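/- Let $n\ge 1$ and $\lambda_{\min},\lambda_{\max}>0$. For every $\sigma\in(0,2)$ there are constants $\alpha=\alpha(n,\lambda_{\min},\lambda_{\max},\sigma)\in(0,1)$ and $C=C(n,\lambda_{\min},\lambda_{\max},\sigma)>0$ with the following property. For each $x\in B_1\subset\mathbb R^n$ let $K_x:\mathbb R^n\to\mathbb R$ be a measurable kernel with $K_x(-y)=K_x(y)$ for all $y$ and $$\lambda_{\min}\,(2-\sigma)|y|^{-n-\sigma}\le K_x(y)\le\lambda_{\max}\,(2-\sigma)|y|^{-n-\sigma}\qquad (y\ne0),$$ let $f:B_1\to\mathbb R$, and let $u:\mathbb R^n\to\mathbb R$ be continuous in $B_1$ with $\int_{\mathbb R^n}\frac{|u(y)|}{1+|y|^{n+\sigma}}\,dy<\infty$. Suppose that $u$ is a viscosity solution of $$\mathcal Lu(x):=\int_{\mathbb R^n}\bigl(u(x+y)-u(x)\bigr)K_x(y)\,dy=f(x)\quad\text{in }B_1,$$ where the integral is understood as $\tfrac12\int_{\mathbb R^n}(u(x+y)+u(x-y)-2u(x))K_x(y)\,dy$ (equivalently, as a principal value). That is: whenever $N\subset B_1$ is open,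 $x\in N$, $\varphi\in C^2(\mathbb R^n)$, $\varphi(x)=u(x)$ and $\varphi>u$ (respectively $\varphi<u$) in $N\setminus\{x\}$, the function $v$ equal to $\varphi$ in $N$ and to $u$ in $\mathbb R^n\setminus N$ satisfies $\mathcal Lv(x)\ge f(x)$ (respectively $\mathcal Lv(x)\le f(x)$). Then $$\|u\|_{C^\alpha(B_{1/2})}\le C\left(\sup_{B_1}|f|+\sup_{B_1}|u|+(2-\sigma)\int_{\mathbb R^n\setminus B_1}\frac{|u(y)|}{|y|^{n+\sigma}}\,dy\right),$$ where $\|u\|_{C^\alpha(B_{1/2})}=\sup_{B_{1/2}}|u|+\sup_{x\ne y\in B_{1/2}}\frac{|u(x)-u(y)|}{|x-y|^\alpha}$; the estimate is void if the right-hand side is infinite. Moreover, $\alpha$ and $C$ can be chosen independent of $\sigma$ for $\sigma$ close to $2$: there is $\sigma_0=\sigma_0(n,\lambda_{\min},\lambda_{\max})\in(0,2)$ such that $\alpha$ and $C$ are constant on $(\sigma_0,2)$, so that there they depend only on $n,\lambda_{\min},\lambda_{\max}$. -/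

import Mathlib

open MeasureTheory Set Filter Topology
open scoped ENNReal NNReal

namespace NonlocalHolder

/-- The Euclidean space `ℝⁿ`. -/
abbrev Rn (n : ℕ) : Type := EuclideanSpace ℝ (Fin n)

/-- The model kernel `K_σ(y) = (2 - σ) |y|^{-n-σ}`. -/
noncomputable def modelKernel (n : ℕ) (σ : ℝ) (y : Rn n) : ℝ :=
  (2 - σ) * ‖y‖ ^ (-(n : ℝ) - σ)

/-- A measurable, symmetric kernel which is comparable to the model kernel `K_σ`
with constants `lmin` and `lmax`. -/
structure IsComparableKernel (n : ℕ) (σ lmin lmax : ℝ) (k : Rn n → ℝ) : Prop where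
  measurable : Measurable k
  symm : ∀ y, k (-y) = k y
  lower : ∀ y, y ≠ 0 → lmin * modelKernel n σ y ≤ k y
  upper : ∀ y, y ≠ 0 → k y ≤ lmax * modelKernel n σ y

/-- The integro-differential operator `∫ (v(x+y) - v(x)) k(y) dy` with a symmetric kernel `k`.
For `σ ≥ 1` this integral is a principal value; as usual it is written in the symmetrized,
absolutely convergent form `½ ∫ (v(x+y) + v(x-y) - 2 v(x)) k(y) dy`
(see `tendsto_truncated` for the agreement of the two). -/
noncomputable def nonlocalOp {n : ℕ} (k : Rn n → ℝ) (v : Rn n → ℝ) (x : Rn n) : ℝ :=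
  (1 / 2) * ∫ y, (v (x + y) + v (x - y) - 2 * v x) * k y

/-- The symmetrized operator is the principal value of `∫ (v(x+y) - v(x)) k(y) dy`. -/
theorem tendsto_truncated {n : ℕ} {k v : Rn n → ℝ} {x : Rn n}
    (hk : ∀ y, k (-y) = k y)
    (hfar : ∀ ε > 0, IntegrableOn (fun y => (v (x + y) - v x) * k y) {y | ε < ‖y‖})
    (hsym : Integrable (fun y => (v (x + y) + v (x - y) - 2 * v x) * k y)) :
    Tendsto (fun ε : ℝ => ∫ y in {y | ε < ‖y‖}, (v (x + y) - v x) * k y)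
      (𝓝[>] 0) (𝓝 (nonlocalOp k v x)) := by
  have hmeas : ∀ ε : ℝ, MeasurableSet {y : Rn n | ε < ‖y‖} := fun ε =>
    measurableSet_lt measurable_const measurable_norm
  have hlim : Tendsto (fun ε : ℝ => (1 / 2) * ∫ y,
      ({y : Rn n | ε < ‖y‖}).indicator
        (fun y => (v (x + y) + v (x - y) - 2 * v x) * k y) y)
      (𝓝[>] 0) (𝓝 (nonlocalOp k v x)) := by
    refine Tendsto.const_mul _ ?_
    refine tendsto_integral_filter_of_dominated_convergence
      (fun y => ‖(v (x + y) + v (x - y) - 2 * v x) * k y‖) ?_ ?_ hsym.norm ?_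
    · exact Eventually.of_forall fun ε => hsym.aestronglyMeasurable.indicator (hmeas ε)
    · exact Eventually.of_forall fun ε => Eventually.of_forall fun y =>
        norm_indicator_le_norm_self _ _
    · refine Eventually.of_forall fun y => ?_
      rcases eq_or_ne y 0 with rfl | hy
      · refine tendsto_const_nhds.congr fun ε => ?_
        have h0 : (v (x + 0) + v (x - 0) - 2 * v x) * k 0 = 0 := by
          rw [add_zero, sub_zero]; ring
        by_cases h : (0 : Rn n) ∈ {y : Rn n | ε < ‖y‖}
        · rw [indicator_of_mem h]
        · rw [indicator_of_notMem h, h0]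
      · refine tendsto_const_nhds.congr' ?_
        have : ∀ᶠ ε : ℝ in 𝓝[>] 0, ε < ‖y‖ :=
          mem_nhdsWithin_of_mem_nhds (Iio_mem_nhds (norm_pos_iff.mpr hy))
        filter_upwards [this] with ε hε
        rw [indicator_of_mem (show y ∈ {y : Rn n | ε < ‖y‖} from hε)]
  refine hlim.congr' ?_
  filter_upwards [self_mem_nhdsWithin] with ε hε
  have hI : Integrable (({y : Rn n | ε < ‖y‖}).indicator
      (fun y => (v (x + y) - v x) * k y)) := (hfar ε hε).integrable_indicator (hmeas ε)
  rw [← integral_indicator (hmeas ε)]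
  have hneg := integral_neg_eq_self (({y : Rn n | ε < ‖y‖}).indicator
      (fun y => (v (x + y) - v x) * k y)) volume
  have hsum : ∀ y : Rn n, ({y : Rn n | ε < ‖y‖}).indicator
      (fun y => (v (x + y) + v (x - y) - 2 * v x) * k y) y =
      ({y : Rn n | ε < ‖y‖}).indicator (fun y => (v (x + y) - v x) * k y) y +
      ({y : Rn n | ε < ‖y‖}).indicator (fun y => (v (x + y) - v x) * k y) (-y) := by
    intro y
    simp only [indicator_apply, mem_ofPred_eq, norm_neg, hk, ← sub_eq_add_neg]
    split_ifs <;> ring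
  simp_rw [hsum]
  rw [integral_add hI hI.comp_neg, hneg]
  ring

open Classical in
/-- The function equal to `φ` in `N` and to `u` outside `N`. -/
noncomputable def glue {n : ℕ} (N : Set (Rn n)) (φ u : Rn n → ℝ) : Rn n → ℝ :=
  fun z => if z ∈ N then φ z else u z

/-- `L u ≥ f` in `Ω` in the viscosity sense, where `L u (x) = ∫ (u(x+y) - u(x)) K_x(y) dy`:
whenever a `C²` function `φ` touches `u` strictly from above at `x ∈ Ω` in an open
neighborhood `N ⊆ Ω` of `x`, the function equal to `φ` in `N` and to `u` outside `N`
satisfies the inequality at `x`. -/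
def IsViscositySubsolution {n : ℕ} (K : Rn n → Rn n → ℝ) (f : Rn n → ℝ) (Ω : Set (Rn n))
    (u : Rn n → ℝ) : Prop :=
  ∀ (x : Rn n) (N : Set (Rn n)) (φ : Rn n → ℝ), x ∈ N → IsOpen N → N ⊆ Ω →
    ContDiff ℝ 2 φ → φ x = u x → (∀ z ∈ N, z ≠ x → u z < φ z) →
    f x ≤ nonlocalOp (K x) (glue N φ u) x

/-- `L u ≤ f` in `Ω` in the viscosity sense (test functions touch `u` from below). -/
def IsViscositySupersolution {n : ℕ} (K : Rn n → Rn n → ℝ) (f : Rn n → ℝ) (Ω : Set (Rn n))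
    (u : Rn n → ℝ) : Prop :=
  ∀ (x : Rn n) (N : Set (Rn n)) (φ : Rn n → ℝ), x ∈ N → IsOpen N → N ⊆ Ω →
    ContDiff ℝ 2 φ → φ x = u x → (∀ z ∈ N, z ≠ x → φ z < u z) →
    nonlocalOp (K x) (glue N φ u) x ≤ f x

/-- `u : ℝⁿ → ℝ` is a viscosity solution of `∫ (u(x+y) - u(x)) K_x(y) dy = f(x)` in `Ω`, for
kernels of order `σ`. The integrability of `u` against `(1 + |y|^{n+σ})⁻¹` is what makes the
integrals that define the equation converge. -/
structure IsViscositySolution {n : ℕ} (σ : ℝ) (K : Rn n → Rn n → ℝ) (f : Rn n → ℝ)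
    (Ω : Set (Rn n)) (u : Rn n → ℝ) : Prop where
  integrable : Integrable (fun y => u y / (1 + ‖y‖ ^ ((n : ℝ) + σ)))
  continuousOn : ContinuousOn u Ω
  sub : IsViscositySubsolution K f Ω u
  super : IsViscositySupersolution K f Ω u

/-- The supremum norm of `u` on `S`, possibly infinite. -/
noncomputable def supNormOn {n : ℕ} (S : Set (Rn n)) (u : Rn n → ℝ) : ℝ≥0∞ :=
  ⨆ x ∈ S, ‖u x‖ₑ

/-- The Hölder norm `‖u‖_{C^α(S)} = sup_S |u| + [u]_{C^α(S)}`, possibly infinite. -/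
noncomputable def holderNormOn {n : ℕ} (α : ℝ≥0) (S : Set (Rn n)) (u : Rn n → ℝ) : ℝ≥0∞ :=
  supNormOn S u + eHolderNorm α (S.domRestrict u)

/-- The tail `(2 - σ) ∫_{ℝⁿ \ B₁} |u(y)| |y|^{-n-σ} dy`, possibly infinite. -/
noncomputable def tail {n : ℕ} (σ : ℝ) (u : Rn n → ℝ) : ℝ≥0∞ :=
  ENNReal.ofReal (2 - σ) * ∫⁻ y in (Metric.ball (0 : Rn n) 1)ᶜ, ‖u y‖ₑ / ‖y‖ₑ ^ ((n : ℝ) + σ)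

end NonlocalHolder

namespace NonlocalHolder

/-! The Hölder bound is geometric decay of oscillation, and the decay rests on a growth lemma of
Krylov–Safonov type: a nonnegative supersolution that exceeds 1 on half of a ball is bounded below
by some κ > 0 there (`exists_growth`). All constants are uniform for orders in `[σ₀, 2)`: the factor
2 - σ keeps the second moment of the kernel near the origin and its mass away from the origin under
control as σ → 2.

The heart is `exists_point_estimate`, which replaces the Aleksandrov–Bakelman–Pucci estimate. For
every small slope p, a Gaussian plus a linear function of slope p is slid under u. The Gaussian is a
strict subsolution away from its centre, so the contact happens near the origin, and the equation at
the contact point bounds the integral of the gap against the kernel (`exists_contact`). Since (2 -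
σ) ∑ r^(2-σ) over dyadic radii r is bounded below, the gap cannot exceed C₁r² on a fixed fraction of
the ball of radius r for all dyadic r (`exists_radius_mostly_below_paraboloid`). At a good radius R
two things follow: u is bounded on at least half of the ball of radius R/20 about the contact point,
and all slopes with contact points within R/4 differ from p by at most 4C₁R (`norm_slope_sub_le`). A
Vitali covering then bounds the volume of the set of slopes by the volume of the set where u is
bounded. The map from slopes to contact points needs no regularity.

The growing ink spots lemma turns the point estimate into the growth lemma. In the oscillation decay
the rescaled solution may be negative far away; its negative part is moved into the right-hand side
(`Supersol.posPart`) and is small because oscillation at larger scales grows only like |z|^α with α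
≤ σ₀/2, and because the tail of u is small after normalization (`rescaled_tail_le`). -/

/-- The area of the unit sphere of `ℝⁿ`. -/
noncomputable def sphereArea (n : ℕ) : ℝ := n * volume.real (Metric.ball (0 : Rn n) 1)

lemma volume_unitBall_pos (n : ℕ) : 0 < volume.real (Metric.ball (0 : Rn n) 1) :=
  ENNReal.toReal_pos (Metric.measure_ball_pos _ _ one_pos).ne' measure_ball_lt_top.ne

lemma sphereArea_pos (n : ℕ) [NeZero n] : 0 < sphereArea n :=
  mul_pos (Nat.cast_pos.2 (NeZero.pos n)) (volume_unitBall_pos n)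

instance nontrivial_Rn (n : ℕ) [NeZero n] : Nontrivial (Rn n) :=
  Module.nontrivial_of_finrank_pos (R := ℝ) (by simp [NeZero.pos n])

lemma volume_closedBall_Rn {n : ℕ} (x : Rn n) {r : ℝ} (hr : 0 ≤ r) :
    volume.real (Metric.closedBall x r) = r ^ n * volume.real (Metric.ball (0 : Rn n) 1) := by
  rw [Measure.real, Measure.addHaar_closedBall _ _ hr, ENNReal.toReal_mul,
    ENNReal.toReal_ofReal (by positivity), finrank_euclideanSpace, Fintype.card_fin]
  rfl

lemma volume_ball_Rn {n : ℕ} (x : Rn n) {r : ℝ} (hr : 0 < r) :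
    volume.real (Metric.ball x r) = r ^ n * volume.real (Metric.ball (0 : Rn n) 1) := by
  rw [Measure.real, Measure.addHaar_ball_of_pos _ _ hr, ENNReal.toReal_mul,
    ENNReal.toReal_ofReal (by positivity), finrank_euclideanSpace, Fintype.card_fin]
  rfl

/-! ### Integrals of powers of |y| inside and outside balls. -/

section RadialPowers

variable {n : ℕ}

lemma indicator_compl_ball_norm (r : ℝ) (f : ℝ → ℝ) (y : Rn n) :
    (Metric.ball (0 : Rn n) r)ᶜ.indicator (fun y => f ‖y‖) y = (Ici r).indicator f ‖y‖ := by
  by_cases h : r ≤ ‖y‖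
  · rw [indicator_of_mem (by simpa using h), indicator_of_mem (mem_Ici.2 h)]
  · rw [indicator_of_notMem (by simpa using h), indicator_of_notMem (by simpa using h)]

lemma indicator_ball_norm (r : ℝ) (f : ℝ → ℝ) (y : Rn n) :
    (Metric.ball (0 : Rn n) r).indicator (fun y => f ‖y‖) y = (Iio r).indicator f ‖y‖ := by
  by_cases h : ‖y‖ < r
  · rw [indicator_of_mem (by simpa using h), indicator_of_mem (mem_Iio.2 h)]
  · rw [indicator_of_notMem (by simpa using h), indicator_of_notMem (by simpa using h)]

variable [NeZero n]

lemma pow_pred_mul_rpow {y : ℝ} (hy : 0 < y) (τ : ℝ) :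
    y ^ (Module.finrank ℝ (Rn n) - 1) * y ^ (-(n : ℝ) + τ) = y ^ (τ - 1) := by
  have h1 : 1 ≤ n := NeZero.one_le
  rw [finrank_euclideanSpace, Fintype.card_fin, ← Real.rpow_natCast, ← Real.rpow_add hy,
    Nat.cast_sub h1]
  congr 1
  push_cast
  ring

lemma far_integrand_eq (r τ : ℝ) :
    EqOn (fun y : ℝ => y ^ (Module.finrank ℝ (Rn n) - 1) • (Ici r).indicator
      (fun s => s ^ (-(n : ℝ) - τ)) y) ((Ici r).indicator fun s => s ^ (-τ - 1)) (Ioi 0) := by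
  intro y hy
  by_cases h : r ≤ y
  · simp only [smul_eq_mul, indicator_of_mem (mem_Ici.2 h), sub_eq_add_neg (-(n : ℝ))]
    exact pow_pred_mul_rpow hy _
  · simp [h]

lemma near_integrand_eq (r τ : ℝ) :
    EqOn (fun y : ℝ => y ^ (Module.finrank ℝ (Rn n) - 1) • (Iio r).indicator
      (fun s => s ^ (-(n : ℝ) + τ)) y) ((Iio r).indicator fun s => s ^ (τ - 1)) (Ioi 0) := by
  intro y hy
  by_cases h : y < r
  · simp only [smul_eq_mul, indicator_of_mem (mem_Iio.2 h)]
    exact pow_pred_mul_rpow hy _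
  · simp [h]

lemma integrableOn_far {r τ : ℝ} (hr : 0 < r) (hτ : 0 < τ) :
    IntegrableOn (fun y : Rn n => ‖y‖ ^ (-(n : ℝ) - τ)) (Metric.ball 0 r)ᶜ := by
  rw [← integrable_indicator_iff Metric.isOpen_ball.measurableSet.compl]
  have := indicator_compl_ball_norm (n := n) r (fun s => s ^ (-(n : ℝ) - τ))
  rw [funext this, integrable_fun_norm_addHaar volume,
    integrableOn_congr_fun (far_integrand_eq r τ) measurableSet_Ioi]
  rw [integrableOn_indicator_iff measurableSet_Ici,
    inter_eq_self_of_subset_left (Ici_subset_Ioi.2 hr), integrableOn_Ici_iff_integrableOn_Ioi]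
  exact integrableOn_Ioi_rpow_of_lt (by linarith) hr

lemma integral_far {r τ : ℝ} (hr : 0 < r) (hτ : 0 < τ) :
    ∫ y in (Metric.ball (0 : Rn n) r)ᶜ, ‖y‖ ^ (-(n : ℝ) - τ) = sphereArea n * (r ^ (-τ) / τ) := by
  rw [← integral_indicator Metric.isOpen_ball.measurableSet.compl]
  have := indicator_compl_ball_norm (n := n) r (fun s => s ^ (-(n : ℝ) - τ))
  rw [integral_congr_ae (ae_of_all _ this), integral_fun_norm_addHaar volume,
    setIntegral_congr_fun measurableSet_Ioi (far_integrand_eq r τ),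
    setIntegral_indicator measurableSet_Ici,
    inter_eq_self_of_subset_right (Ici_subset_Ioi.2 hr),
    integral_Ici_eq_integral_Ioi, integral_Ioi_rpow_of_lt (by linarith) hr, sphereArea]
  simp only [finrank_euclideanSpace, Fintype.card_fin, nsmul_eq_mul, smul_eq_mul,
    sub_add_cancel, neg_div_neg_eq]
  rw [mul_assoc]

lemma integrableOn_near (r : ℝ) {τ : ℝ} (hτ : 0 < τ) :
    IntegrableOn (fun y : Rn n => ‖y‖ ^ (-(n : ℝ) + τ)) (Metric.ball 0 r) := by
  rw [← integrable_indicator_iff Metric.isOpen_ball.measurableSet]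
  have := indicator_ball_norm (n := n) r (fun s => s ^ (-(n : ℝ) + τ))
  rw [funext this, integrable_fun_norm_addHaar volume,
    integrableOn_congr_fun (near_integrand_eq r τ) measurableSet_Ioi,
    integrableOn_indicator_iff measurableSet_Iio, Iio_inter_Ioi]
  rcases le_or_gt r 0 with hr | hr
  · simp [hr]
  · exact ((intervalIntegrable_iff_integrableOn_Ioo_of_le hr.le).1
      (intervalIntegral.intervalIntegrable_rpow' (by linarith)))

lemma integral_near {r τ : ℝ} (hr : 0 < r) (hτ : 0 < τ) :
    ∫ y in Metric.ball (0 : Rn n) r, ‖y‖ ^ (-(n : ℝ) + τ) = sphereArea n * (r ^ τ / τ) := by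
  rw [← integral_indicator Metric.isOpen_ball.measurableSet]
  have := indicator_ball_norm (n := n) r (fun s => s ^ (-(n : ℝ) + τ))
  rw [integral_congr_ae (ae_of_all _ this), integral_fun_norm_addHaar volume,
    setIntegral_congr_fun measurableSet_Ioi (near_integrand_eq r τ),
    setIntegral_indicator measurableSet_Iio, Ioi_inter_Iio, ← integral_Ioc_eq_integral_Ioo,
    ← intervalIntegral.integral_of_le hr.le, integral_rpow (by left; linarith), sphereArea]
  simp only [finrank_euclideanSpace, Fintype.card_fin, nsmul_eq_mul, smul_eq_mul,
    sub_add_cancel, Real.zero_rpow hτ.ne', sub_zero]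
  rw [mul_assoc]

end RadialPowers

/-! ### Moments of the model kernel. -/

section Kernel

variable {n : ℕ}

lemma modelKernel_nonneg {σ : ℝ} (hσ : σ < 2) (y : Rn n) : 0 ≤ modelKernel n σ y :=
  mul_nonneg (by linarith) (Real.rpow_nonneg (norm_nonneg _) _)

lemma measurable_modelKernel (σ : ℝ) : Measurable (modelKernel n σ) := by
  unfold modelKernel; fun_prop

lemma ae_ne_zero [NeZero n] : ∀ᵐ y : Rn n, y ≠ 0 :=
  Measure.ae_ne volume 0

lemma norm_sq_mul_modelKernel {σ : ℝ} {y : Rn n} (hy : y ≠ 0) :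
    ‖y‖ ^ 2 * modelKernel n σ y = (2 - σ) * ‖y‖ ^ (-(n : ℝ) + (2 - σ)) := by
  have h : 0 < ‖y‖ := norm_pos_iff.2 hy
  rw [modelKernel, mul_left_comm, ← Real.rpow_natCast ‖y‖ 2, ← Real.rpow_add h]
  congr 2
  push_cast
  ring

lemma norm_rpow_mul_modelKernel {σ : ℝ} (β : ℝ) {y : Rn n} (hy : y ≠ 0) :
    ‖y‖ ^ β * modelKernel n σ y = (2 - σ) * ‖y‖ ^ (-(n : ℝ) - (σ - β)) := by
  have h : 0 < ‖y‖ := norm_pos_iff.2 hy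
  rw [modelKernel, mul_left_comm, ← Real.rpow_add h]
  congr 2
  ring

/-- The reflection in the hyperplane orthogonal to x - x' carries x to x' and preserves both |y| and
Lebesgue measure. -/
lemma integral_inner_sq_radial_eq (g : ℝ → ℝ) {x x' : Rn n} (h : ‖x‖ = ‖x'‖) :
    ∫ y : Rn n, inner ℝ x y ^ 2 * g ‖y‖ = ∫ y : Rn n, inner ℝ x' y ^ 2 * g ‖y‖ := by
  set ρ := (ℝ ∙ (x - x'))ᗮ.reflection
  have hρ : ρ x = x' := Submodule.reflection_sub h
  rw [← (ρ.measurePreserving).integral_comp ρ.toHomeomorph.measurableEmbedding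
    (fun y => inner ℝ x' y ^ 2 * g ‖y‖)]
  simp [← hρ]

variable [NeZero n]

lemma integrableOn_norm_sq_modelKernel {σ : ℝ} (hσ : σ < 2) (r : ℝ) :
    IntegrableOn (fun y : Rn n => ‖y‖ ^ 2 * modelKernel n σ y) (Metric.ball 0 r) := by
  refine ((integrableOn_near r (sub_pos.2 hσ)).const_mul (2 - σ)).congr ?_
  filter_upwards [ae_restrict_of_ae ae_ne_zero] with y hy
  exact (norm_sq_mul_modelKernel hy).symm

lemma integral_norm_sq_modelKernel {σ r : ℝ} (hσ : σ < 2) (hr : 0 < r) :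
    ∫ y in Metric.ball (0 : Rn n) r, ‖y‖ ^ 2 * modelKernel n σ y =
      sphereArea n * r ^ (2 - σ) := by
  have : ∫ y in Metric.ball (0 : Rn n) r, ‖y‖ ^ 2 * modelKernel n σ y =
      ∫ y in Metric.ball (0 : Rn n) r, (2 - σ) * ‖y‖ ^ (-(n : ℝ) + (2 - σ)) := by
    refine integral_congr_ae ?_
    filter_upwards [ae_restrict_of_ae ae_ne_zero] with y hy
    exact norm_sq_mul_modelKernel hy
  rw [this, integral_const_mul, integral_near hr (sub_pos.2 hσ)]
  field_simp [(sub_pos.2 hσ).ne']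

lemma integrableOn_rpow_modelKernel {σ β r : ℝ} (hβ : β < σ) (hr : 0 < r) :
    IntegrableOn (fun y : Rn n => ‖y‖ ^ β * modelKernel n σ y) (Metric.ball 0 r)ᶜ := by
  refine ((integrableOn_far hr (sub_pos.2 hβ)).const_mul (2 - σ)).congr ?_
  filter_upwards [ae_restrict_of_ae ae_ne_zero] with y hy
  exact (norm_rpow_mul_modelKernel β hy).symm

lemma integral_rpow_modelKernel {σ β r : ℝ} (hβ : β < σ) (hr : 0 < r) :
    ∫ y in (Metric.ball (0 : Rn n) r)ᶜ, ‖y‖ ^ β * modelKernel n σ y =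
      (2 - σ) * (sphereArea n * (r ^ (-(σ - β)) / (σ - β))) := by
  rw [← integral_far hr (sub_pos.2 hβ), ← integral_const_mul]
  refine integral_congr_ae ?_
  filter_upwards [ae_restrict_of_ae ae_ne_zero] with y hy
  exact norm_rpow_mul_modelKernel β hy

lemma integrableOn_modelKernel {σ r : ℝ} (hσ : 0 < σ) (hr : 0 < r) :
    IntegrableOn (modelKernel n σ) (Metric.ball 0 r)ᶜ := by
  simpa using integrableOn_rpow_modelKernel hσ hr

lemma integral_modelKernel {σ r : ℝ} (hσ : 0 < σ) (hr : 0 < r) :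
    ∫ y in (Metric.ball (0 : Rn n) r)ᶜ, modelKernel n σ y =
      (2 - σ) * (sphereArea n * (r ^ (-σ) / σ)) := by
  simpa using integral_rpow_modelKernel (n := n) hσ hr

/-- By symmetry x may be replaced by |x| times any coordinate vector; summing over the n coordinates
yields the factor 1/n. -/
lemma integral_inner_sq_radial (g : ℝ → ℝ) (hg : Integrable fun y : Rn n => ‖y‖ ^ 2 * g ‖y‖)
    (hgm : Measurable g) (x : Rn n) :
    ∫ y : Rn n, inner ℝ x y ^ 2 * g ‖y‖ = ‖x‖ ^ 2 / n * ∫ y : Rn n, ‖y‖ ^ 2 * g ‖y‖ := by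
  have hn : (n : ℝ) ≠ 0 := Nat.cast_ne_zero.2 (NeZero.ne n)
  have hi : ∀ i : Fin n, ∫ y : Rn n, inner ℝ x y ^ 2 * g ‖y‖ =
      ∫ y : Rn n, ‖x‖ ^ 2 * ((y i) ^ 2 * g ‖y‖) := by
    intro i
    rw [integral_inner_sq_radial_eq (x' := ‖x‖ • EuclideanSpace.single i (1 : ℝ)) g
      (by simp [norm_smul])]
    refine integral_congr_ae (ae_of_all _ fun y => ?_)
    simp [inner_smul_left, EuclideanSpace.inner_single_left]
    ring
  have hint : ∀ i : Fin n, Integrable fun y : Rn n => ‖x‖ ^ 2 * ((y i) ^ 2 * g ‖y‖) := by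
    intro i
    refine (hg.mono (by fun_prop) (ae_of_all _ fun y => ?_)).const_mul _
    rw [norm_mul, norm_mul, norm_pow, norm_pow, norm_norm]
    gcongr
    exact PiLp.norm_apply_le y i
  have hsum : ∑ i : Fin n, ∫ y : Rn n, ‖x‖ ^ 2 * ((y i) ^ 2 * g ‖y‖) =
      ‖x‖ ^ 2 * ∫ y : Rn n, ‖y‖ ^ 2 * g ‖y‖ := by
    rw [← integral_finsetSum _ fun i _ => hint i, ← integral_const_mul]
    refine integral_congr_ae (ae_of_all _ fun y => ?_)
    simp only [← Finset.mul_sum, ← Finset.sum_mul]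
    rw [EuclideanSpace.real_norm_sq_eq y]
  rw [← Finset.sum_congr rfl fun i _ => hi i, Finset.sum_const, Finset.card_univ, Fintype.card_fin,
    nsmul_eq_mul] at hsum
  field_simp
  linarith

lemma integral_inner_sq_modelKernel {σ r : ℝ} (hσ : σ < 2) (hr : 0 < r) (x : Rn n) :
    ∫ y in Metric.ball (0 : Rn n) r, inner ℝ x y ^ 2 * modelKernel n σ y =
      ‖x‖ ^ 2 / n * (sphereArea n * r ^ (2 - σ)) := by
  set g : ℝ → ℝ := (Iio r).indicator fun s => (2 - σ) * s ^ (-(n : ℝ) - σ)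
  have hgm : Measurable g := by
    refine Measurable.indicator ?_ measurableSet_Iio
    fun_prop
  have hg : ∀ (a : Rn n → ℝ) (y : Rn n), (Metric.ball (0 : Rn n) r).indicator
      (fun y => a y * modelKernel n σ y) y = a y * g ‖y‖ := by
    intro a y
    by_cases h : ‖y‖ < r
    · rw [indicator_of_mem (by simpa using h)]
      simp only [g]
      rw [indicator_of_mem (by simpa using h)]
      rfl
    · rw [indicator_of_notMem (by simpa using h)]
      simp only [g]
      rw [indicator_of_notMem (by simpa using h), mul_zero]
  rw [← integral_norm_sq_modelKernel hσ hr, ← integral_indicator Metric.isOpen_ball.measurableSet,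
    ← integral_indicator Metric.isOpen_ball.measurableSet,
    integral_congr_ae (ae_of_all _ (hg fun y => inner ℝ x y ^ 2)),
    integral_congr_ae (ae_of_all _ (hg fun y => ‖y‖ ^ 2))]
  refine integral_inner_sq_radial g ?_ hgm x
  rw [← funext (hg fun y => ‖y‖ ^ 2), integrable_indicator_iff Metric.isOpen_ball.measurableSet]
  exact integrableOn_norm_sq_modelKernel hσ r

end Kernel

/-! ### Second differences of smooth functions. -/

section SecondDifference

variable {n : ℕ}

/-- The symmetric second difference of a `C²` function is `O(|y|²)`. -/
lemma exists_secondDifference_le {φ : Rn n → ℝ} (hφ : ContDiff ℝ 2 φ) (x : Rn n) :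
    ∃ C ρ, 0 ≤ C ∧ 0 < ρ ∧ ∀ y, ‖y‖ < ρ → |φ (x + y) + φ (x - y) - 2 * φ x| ≤ C * ‖y‖ ^ 2 := by
  have h1 : ContDiff ℝ 1 (fderiv ℝ φ) := hφ.fderiv_right (by norm_num)
  obtain ⟨L, t, ht, hL⟩ := h1.contDiffAt.exists_lipschitzOnWith (x := x)
  obtain ⟨ρ, hρ, hρt⟩ := Metric.mem_nhds_iff.1 ht
  refine ⟨2 * L, ρ, by positivity, hρ, fun y hy => ?_⟩
  have hd : Differentiable ℝ φ := hφ.differentiable (by norm_num)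
  -- `g` runs from 2φ(x) at s = 0 to φ(x+y) + φ(x-y) at s = 1, and its derivative is O(|y|²) because
  -- Dφ is Lipschitz near x.
  set g : ℝ → ℝ := fun s => φ (x + s • y) + φ (x - s • y)
  have hg : ∀ s, HasDerivAt g (fderiv ℝ φ (x + s • y) y - fderiv ℝ φ (x - s • y) y) s := by
    intro s
    have e1 : HasDerivAt (fun s : ℝ => x + s • y) y s := by
      simpa using ((hasDerivAt_id s).smul_const y).const_add x
    have e2 : HasDerivAt (fun s : ℝ => x - s • y) (-y) s := by
      simpa using ((hasDerivAt_id s).smul_const y).const_sub x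
    have := ((hd _).hasFDerivAt.comp_hasDerivAt s e1).add ((hd _).hasFDerivAt.comp_hasDerivAt s e2)
    refine this.congr_deriv ?_
    simp [sub_eq_add_neg]
  have hb : ∀ s ∈ Ico (0 : ℝ) 1,
      ‖fderiv ℝ φ (x + s • y) y - fderiv ℝ φ (x - s • y) y‖ ≤ 2 * L * ‖y‖ ^ 2 := by
    intro s hs
    have hsy : ‖s • y‖ < ρ := by
      rw [norm_smul, Real.norm_of_nonneg hs.1]
      nlinarith [norm_nonneg y, hs.1, hs.2]
    have m1 : x + s • y ∈ t := hρt (by simpa using hsy)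
    have m2 : x - s • y ∈ t := hρt (by simpa [dist_eq_norm] using hsy)
    have := hL.norm_sub_le m1 m2
    have e : x + s • y - (x - s • y) = (2 * s) • y := by module
    rw [e, norm_smul, Real.norm_of_nonneg (by linarith [hs.1])] at this
    rw [← _root_.sub_apply]
    refine (ContinuousLinearMap.le_opNorm _ _).trans ?_
    have : ‖fderiv ℝ φ (x + s • y) - fderiv ℝ φ (x - s • y)‖ ≤ 2 * L * ‖y‖ :=
      this.trans (by
        have := mul_nonneg L.2 (norm_nonneg y)
        change (0:ℝ) ≤ (L:ℝ) * ‖y‖ at this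
        nlinarith [hs.2])
    calc _ ≤ 2 * L * ‖y‖ * ‖y‖ := by gcongr
      _ = _ := by ring
  have := norm_image_sub_le_of_norm_deriv_le_segment' (f := g)
    (fun s _ => (hg s).hasDerivWithinAt) hb 1 (right_mem_Icc.2 zero_le_one)
  simpa [g, two_mul, sub_sub] using this

end SecondDifference

/-! ### The weighted integrability class and its invariances. -/

section TailIntegrable

variable {n : ℕ}

/-- Integrability against the weight `(1 + |y|^{n+σ})⁻¹`. -/
def TailIntegrable (σ : ℝ) (u : Rn n → ℝ) : Prop :=
  Integrable fun y => u y / (1 + ‖y‖ ^ ((n : ℝ) + σ))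

lemma weight_pos (q : ℝ) (y : Rn n) : 0 < 1 + ‖y‖ ^ q := by
  have := Real.rpow_nonneg (norm_nonneg y) q
  linarith

/-- Translations and dilations change the weight only by a bounded factor, so `TailIntegrable`
survives the rescalings of the iteration. -/
lemma weight_comp_affine_le {q r : ℝ} (hq : 0 ≤ q) (hr : 0 ≤ r) (x z : Rn n) :
    1 + ‖x + r • z‖ ^ q ≤ (1 + (‖x‖ + r) ^ q) * (1 + ‖z‖ ^ q) := by
  have hx := norm_nonneg x
  have hz := norm_nonneg z
  have h1 : ‖x + r • z‖ ≤ (‖x‖ + r) * max 1 ‖z‖ := by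
    refine (norm_add_le _ _).trans ?_
    rw [norm_smul, Real.norm_of_nonneg hr, add_mul]
    gcongr
    · exact le_mul_of_one_le_right hx (le_max_left _ _)
    · exact le_max_right _ _
  have h2 : (max 1 ‖z‖) ^ q ≤ 1 + ‖z‖ ^ q := by
    have := Real.rpow_nonneg hz q
    rcases max_choice 1 ‖z‖ with h | h <;> rw [h]
    · rw [Real.one_rpow]; linarith
    · linarith
  have h3 : ‖x + r • z‖ ^ q ≤ (‖x‖ + r) ^ q * (1 + ‖z‖ ^ q) := by
    calc _ ≤ ((‖x‖ + r) * max 1 ‖z‖) ^ q := Real.rpow_le_rpow (norm_nonneg _) h1 hq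
      _ = (‖x‖ + r) ^ q * (max 1 ‖z‖) ^ q := Real.mul_rpow (by positivity) (by positivity)
      _ ≤ _ := by gcongr
  have := Real.rpow_nonneg hz q
  nlinarith

lemma measurable_weight (q : ℝ) : Measurable fun y : Rn n => 1 + ‖y‖ ^ q := by fun_prop

lemma TailIntegrable.aestronglyMeasurable {σ : ℝ} {u : Rn n → ℝ} (hu : TailIntegrable σ u) :
    AEStronglyMeasurable u := by
  refine (Integrable.aestronglyMeasurable hu |>.mul
    (measurable_weight ((n : ℝ) + σ)).aestronglyMeasurable).congr (ae_of_all _ fun y => ?_)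
  exact div_mul_cancel₀ _ (weight_pos _ y).ne'

lemma TailIntegrable.mono {σ : ℝ} {u v : Rn n → ℝ} (hu : TailIntegrable σ u)
    (hv : AEStronglyMeasurable v) (h : ∀ y, |v y| ≤ |u y|) : TailIntegrable σ v := by
  refine Integrable.mono hu (hv.mul (measurable_weight _).inv.aestronglyMeasurable)
    (ae_of_all _ fun y => ?_)
  rw [norm_div, norm_div]
  gcongr
  exact h y

lemma TailIntegrable.add {σ : ℝ} {u v : Rn n → ℝ} (hu : TailIntegrable σ u)
    (hv : TailIntegrable σ v) : TailIntegrable σ fun y => u y + v y := by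
  exact (Integrable.add hu hv).congr (ae_of_all _ fun y => (add_div _ _ _).symm)

lemma TailIntegrable.const_mul {σ : ℝ} {u : Rn n → ℝ} (hu : TailIntegrable σ u) (a : ℝ) :
    TailIntegrable σ fun y => a * u y := by
  simpa only [TailIntegrable, mul_div_assoc] using Integrable.const_mul hu a

lemma TailIntegrable.neg {σ : ℝ} {u : Rn n → ℝ} (hu : TailIntegrable σ u) :
    TailIntegrable σ fun y => - u y := by
  simpa using hu.const_mul (-1)

lemma TailIntegrable.sub {σ : ℝ} {u v : Rn n → ℝ} (hu : TailIntegrable σ u)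
    (hv : TailIntegrable σ v) : TailIntegrable σ fun y => u y - v y := by
  exact (Integrable.sub hu hv).congr (ae_of_all _ fun y => (sub_div _ _ _).symm)

lemma TailIntegrable.comp_affine {σ : ℝ} (hσ : 0 < σ) {u : Rn n → ℝ} (hu : TailIntegrable σ u)
    (x : Rn n) {r : ℝ} (hr : 0 < r) : TailIntegrable σ fun z => u (x + r • z) := by
  have h1 : Integrable fun z : Rn n => u (x + r • z) / (1 + ‖x + r • z‖ ^ ((n : ℝ) + σ)) :=
    (Integrable.comp_add_left hu x).comp_smul hr.ne'
  have hm : AEStronglyMeasurable fun z : Rn n => u (x + r • z) := by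
    refine (h1.aestronglyMeasurable.mul (f := fun z : Rn n => u (x + r • z) /
      (1 + ‖x + r • z‖ ^ ((n : ℝ) + σ))) (g := fun z => 1 + ‖x + r • z‖ ^ ((n : ℝ) + σ))
      (Measurable.aestronglyMeasurable (by fun_prop))).congr (ae_of_all _ fun y => ?_)
    exact div_mul_cancel₀ _ (weight_pos _ _).ne'
  refine (h1.norm.const_mul (1 + (‖x‖ + r) ^ ((n : ℝ) + σ))).mono'
    (hm.mul (measurable_weight _).inv.aestronglyMeasurable) (ae_of_all _ fun z => ?_)
  have hq : (0 : ℝ) ≤ n + σ := by positivity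
  have := weight_comp_affine_le hq hr.le x z
  have p1 := weight_pos ((n : ℝ) + σ) z
  have p2 := weight_pos ((n : ℝ) + σ) (x + r • z)
  rw [norm_div, norm_div, Real.norm_of_nonneg p1.le, Real.norm_of_nonneg p2.le, ← mul_div_assoc,
    div_le_div_iff₀ p1 p2]
  calc ‖u (x + r • z)‖ * (1 + ‖x + r • z‖ ^ ((n : ℝ) + σ))
      ≤ ‖u (x + r • z)‖ * ((1 + (‖x‖ + r) ^ ((n : ℝ) + σ)) * (1 + ‖z‖ ^ ((n : ℝ) + σ))) := by
        gcongr
    _ = _ := by ring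

lemma TailIntegrable.comp_neg {σ : ℝ} {u : Rn n → ℝ} (hu : TailIntegrable σ u) :
    TailIntegrable σ fun z => u (-z) := by
  simpa [TailIntegrable] using Integrable.comp_neg hu

/-- Away from its singularity the kernel is dominated by the weight recentred at x, so
`TailIntegrable` makes the far part of the operator converge at every point. -/
lemma modelKernel_le_weight {σ r : ℝ} (hσ0 : 0 < σ) (hr : 0 < r) (x y : Rn n)
    (hy : r ≤ ‖y‖) :
    modelKernel n σ y ≤ (2 * ((1 + (‖x‖ + 1) ^ ((n : ℝ) + σ)) * (r ^ (-((n : ℝ) + σ)) + 1))) /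
      (1 + ‖x + y‖ ^ ((n : ℝ) + σ)) := by
  set q : ℝ := (n : ℝ) + σ with hqdef
  have hq : 0 ≤ q := by positivity
  have hy0 : 0 < ‖y‖ := hr.trans_le hy
  have hyq : 0 < ‖y‖ ^ q := Real.rpow_pos_of_pos hy0 q
  have h1 := weight_comp_affine_le hq zero_le_one x y
  rw [one_smul] at h1
  have h2 : 1 + ‖y‖ ^ q ≤ (r ^ (-q) + 1) * ‖y‖ ^ q := by
    have : 1 ≤ r ^ (-q) * ‖y‖ ^ q := by
      rw [Real.rpow_neg hr.le, ← div_eq_inv_mul, one_le_div (Real.rpow_pos_of_pos hr q)]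
      exact Real.rpow_le_rpow hr.le hy hq
    linarith
  rw [le_div_iff₀ (weight_pos q _), modelKernel, show -(n : ℝ) - σ = -q by simp [q]; ring,
    Real.rpow_neg hy0.le]
  have hc : 0 < 1 + (‖x‖ + 1) ^ q := by positivity
  calc (2 - σ) * (‖y‖ ^ q)⁻¹ * (1 + ‖x + y‖ ^ q)
      ≤ 2 * (‖y‖ ^ q)⁻¹ * ((1 + (‖x‖ + 1) ^ q) * ((r ^ (-q) + 1) * ‖y‖ ^ q)) := by
        gcongr
        · linarith
        · exact h1.trans (by gcongr)
    _ = _ := by field_simp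

lemma TailIntegrable.integrableOn_mul_modelKernel {σ r : ℝ} (hσ0 : 0 < σ) (hσ2 : σ < 2)
    (hr : 0 < r) {u : Rn n → ℝ} (hu : TailIntegrable σ u) (x : Rn n) :
    IntegrableOn (fun y => u (x + y) * modelKernel n σ y) (Metric.ball 0 r)ᶜ := by
  have h1 := Integrable.comp_add_left hu x
  have hm : AEStronglyMeasurable fun y => u (x + y) := by
    simpa using (hu.comp_affine hσ0 x one_pos).aestronglyMeasurable
  refine (h1.integrableOn.norm.const_mul (2 * ((1 + (‖x‖ + 1) ^ ((n : ℝ) + σ)) *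
    (r ^ (-((n : ℝ) + σ)) + 1)))).mono'
    (hm.mul (measurable_modelKernel σ).aestronglyMeasurable).restrict ?_
  filter_upwards [ae_restrict_mem Metric.isOpen_ball.measurableSet.compl] with y hy
  have hy' : r ≤ ‖y‖ := by simpa using hy
  have := modelKernel_le_weight hσ0 hr x y hy'
  rw [norm_mul, norm_div, Real.norm_of_nonneg (modelKernel_nonneg hσ2 y),
    Real.norm_of_nonneg (weight_pos _ _).le]
  calc _ ≤ _ := mul_le_mul_of_nonneg_left this (norm_nonneg _)
    _ = _ := by ring

lemma tailIntegrable_const [NeZero n] {σ : ℝ} (hσ : 0 < σ) (a : ℝ) :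
    TailIntegrable σ fun _ : Rn n => a := by
  refine Integrable.congr (Integrable.const_mul (c := a)
    (f := fun y : Rn n => (1 + ‖y‖ ^ ((n : ℝ) + σ))⁻¹) ?_) (ae_of_all _ fun y => by
      simp [div_eq_mul_inv])
  have hm : Measurable fun y : Rn n => (1 + ‖y‖ ^ ((n : ℝ) + σ))⁻¹ := by fun_prop
  rw [← integrableOn_univ, ← union_compl_self (Metric.ball (0 : Rn n) 1)]
  refine IntegrableOn.union ?_ ?_
  · refine Integrable.mono' (integrableOn_const (C := (1 : ℝ)) measure_ball_lt_top.ne)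
      hm.aestronglyMeasurable (ae_of_all _ fun y => ?_)
    rw [Real.norm_of_nonneg (inv_nonneg.2 (weight_pos _ _).le)]
    refine inv_le_one_of_one_le₀ ?_
    have := Real.rpow_nonneg (norm_nonneg y) ((n : ℝ) + σ)
    linarith
  · refine Integrable.mono' (integrableOn_far one_pos hσ) hm.aestronglyMeasurable ?_
    filter_upwards [ae_restrict_mem Metric.isOpen_ball.measurableSet.compl] with y hy
    have hy' : 0 < ‖y‖ := one_pos.trans_le (by simpa using hy)
    rw [Real.norm_of_nonneg (inv_nonneg.2 (weight_pos _ _).le),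
      show -(n : ℝ) - σ = -((n : ℝ) + σ) by ring, Real.rpow_neg hy'.le]
    gcongr
    linarith

lemma tailIntegrable_of_bounded [NeZero n] {σ : ℝ} (hσ : 0 < σ) {v : Rn n → ℝ} {C : ℝ}
    (hv : AEStronglyMeasurable v) (h : ∀ y, |v y| ≤ C) : TailIntegrable σ v :=
  (tailIntegrable_const hσ C).mono hv fun y => (h y).trans (le_abs_self C)

end TailIntegrable

/-! ### Convergence and additivity of the operator for comparable kernels. -/

section Comparable

variable {n : ℕ} {σ lmin lmax : ℝ} {k : Rn n → ℝ}

lemma IsComparableKernel.nonneg (hk : IsComparableKernel n σ lmin lmax k) (hσ : σ < 2)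
    (hmin : 0 < lmin) {y : Rn n} (hy : y ≠ 0) : 0 ≤ k y :=
  (mul_nonneg hmin.le (modelKernel_nonneg hσ y)).trans (hk.lower y hy)

lemma IsComparableKernel.abs_le (hk : IsComparableKernel n σ lmin lmax k) (hσ : σ < 2)
    (hmin : 0 < lmin) {y : Rn n} (hy : y ≠ 0) : |k y| ≤ lmax * modelKernel n σ y := by
  rw [abs_of_nonneg (hk.nonneg hσ hmin hy)]
  exact hk.upper y hy

variable [NeZero n]

lemma IsComparableKernel.integrableOn_of_model (hk : IsComparableKernel n σ lmin lmax k)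
    (hσ : σ < 2) (hmin : 0 < lmin) {g : Rn n → ℝ} {s : Set (Rn n)}
    (hgm : AEStronglyMeasurable g)
    (hg : IntegrableOn (fun y => g y * modelKernel n σ y) s) :
    IntegrableOn (fun y => g y * k y) s := by
  refine (hg.norm.const_mul lmax).mono' (hgm.mul hk.measurable.aestronglyMeasurable).restrict ?_
  filter_upwards [ae_restrict_of_ae ae_ne_zero] with y hy
  rw [norm_mul, norm_mul, Real.norm_of_nonneg (modelKernel_nonneg hσ y)]
  calc _ ≤ ‖g y‖ * (lmax * modelKernel n σ y) := by
        gcongr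
        exact hk.abs_le hσ hmin hy
    _ = _ := by ring

lemma IsComparableKernel.integrable_mul (hk : IsComparableKernel n σ lmin lmax k)
    (hσ : σ < 2) (hmin : 0 < lmin) {g : Rn n → ℝ} {C ρ : ℝ}
    (hgm : AEStronglyMeasurable g) (hC : ∀ y, ‖y‖ < ρ → |g y| ≤ C * ‖y‖ ^ 2)
    (hg : IntegrableOn (fun y => g y * modelKernel n σ y) (Metric.ball 0 ρ)ᶜ) :
    Integrable fun y => g y * k y := by
  rw [← integrableOn_univ, ← union_compl_self (Metric.ball (0 : Rn n) ρ)]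
  refine IntegrableOn.union (hk.integrableOn_of_model hσ hmin hgm ?_)
    (hk.integrableOn_of_model hσ hmin hgm hg)
  refine ((integrableOn_norm_sq_modelKernel hσ ρ).const_mul C).mono'
    (hgm.mul (measurable_modelKernel σ).aestronglyMeasurable).restrict ?_
  filter_upwards [ae_restrict_mem Metric.isOpen_ball.measurableSet] with y hy
  rw [norm_mul, Real.norm_of_nonneg (modelKernel_nonneg hσ y), ← mul_assoc]
  have := modelKernel_nonneg hσ y
  gcongr
  exact hC y (by simpa using hy)

lemma IsComparableKernel.integrable_secondDifference
    (hk : IsComparableKernel n σ lmin lmax k) (hσ0 : 0 < σ)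
    (hσ : σ < 2) (hmin : 0 < lmin) {Ψ φ : Rn n → ℝ} {x : Rn n} (hφ : ContDiff ℝ 2 φ)
    (hΨφ : Ψ =ᶠ[𝓝 x] φ) (hΨ : TailIntegrable σ Ψ) :
    Integrable fun y => (Ψ (x + y) + Ψ (x - y) - 2 * Ψ x) * k y := by
  obtain ⟨C, ρ, hC, hρ, h⟩ := exists_secondDifference_le hφ x
  obtain ⟨ρ', hρ', h'⟩ := Metric.eventually_nhds_iff_ball.1 hΨφ
  have hm1 : AEStronglyMeasurable fun y => Ψ (x + y) := by
    simpa using (hΨ.comp_affine hσ0 x one_pos).aestronglyMeasurable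
  have hm2 : AEStronglyMeasurable fun y => Ψ (x - y) := by
    simpa [sub_eq_add_neg] using (hΨ.comp_affine hσ0 x one_pos).comp_neg.aestronglyMeasurable
  refine hk.integrable_mul hσ hmin (C := C) (ρ := min ρ ρ')
    ((hm1.add hm2).sub aestronglyMeasurable_const) (fun y hy => ?_) ?_
  · rw [lt_min_iff] at hy
    rw [h' _ (by simpa using hy.2), h' _ (by simpa [dist_eq_norm] using hy.2),
      h' x (by simpa using hρ')]
    exact h y hy.1
  · have hmin0 : 0 < min ρ ρ' := lt_min hρ hρ'
    have i1 := hΨ.integrableOn_mul_modelKernel hσ0 hσ hmin0 x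
    have i2 := hΨ.comp_neg.integrableOn_mul_modelKernel hσ0 hσ hmin0 (-x)
    have i3 := (integrableOn_modelKernel (n := n) hσ0 hmin0).const_mul (2 * Ψ x)
    refine ((i1.add i2).sub i3).congr (ae_of_all _ fun y => ?_)
    simp only [Pi.add_apply, Pi.sub_apply, neg_add, neg_neg, ← sub_eq_add_neg]
    ring

-- The perturbation is absolutely integrable against k, so it needs no symmetrization: evenness of k
-- makes the y and -y contributions equal, which cancels the factor 1/2.
omit [NeZero n] in
lemma IsComparableKernel.nonlocalOp_add (hk : IsComparableKernel n σ lmin lmax k)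
    {Ψ v w : Rn n → ℝ} {x : Rn n}
    (hΨ : Integrable fun y => (Ψ (x + y) + Ψ (x - y) - 2 * Ψ x) * k y)
    (hw : Integrable fun y => w y * k y) (hw0 : w 0 = 0) (hv : ∀ y, v (x + y) = Ψ (x + y) + w y) :
    nonlocalOp k v x = nonlocalOp k Ψ x + ∫ y, w y * k y := by
  have h1 : ∀ y, (v (x + y) + v (x - y) - 2 * v x) * k y =
      (Ψ (x + y) + Ψ (x - y) - 2 * Ψ x) * k y + (w y * k y + w (-y) * k (-y)) := by
    intro y
    have e1 := hv y
    have e2 := hv (-y)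
    have e3 := hv 0
    rw [add_zero, hw0, add_zero] at e3
    rw [← sub_eq_add_neg] at e2
    rw [e1, e2, e3, hk.symm]
    ring
  have h2 := integral_neg_eq_self (fun y => w y * k y) volume
  have h3 : Integrable fun y => w (-y) * k (-y) := hw.comp_neg
  rw [nonlocalOp, nonlocalOp, integral_congr_ae (ae_of_all _ h1), integral_add hΨ (by exact hw.add h3),
    integral_add hw h3, h2]
  ring

end Comparable

/-! ### From viscosity supersolutions to global test functions. -/

section Supersolutions

/-- `L u ≤ c` in `Ω` in the viscosity sense, formulated with global touching functions `Ψ ≤ u`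
that are `C²` near the contact point. -/
structure Supersol {n : ℕ} (σ lmin lmax : ℝ) (K : Rn n → Rn n → ℝ) (c : ℝ) (Ω : Set (Rn n))
    (u : Rn n → ℝ) : Prop where
  kernel : ∀ x ∈ Ω, IsComparableKernel n σ lmin lmax (K x)
  tailIntegrable : TailIntegrable σ u
  continuousOn : ContinuousOn u Ω
  -- The nonnegative gap u - Ψ appears in its own integral: its bound is the information that the
  -- measure estimates exploit.
  touch : ∀ x ∈ Ω, ∀ Ψ φ : Rn n → ℝ, ContDiff ℝ 2 φ → Ψ =ᶠ[𝓝 x] φ → TailIntegrable σ Ψ →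
    (∀ z, Ψ z ≤ u z) → Ψ x = u x →
    Integrable (fun y => (u (x + y) - Ψ (x + y)) * K x y) ∧
      nonlocalOp (K x) Ψ x + ∫ y, (u (x + y) - Ψ (x + y)) * K x y ≤ c

variable {n : ℕ} {σ lmin lmax c : ℝ} {K : Rn n → Rn n → ℝ} {Ω : Set (Rn n)} {u : Rn n → ℝ}

lemma IsViscositySubsolution.neg {f : Rn n → ℝ} (h : IsViscositySubsolution K f Ω u) :
    IsViscositySupersolution K (fun x => - f x) Ω fun x => - u x := by
  intro x N φ hx hN hNΩ hφ hφx hlt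
  have := h x N (fun z => - φ z) hx hN hNΩ hφ.neg (by simp [hφx])
    (fun z hz hzx => by linarith [hlt z hz hzx])
  have e : glue N (fun z => - φ z) u = fun z => - glue N φ (fun x => - u x) z := by
    ext z
    by_cases hz : z ∈ N <;> simp [glue, hz]
  have e2 : nonlocalOp (K x) (glue N (fun z => - φ z) u) x =
      - nonlocalOp (K x) (glue N φ (fun x => - u x)) x := by
    rw [e, nonlocalOp, nonlocalOp, ← mul_neg, ← integral_neg]
    congr 2
    ext y
    ring
  rw [e2] at this
  linarith

/-- Viscosity tests require strict contact, so |z - x|² is subtracted from the test function in the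
ball of radius r. The cost is the last term, which vanishes as r → 0. -/
lemma IsViscositySupersolution.truncated_bound [NeZero n] {f Ψ φ : Rn n → ℝ} {x : Rn n}
    (h : IsViscositySupersolution K f Ω u) (hσ0 : 0 < σ) (hσ : σ < 2) (hmin : 0 < lmin)
    (hk : IsComparableKernel n σ lmin lmax (K x))
    (hu : TailIntegrable σ u) (hφ : ContDiff ℝ 2 φ)
    (hΨ : TailIntegrable σ Ψ) (hle : ∀ z, Ψ z ≤ u z) (hx : Ψ x = u x) {r : ℝ} (hr : 0 < r)
    (hrΩ : Metric.ball x r ⊆ Ω) (hΨφ : ∀ z ∈ Metric.ball x r, Ψ z = φ z) :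
    IntegrableOn (fun y => (u (x + y) - Ψ (x + y)) * K x y) (Metric.ball 0 r)ᶜ ∧
    ∫ y in (Metric.ball 0 r)ᶜ, (u (x + y) - Ψ (x + y)) * K x y ≤
      f x - nonlocalOp (K x) Ψ x + lmax * (sphereArea n * r ^ (2 - σ)) := by
  have hxr : x ∈ Metric.ball x r := Metric.mem_ball_self hr
  have hmB : MeasurableSet (Metric.ball (0 : Rn n) r) := Metric.isOpen_ball.measurableSet
  have hop := h x (Metric.ball x r) (fun z => φ z - ‖z - x‖ ^ 2) hxr Metric.isOpen_ball hrΩ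
    (hφ.sub ((contDiff_id.sub contDiff_const).norm_sq ℝ)) (by simp [← hΨφ x hxr, hx])
    (fun z hz hzx => by
      have : 0 < ‖z - x‖ ^ 2 := by have := norm_pos_iff.2 (sub_ne_zero.2 hzx); positivity
      linarith [hle z, hΨφ z hz])
  set w1 : Rn n → ℝ := (Metric.ball 0 r).indicator fun y => - ‖y‖ ^ 2
  set w2 : Rn n → ℝ := (Metric.ball 0 r)ᶜ.indicator fun y => u (x + y) - Ψ (x + y)
  have hd : TailIntegrable σ fun z => u z - Ψ z := hu.sub hΨ
  have hdm : AEStronglyMeasurable fun y => u (x + y) - Ψ (x + y) := by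
    simpa using (hd.comp_affine hσ0 x one_pos).aestronglyMeasurable
  have hdi : IntegrableOn (fun y => (u (x + y) - Ψ (x + y)) * K x y) (Metric.ball 0 r)ᶜ :=
    hk.integrableOn_of_model hσ hmin hdm (hd.integrableOn_mul_modelKernel hσ0 hσ hr x)
  have hqi : IntegrableOn (fun y => ‖y‖ ^ 2 * K x y) (Metric.ball 0 r) :=
    hk.integrableOn_of_model hσ hmin (by fun_prop) (integrableOn_norm_sq_modelKernel hσ r)
  refine ⟨hdi, ?_⟩
  have e1 : (fun y => w1 y * K x y) =
      (Metric.ball 0 r).indicator fun y => - (‖y‖ ^ 2 * K x y) := by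
    ext y
    by_cases hy : y ∈ Metric.ball (0 : Rn n) r <;> simp [w1, hy]
  have e2 : (fun y => w2 y * K x y) =
      (Metric.ball 0 r)ᶜ.indicator fun y => (u (x + y) - Ψ (x + y)) * K x y := by
    ext y
    by_cases hy : y ∈ Metric.ball (0 : Rn n) r <;> simp [w2, hy]
  have i1 : Integrable fun y => w1 y * K x y := by
    rw [e1, integrable_indicator_iff hmB]; exact hqi.neg
  have i2 : Integrable fun y => w2 y * K x y := by
    rw [e2, integrable_indicator_iff hmB.compl]; exact hdi
  have hev : Ψ =ᶠ[𝓝 x] φ := Metric.eventually_nhds_iff_ball.2 ⟨r, hr, hΨφ⟩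
  have hadd := hk.nonlocalOp_add (Ψ := Ψ)
    (v := glue (Metric.ball x r) (fun z => φ z - ‖z - x‖ ^ 2) u) (w := fun y => w1 y + w2 y)
    (x := x) (hk.integrable_secondDifference hσ0 hσ hmin hφ hev hΨ)
    ((i1.add i2).congr (ae_of_all _ fun y => by simp [add_mul]))
    (by simp [w1, w2, hr])
    (fun y => by
      by_cases hy : ‖y‖ < r
      · have m : x + y ∈ Metric.ball x r := by simpa using hy
        have m' : y ∈ Metric.ball (0 : Rn n) r := by simpa using hy
        simp [glue, m, w1, w2, m', hΨφ _ m, sub_eq_add_neg]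
      · have m : x + y ∉ Metric.ball x r := by simpa using hy
        have m' : y ∉ Metric.ball (0 : Rn n) r := by simpa using hy
        simp [glue, m, w1, w2, m'])
  rw [hadd] at hop
  simp only [add_mul] at hop
  rw [integral_add i1 i2, e1, e2, integral_indicator hmB, integral_indicator hmB.compl,
    integral_neg] at hop
  have hbd : ∫ y in Metric.ball 0 r, ‖y‖ ^ 2 * K x y ≤ lmax * (sphereArea n * r ^ (2 - σ)) := by
    rw [← integral_norm_sq_modelKernel hσ hr, ← integral_const_mul]
    refine integral_mono_ae hqi ((integrableOn_norm_sq_modelKernel hσ r).const_mul _) ?_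
    filter_upwards [ae_restrict_of_ae ae_ne_zero] with y hy
    have := hk.upper y hy
    calc _ ≤ ‖y‖ ^ 2 * (lmax * modelKernel n σ y) := by gcongr
      _ = _ := by ring
  linarith

/-- The truncated bounds hold for all small r and the gap is nonnegative, so letting r → 0 gives
both integrability of the gap over the whole space and the inequality. -/
lemma IsViscositySupersolution.supersol [NeZero n] {f : Rn n → ℝ}
    (h : IsViscositySupersolution K f Ω u) (hΩ : IsOpen Ω) (hσ0 : 0 < σ) (hσ : σ < 2)
    (hmin : 0 < lmin)
    (hk : ∀ x ∈ Ω, IsComparableKernel n σ lmin lmax (K x)) (hu : TailIntegrable σ u)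
    (hcont : ContinuousOn u Ω) (hf : ∀ x ∈ Ω, f x ≤ c) : Supersol σ lmin lmax K c Ω u := by
  refine ⟨hk, hu, hcont, fun x hx Ψ φ hφ hΨφ hΨ hle hΨx => ?_⟩
  obtain ⟨r1, hr1, hr1Ω⟩ := Metric.isOpen_iff.1 hΩ x hx
  obtain ⟨r2, hr2, hr2φ⟩ := Metric.eventually_nhds_iff_ball.1 hΨφ
  set r0 := min r1 r2 with hr0def
  have hr0 : 0 < r0 := lt_min hr1 hr2
  set r : ℕ → ℝ := fun j => r0 / (j + 1)
  have hr : ∀ j, 0 < r j := fun j => by positivity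
  have hrle : ∀ j, r j ≤ r0 := fun j => div_le_self hr0.le (by linarith [j.cast_nonneg (α := ℝ)])
  have hrlim : Tendsto r atTop (𝓝 0) := tendsto_const_div_atTop_nhds_zero_nat r0 |>.comp
    (tendsto_add_atTop_nat 1) |>.congr fun j => by simp [r]
  have hb := fun j => h.truncated_bound hσ0 hσ hmin (hk x hx) hu hφ hΨ hle hΨx (hr j)
    ((Metric.ball_subset_ball ((hrle j).trans (min_le_left _ _))).trans hr1Ω)
    (fun z hz => hr2φ z (Metric.ball_subset_ball ((hrle j).trans (min_le_right _ _)) hz))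
  have hcov : AECover volume atTop fun j => (Metric.ball (0 : Rn n) (r j))ᶜ := by
    refine ⟨?_, fun j => Metric.isOpen_ball.measurableSet.compl⟩
    filter_upwards [ae_ne_zero] with y hy
    filter_upwards [hrlim.eventually (gt_mem_nhds (norm_pos_iff.2 hy))] with j hj
    simpa using hj.le
  have hnn : ∀ᵐ y : Rn n, 0 ≤ (u (x + y) - Ψ (x + y)) * K x y := by
    filter_upwards [ae_ne_zero] with y hy
    exact mul_nonneg (sub_nonneg.2 (hle _)) ((hk x hx).nonneg hσ hmin hy)
  have hlim : Tendsto (fun j => f x - nonlocalOp (K x) Ψ x +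
      lmax * (sphereArea n * (r j) ^ (2 - σ))) atTop (𝓝 (f x - nonlocalOp (K x) Ψ x)) := by
    have : Tendsto (fun j => (r j) ^ (2 - σ)) atTop (𝓝 0) := by
      have := hrlim.rpow_const (p := 2 - σ) (Or.inr (by linarith))
      rwa [Real.zero_rpow (by linarith)] at this
    simpa using ((this.const_mul (sphereArea n)).const_mul lmax).const_add
      (f x - nonlocalOp (K x) Ψ x)
  obtain ⟨B, hB⟩ := hlim.bddAbove_range
  have hI : Integrable fun y => (u (x + y) - Ψ (x + y)) * K x y :=
    hcov.integrable_of_integral_bounded_of_nonneg_ae B (fun j => (hb j).1) hnn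
      (Eventually.of_forall fun j => (hb j).2.trans (hB (mem_range_self j)))
  have := le_of_tendsto_of_tendsto' (hcov.integral_tendsto_of_countably_generated hI) hlim
    fun j => (hb j).2
  exact ⟨hI, by linarith [hf x hx]⟩

lemma Supersol.mono (h : Supersol σ lmin lmax K c Ω u) {c' : ℝ} {Ω' : Set (Rn n)} (hc : c ≤ c')
    (hΩ : Ω' ⊆ Ω) : Supersol σ lmin lmax K c' Ω' u where
  kernel x hx := h.kernel x (hΩ hx)
  tailIntegrable := h.tailIntegrable
  continuousOn := h.continuousOn.mono hΩ
  touch x hx Ψ φ hφ hΨφ hΨ hle hΨx :=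
    have := h.touch x (hΩ hx) Ψ φ hφ hΨφ hΨ hle hΨx
    ⟨this.1, this.2.trans hc⟩

lemma Supersol.affine [NeZero n] (h : Supersol σ lmin lmax K c Ω u) (hσ : 0 < σ) {a : ℝ}
    (ha : 0 < a) (b : ℝ) : Supersol σ lmin lmax K (a * c) Ω fun z => a * u z + b where
  kernel := h.kernel
  tailIntegrable := (h.tailIntegrable.const_mul a).add (tailIntegrable_const hσ b)
  continuousOn := (h.continuousOn.const_mul a).add continuousOn_const
  touch x hx Ψ φ hφ hΨφ hΨ hle hΨx := by
    obtain ⟨h1, h2⟩ := h.touch x hx (fun z => a⁻¹ * (Ψ z - b)) (fun z => a⁻¹ * (φ z - b))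
      (contDiff_const.mul (hφ.sub contDiff_const))
      (hΨφ.mono fun z hz => by simp only [hz])
      ((hΨ.sub (tailIntegrable_const hσ b)).const_mul a⁻¹)
      (fun z => by
        rw [inv_mul_le_iff₀ ha]
        linarith [hle z])
      (by rw [hΨx]; field_simp; ring)
    have e1 : ∀ y, (u (x + y) - a⁻¹ * (Ψ (x + y) - b)) * K x y =
        a⁻¹ * ((a * u (x + y) + b - Ψ (x + y)) * K x y) := by
      intro y
      field_simp
      ring
    have e2 : nonlocalOp (K x) (fun z => a⁻¹ * (Ψ z - b)) x = a⁻¹ * nonlocalOp (K x) Ψ x := by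
      rw [nonlocalOp, nonlocalOp, mul_left_comm a⁻¹, ← integral_const_mul a⁻¹]
      congr 2
      ext y
      ring
    simp only [e1] at h1 h2
    rw [e2, integral_const_mul, ← mul_add, inv_mul_le_iff₀ ha] at h2
    refine ⟨(h1.const_mul a).congr (ae_of_all _ fun y => ?_), h2⟩
    simp only
    field_simp

/-- The model kernel is homogeneous of degree -n-σ, so the rescaled kernels keep the constants
`lmin` and `lmax`, while the right-hand side gains r^σ. -/
lemma Supersol.rescale (h : Supersol σ lmin lmax K c Ω u) (hσ : 0 < σ) (x0 : Rn n) {r : ℝ}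
    (hr : 0 < r) : Supersol σ lmin lmax
      (fun z y => r ^ ((n : ℝ) + σ) * K (x0 + r • z) (r • y)) (r ^ σ * c)
      ((fun z => x0 + r • z) ⁻¹' Ω) fun z => u (x0 + r • z) where
  kernel z hz := by
    have hk := h.kernel _ hz
    have hrq : 0 < r ^ ((n : ℝ) + σ) := Real.rpow_pos_of_pos hr _
    have e : ∀ y : Rn n, modelKernel n σ y = r ^ ((n : ℝ) + σ) * modelKernel n σ (r • y) := by
      intro y
      rw [modelKernel, modelKernel, norm_smul, Real.norm_of_nonneg hr.le,
        Real.mul_rpow hr.le (norm_nonneg _), show -(n : ℝ) - σ = -((n : ℝ) + σ) by ring,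
        Real.rpow_neg hr.le]
      field_simp
    refine ⟨(hk.measurable.comp (measurable_const_smul r)).const_mul _, fun y => ?_,
      fun y hy => ?_, fun y hy => ?_⟩
    · rw [smul_neg, hk.symm]
    · rw [e, mul_left_comm]
      gcongr
      exact hk.lower _ (smul_ne_zero hr.ne' hy)
    · rw [e, mul_left_comm]
      gcongr
      exact hk.upper _ (smul_ne_zero hr.ne' hy)
  tailIntegrable := h.tailIntegrable.comp_affine hσ x0 hr
  continuousOn := h.continuousOn.comp (by fun_prop) (mapsTo_preimage _ _)
  touch z hz Ψ φ hφ hΨφ hΨ hle hΨx := by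
    set T : Rn n → Rn n := fun w => - (r⁻¹ • x0) + r⁻¹ • w with hT
    have hTx : ∀ z, T (x0 + r • z) = z := fun z => by
      simp [T, smul_smul, inv_mul_cancel₀ hr.ne']
    have hTi : ∀ w, x0 + r • T w = w := fun w => by
      simp [T, smul_smul, mul_inv_cancel₀ hr.ne']
    have hTc : Continuous T := by fun_prop
    obtain ⟨h1, h2⟩ := h.touch _ hz (fun w => Ψ (T w)) (fun w => φ (T w))
      (hφ.comp (by fun_prop))
      ((hTc.tendsto' (x0 + r • z) z (hTx z)).eventually hΨφ)
      (hΨ.comp_affine hσ _ (inv_pos.2 hr))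
      (fun w => by simpa [hTi] using hle (T w))
      (by simpa [hTx] using hΨx)
    have hadd : ∀ y, x0 + r • z + r • y = x0 + r • (z + y) := fun y => by module
    have hsub : ∀ y, x0 + r • z - r • y = x0 + r • (z - y) := fun y => by module
    have hq : r ^ ((n : ℝ) + σ) * (r ^ n)⁻¹ = r ^ σ := by
      rw [Real.rpow_add hr, Real.rpow_natCast]
      field_simp
    have hfr : Module.finrank ℝ (Rn n) = n := by simp
    have cv : ∀ G : Rn n → ℝ, ∫ y, r ^ ((n : ℝ) + σ) * G (r • y) = r ^ σ * ∫ y, G y := by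
      intro G
      rw [integral_const_mul, Measure.integral_comp_smul_of_nonneg volume G r (hR := hr.le), hfr,
        smul_eq_mul, ← mul_assoc, hq]
    have e1 := cv fun y => (u (x0 + r • z + y) - Ψ (T (x0 + r • z + y))) * K (x0 + r • z) y
    have e2 := cv fun y => (Ψ (T (x0 + r • z + y)) + Ψ (T (x0 + r • z - y)) -
      2 * Ψ (T (x0 + r • z))) * K (x0 + r • z) y
    simp only [hadd, hsub, hTx] at e1 e2
    refine ⟨?_, ?_⟩
    · refine ((h1.comp_smul hr.ne').const_mul (r ^ ((n : ℝ) + σ))).congr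
        (ae_of_all _ fun y => ?_)
      simp only [hadd, hTx]
      ring
    · have := mul_le_mul_of_nonneg_left h2 (Real.rpow_nonneg hr.le σ)
      refine le_of_eq_of_le ?_ this
      rw [mul_add, nonlocalOp, nonlocalOp, mul_left_comm (r ^ σ)]
      simp only [hTx] at e1 e2 ⊢
      rw [← e1, ← e2]
      congr 1
      · congr 2
        ext y
        ring
      · congr 1
        ext y
        ring

/-- A test function Ψ for u⁺ gives the test function Ψ - u⁻ for u. As u⁻ vanishes in Ω', smoothness
near x is unaffected, and the operator changes by ∫ u⁻ K ≤ d only. -/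
lemma Supersol.posPart (h : Supersol σ lmin lmax K c Ω u) [NeZero n] (hσ0 : 0 < σ)
    (hσ : σ < 2) (hmin : 0 < lmin) {Ω' : Set (Rn n)} (hΩ : Ω' ⊆ Ω)
    (hΩ' : IsOpen Ω') (hu : ∀ z ∈ Ω', 0 ≤ u z) {d : ℝ}
    (hd : ∀ x ∈ Ω', ∫ y, max (- u (x + y)) 0 * K x y ≤ d) :
    Supersol σ lmin lmax K (c + d) Ω' fun z => max (u z) 0 where
  kernel x hx := h.kernel x (hΩ hx)
  tailIntegrable := h.tailIntegrable.mono
    (h.tailIntegrable.aestronglyMeasurable.sup aestronglyMeasurable_const)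
    fun y => by rcases le_total (u y) 0 with h | h <;> simp [h]
  continuousOn := (h.continuousOn.mono hΩ).sup continuousOn_const
  touch x hx Ψ φ hφ hΨφ hΨ hle hΨx := by
    have hneg : TailIntegrable σ fun z => max (- u z) 0 := h.tailIntegrable.mono
      (h.tailIntegrable.aestronglyMeasurable.neg.sup aestronglyMeasurable_const)
      fun y => by rcases le_total (u y) 0 with h | h <;> simp [h]
    have hz0 : ∀ z ∈ Ω', max (- u z) 0 = 0 := fun z hz => max_eq_right (by linarith [hu z hz])
    obtain ⟨ρ, hρ, hρΩ⟩ := Metric.isOpen_iff.1 hΩ' x hx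
    have hk := h.kernel x (hΩ hx)
    have hw : Integrable fun y => (- max (- u (x + y)) 0) * K x y := by
      refine hk.integrable_mul hσ hmin (C := 0) (ρ := ρ) ?_ (fun y hy => ?_) ?_
      · have := (hneg.comp_affine hσ0 x one_pos).aestronglyMeasurable
        simp only [one_smul] at this
        exact this.neg
      · rw [hz0 _ (hρΩ (by simpa using hy))]
        simp
      · exact hneg.neg.integrableOn_mul_modelKernel hσ0 hσ hρ x
    have hmp : ∀ z, u z = max (u z) 0 - max (- u z) 0 := fun z => by
      rcases le_total (u z) 0 with h | h <;> simp [h]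
    obtain ⟨h1, h2⟩ := h.touch x (hΩ hx) (fun z => Ψ z - max (- u z) 0) φ hφ
      (by
        filter_upwards [hΨφ, hΩ'.mem_nhds hx] with z hz hz'
        rw [hz0 z hz', sub_zero, hz])
      (hΨ.sub hneg) (fun z => by linarith [hle z, hmp z])
      (by rw [hΨx, ← hmp])
    rw [hk.nonlocalOp_add (Ψ := Ψ) (w := fun y => - max (- u (x + y)) 0)
      (hk.integrable_secondDifference hσ0 hσ hmin hφ hΨφ hΨ) hw
      (by simp only [add_zero]; rw [hz0 x hx, neg_zero])
      (fun y => by ring)] at h2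
    have e : ∀ y, u (x + y) - (Ψ (x + y) - max (- u (x + y)) 0) =
        max (u (x + y)) 0 - Ψ (x + y) := fun y => by linarith [hmp (x + y)]
    simp only [e] at h1 h2
    refine ⟨h1, ?_⟩
    have := hd x hx
    simp only [neg_mul] at h2
    rw [integral_neg] at h2
    linarith

end Supersolutions

/-! ### Gaussian barriers. -/

/-- The Gaussian of width `ρ`, which serves as a barrier. -/
noncomputable def gaussian {n : ℕ} (ρ : ℝ) (y : Rn n) : ℝ := Real.exp (-(‖y‖ ^ 2 / ρ ^ 2))

section Gaussian

variable {n : ℕ} {ρ : ℝ}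

lemma gaussian_pos (y : Rn n) : 0 < gaussian ρ y := Real.exp_pos _

lemma gaussian_le_one (y : Rn n) : gaussian ρ y ≤ 1 :=
  Real.exp_le_one_iff.2 (by have : 0 ≤ ‖y‖ ^ 2 / ρ ^ 2 := by positivity
                            linarith)

lemma contDiff_gaussian : ContDiff ℝ 2 (gaussian ρ : Rn n → ℝ) := by
  unfold gaussian
  exact (((contDiff_id.norm_sq ℝ).div_const _).neg).exp

lemma continuous_gaussian : Continuous (gaussian ρ : Rn n → ℝ) := contDiff_gaussian.continuous

lemma tailIntegrable_gaussian [NeZero n] {σ : ℝ} (hσ : 0 < σ) :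
    TailIntegrable σ (gaussian ρ : Rn n → ℝ) :=
  tailIntegrable_of_bounded hσ continuous_gaussian.aestronglyMeasurable (C := 1) fun y => by
    rw [abs_of_pos (gaussian_pos y)]
    exact gaussian_le_one y

lemma gaussian_secondDifference (hρ : 0 < ρ) (x y : Rn n) :
    gaussian ρ (x + y) + gaussian ρ (x - y) - 2 * gaussian ρ x =
      gaussian ρ x * (2 * (Real.exp (-(‖y‖ ^ 2 / ρ ^ 2)) *
        Real.cosh (2 * inner ℝ x y / ρ ^ 2)) - 2) := by
  rw [Real.cosh_eq]
  unfold gaussian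
  have e1 : -(‖x + y‖ ^ 2 / ρ ^ 2) =
      -(‖x‖ ^ 2 / ρ ^ 2) + -(‖y‖ ^ 2 / ρ ^ 2) + -(2 * inner ℝ x y / ρ ^ 2) := by
    rw [norm_add_sq_real]; field_simp; ring
  have e2 : -(‖x - y‖ ^ 2 / ρ ^ 2) =
      -(‖x‖ ^ 2 / ρ ^ 2) + -(‖y‖ ^ 2 / ρ ^ 2) + (2 * inner ℝ x y / ρ ^ 2) := by
    rw [norm_sub_sq_real]; field_simp; ring
  rw [e1, e2]
  simp only [Real.exp_add]
  ring

lemma one_add_sq_div_two_le_cosh (t : ℝ) : 1 + t ^ 2 / 2 ≤ Real.cosh t := by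
  have h := Real.cosh_two_mul (t / 2)
  have h2 := Real.cosh_sq (t / 2)
  rw [mul_div_cancel₀ t two_ne_zero] at h
  have h3 : (t / 2) ^ 2 ≤ Real.sinh (t / 2) ^ 2 := by
    rw [← sq_abs (t / 2), ← sq_abs (Real.sinh (t / 2)), Real.abs_sinh]
    exact pow_le_pow_left₀ (abs_nonneg _) (Real.self_le_sinh_iff.2 (abs_nonneg _)) 2
  nlinarith

lemma gaussian_secondDifference_ge_far (x y : Rn n) :
    -(2 * gaussian ρ x) ≤ gaussian ρ (x + y) + gaussian ρ (x - y) - 2 * gaussian ρ x := by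
  have := gaussian_pos (ρ := ρ) (x + y)
  have := gaussian_pos (ρ := ρ) (x - y)
  linarith

/-- The gain, quadratic in ⟨x, y⟩, carries ρ⁻⁴, whereas the loss carries ρ⁻² only. After averaging
over directions the gain prevails once |x| is large compared with ρ. -/
lemma gaussian_secondDifference_ge_near (hρ : 0 < ρ) (x : Rn n) {y : Rn n} (hy : ‖y‖ < ρ) :
    gaussian ρ x * (4 * Real.exp (-1) / ρ ^ 4 * inner ℝ x y ^ 2 - 2 / ρ ^ 2 * ‖y‖ ^ 2) ≤
      gaussian ρ (x + y) + gaussian ρ (x - y) - 2 * gaussian ρ x := by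
  rw [gaussian_secondDifference hρ]
  refine mul_le_mul_of_nonneg_left ?_ (gaussian_pos x).le
  set s := ‖y‖ ^ 2 / ρ ^ 2 with hs
  set t := 2 * inner ℝ x y / ρ ^ 2 with ht
  have hs1 : s ≤ 1 := by
    rw [hs, div_le_one (by positivity)]
    gcongr
  have h1 := one_add_sq_div_two_le_cosh t
  have h2 : Real.exp (-1) ≤ Real.exp (-s) := Real.exp_le_exp.2 (by linarith)
  have h3 : 1 - s ≤ Real.exp (-s) := by linarith [Real.add_one_le_exp (-s)]
  have e1 : 4 * Real.exp (-1) / ρ ^ 4 * inner ℝ x y ^ 2 = Real.exp (-1) * t ^ 2 := by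
    rw [ht]; field_simp; ring
  have e2 : 2 / ρ ^ 2 * ‖y‖ ^ 2 = 2 * s := by rw [hs]; ring
  rw [e1, e2]
  have h4 : Real.exp (-s) * (1 + t ^ 2 / 2) ≤ Real.exp (-s) * Real.cosh t := by gcongr
  have h5 : Real.exp (-1) * t ^ 2 ≤ Real.exp (-s) * t ^ 2 := by gcongr
  nlinarith

/-- Away from its centre a narrow Gaussian is a strict subsolution, with bounds that are uniform
in the order of the operator. -/
lemma nonlocalOp_gaussian_ge [NeZero n] {σ lmin lmax : ℝ} {k : Rn n → ℝ}
    (hk : IsComparableKernel n σ lmin lmax k) (hσ0 : 0 < σ) (hσ : σ < 2) (hmin : 0 < lmin)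
    (hρ : 0 < ρ) (x : Rn n) :
    gaussian ρ x * (sphereArea n * ρ ^ (-σ) *
      (2 * Real.exp (-1) * lmin / n * ‖x‖ ^ 2 / ρ ^ 2 - 2 * lmax / σ)) ≤
      nonlocalOp k (gaussian ρ) x := by
  have hn : (n : ℝ) ≠ 0 := Nat.cast_ne_zero.2 (NeZero.ne n)
  have hI := hk.integrable_secondDifference (x := x) hσ0 hσ hmin contDiff_gaussian
    (EventuallyEq.refl _ (gaussian ρ)) (tailIntegrable_gaussian hσ0)
  have hmB : MeasurableSet (Metric.ball (0 : Rn n) ρ) := Metric.isOpen_ball.measurableSet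
  set G := gaussian ρ x
  have hG : 0 < G := gaussian_pos x
  have hinner : IntegrableOn (fun y : Rn n => inner ℝ x y ^ 2 * modelKernel n σ y)
      (Metric.ball 0 ρ) := by
    refine ((integrableOn_norm_sq_modelKernel hσ ρ).const_mul (‖x‖ ^ 2)).mono'
      ((Measurable.mul (by fun_prop) (measurable_modelKernel σ)).aestronglyMeasurable)
      (ae_of_all _ fun y => ?_)
    rw [norm_mul, Real.norm_of_nonneg (modelKernel_nonneg hσ y), ← mul_assoc, ← mul_pow, norm_pow]
    have := modelKernel_nonneg hσ y
    gcongr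
    exact norm_inner_le_norm x y
  have hnear : G * (4 * Real.exp (-1) / ρ ^ 4 * lmin * (‖x‖ ^ 2 / n * (sphereArea n * ρ ^ (2 - σ)))
      - 2 / ρ ^ 2 * lmax * (sphereArea n * ρ ^ (2 - σ))) ≤
      ∫ y in Metric.ball 0 ρ, (gaussian ρ (x + y) + gaussian ρ (x - y) - 2 * gaussian ρ x) * k y := by
    rw [← integral_inner_sq_modelKernel hσ hρ, ← integral_norm_sq_modelKernel hσ hρ,
      ← integral_const_mul, ← integral_const_mul, ← integral_sub (hinner.const_mul _)
      ((integrableOn_norm_sq_modelKernel hσ ρ).const_mul _), ← integral_const_mul]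
    refine integral_mono_ae (((hinner.const_mul _).sub
      ((integrableOn_norm_sq_modelKernel hσ ρ).const_mul _)).const_mul _) hI.integrableOn ?_
    filter_upwards [ae_restrict_of_ae ae_ne_zero, ae_restrict_mem hmB] with y hy0 hyB
    have h1 := gaussian_secondDifference_ge_near hρ x (y := y) (by simpa using hyB)
    have hk0 := hk.nonneg hσ hmin hy0
    refine le_trans ?_ (mul_le_mul_of_nonneg_right h1 hk0)
    rw [mul_assoc (gaussian ρ x)]
    refine mul_le_mul_of_nonneg_left ?_ hG.le
    have a1 : 4 * Real.exp (-1) / ρ ^ 4 * inner ℝ x y ^ 2 * (lmin * modelKernel n σ y) ≤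
        4 * Real.exp (-1) / ρ ^ 4 * inner ℝ x y ^ 2 * k y := by
      gcongr; exact hk.lower y hy0
    have a2 : 2 / ρ ^ 2 * ‖y‖ ^ 2 * k y ≤ 2 / ρ ^ 2 * ‖y‖ ^ 2 * (lmax * modelKernel n σ y) := by
      gcongr; exact hk.upper y hy0
    nlinarith
  have hfar : G * (-(2 * lmax * ((2 - σ) * (sphereArea n * (ρ ^ (-σ) / σ))))) ≤
      ∫ y in (Metric.ball 0 ρ)ᶜ,
        (gaussian ρ (x + y) + gaussian ρ (x - y) - 2 * gaussian ρ x) * k y := by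
    rw [← integral_modelKernel hσ0 hρ, ← integral_const_mul, ← integral_neg, ← integral_const_mul]
    refine integral_mono_ae (((integrableOn_modelKernel hσ0 hρ).const_mul _).neg.const_mul _)
      hI.integrableOn ?_
    filter_upwards [ae_restrict_of_ae ae_ne_zero] with y hy0
    have h1 := gaussian_secondDifference_ge_far (ρ := ρ) x y
    have hk0 := hk.nonneg hσ hmin hy0
    refine le_trans ?_ (mul_le_mul_of_nonneg_right h1 hk0)
    have : G * k y ≤ G * (lmax * modelKernel n σ y) := by
      gcongr; exact hk.upper y hy0
    simp only [G] at this ⊢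
    nlinarith
  rw [nonlocalOp, ← integral_add_compl hmB hI]
  have hp : ρ ^ (2 - σ) = ρ ^ 2 * ρ ^ (-σ) := by
    rw [sub_eq_add_neg, Real.rpow_add hρ]; norm_num
  rw [hp] at hnear
  -- The near and far losses add up to lmax (1 + (2 - σ)/σ) = 2 lmax/σ.
  refine le_trans (le_of_eq ?_) (mul_le_mul_of_nonneg_left (add_le_add hnear hfar)
    (by norm_num : (0:ℝ) ≤ 1 / 2))
  field_simp
  ring

/-- A Gaussian barrier for a whole range of orders. -/
lemma exists_gaussian_barrier (n : ℕ) [NeZero n] {σ₀ lmin lmax : ℝ} (hσ₀ : 0 < σ₀)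
    (hmin : 0 < lmin) (hmax : 0 < lmax) :
    ∃ ρ D : ℝ, 0 < ρ ∧ 0 < D ∧ ∀ σ, σ₀ ≤ σ → σ < 2 → ∀ k : Rn n → ℝ,
      IsComparableKernel n σ lmin lmax k →
      (∀ x, 1 / 4 ≤ ‖x‖ → gaussian ρ x * sphereArea n ≤ nonlocalOp k (gaussian ρ) x) ∧
      ∀ x, -D ≤ nonlocalOp k (gaussian ρ) x := by
  have hn : (0 : ℝ) < n := Nat.cast_pos.2 (NeZero.pos n)
  have hω := sphereArea_pos n
  -- `a` is the gain coefficient at |x| = 1/4 and `b` bounds the loss for all σ ≥ σ₀; `ρ` is chosen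
  -- so that a/ρ² ≥ b + 1.
  set a := 2 * Real.exp (-1) * lmin / n / 16 with ha
  have ha0 : 0 < a := by positivity
  set b := 2 * lmax / σ₀ with hb
  have hb0 : 0 < b := by positivity
  set ρ : ℝ := min 1 (a / (b + 1)) with hρdef
  have hρ : 0 < ρ := lt_min one_pos (by positivity)
  have hρ1 : ρ ≤ 1 := min_le_left _ _
  refine ⟨ρ, sphereArea n * ρ ^ (-2 : ℝ) * b, hρ, by positivity, fun σ hσσ hσ k hk => ?_⟩
  have hσ0 : 0 < σ := hσ₀.trans_le hσσ
  have hbσ : 2 * lmax / σ ≤ b := by rw [hb]; gcongr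
  have hρσ : 1 ≤ ρ ^ (-σ) := Real.one_le_rpow_of_pos_of_le_one_of_nonpos hρ hρ1 (by linarith)
  have hρσ2 : ρ ^ (-σ) ≤ ρ ^ (-2 : ℝ) := Real.rpow_le_rpow_of_exponent_ge hρ hρ1 (by linarith)
  refine ⟨fun x hx => ?_, fun x => ?_⟩
  · refine le_trans ?_ (nonlocalOp_gaussian_ge hk hσ0 hσ hmin hρ x)
    have h1 : b + 1 ≤ a / ρ ^ 2 := by
      rw [le_div_iff₀ (by positivity)]
      have : ρ ≤ a / (b + 1) := min_le_right _ _
      rw [le_div_iff₀ (by positivity)] at this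
      nlinarith
    have h2 : a / ρ ^ 2 ≤ 2 * Real.exp (-1) * lmin / n * ‖x‖ ^ 2 / ρ ^ 2 := by
      have : 1 / 16 ≤ ‖x‖ ^ 2 := by nlinarith
      rw [ha, div_eq_mul_one_div (2 * Real.exp (-1) * lmin / n) 16]
      gcongr
    have h3 : 1 ≤ ρ ^ (-σ) *
        (2 * Real.exp (-1) * lmin / n * ‖x‖ ^ 2 / ρ ^ 2 - 2 * lmax / σ) := by
      refine one_le_mul_of_one_le_of_one_le hρσ (by linarith)
    have := (mul_pos (gaussian_pos (ρ := ρ) x) hω)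
    nlinarith
  · refine le_trans ?_ (nonlocalOp_gaussian_ge hk hσ0 hσ hmin hρ x)
    have h1 : 0 ≤ 2 * Real.exp (-1) * lmin / n * ‖x‖ ^ 2 / ρ ^ 2 := by positivity
    have hg := gaussian_le_one (ρ := ρ) x
    have hg0 := gaussian_pos (ρ := ρ) x
    have hs : 0 ≤ 2 * lmax / σ := by positivity
    have e : gaussian ρ x * (sphereArea n * ρ ^ (-σ) * (2 * lmax / σ)) ≤
        1 * (sphereArea n * ρ ^ (-2 : ℝ) * b) := by gcongr
    have e2 : 0 ≤ gaussian ρ x * (sphereArea n * ρ ^ (-σ)) := by positivity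
    nlinarith

end Gaussian

/-! ### Pigeonhole over dyadic scales. -/

section Scales

/-- The radii at which a nonnegative function is compared with a paraboloid. -/
noncomputable def dyadicRadius (k : ℕ) : ℝ := (1 / 2) ^ (k + 1)

lemma dyadicRadius_pos (k : ℕ) : 0 < dyadicRadius k := by unfold dyadicRadius; positivity

lemma dyadicRadius_le (k : ℕ) : dyadicRadius k ≤ 1 / 2 := by
  unfold dyadicRadius
  exact pow_le_of_le_one (by norm_num) (by norm_num) (by simp)

lemma dyadicRadius_succ (k : ℕ) : dyadicRadius (k + 1) = dyadicRadius k / 2 := by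
  unfold dyadicRadius; ring

/-- As q ≥ 1 the terms at least double from one scale to the next, so the last one dominates. With q
= n + σ, the contributions of all dyadic balls containing a point are controlled by the kernel at
that point. -/
lemma sum_dyadicRadius_rpow_neg_le {q t : ℝ} (hq : 1 ≤ q) (ht : 0 < t) (K : ℕ) :
    ∑ k ∈ Finset.range K, (if t < dyadicRadius k then dyadicRadius k ^ (-q) else 0) ≤
      2 * t ^ (-q) := by
  have key : ∀ K : ℕ,
      ∑ k ∈ Finset.range K, (if t < dyadicRadius k then dyadicRadius k ^ (-q) else 0) ≤
        dyadicRadius K ^ (-q) := by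
    intro K
    induction K with
    | zero => simpa using Real.rpow_nonneg (dyadicRadius_pos 0).le _
    | succ K ih =>
      rw [Finset.sum_range_succ, dyadicRadius_succ, Real.div_rpow (dyadicRadius_pos K).le (by simp),
        Real.rpow_neg zero_le_two, div_inv_eq_mul]
      have h2 : (2 : ℝ) ≤ 2 ^ q := by
        simpa using Real.rpow_le_rpow_of_exponent_le (one_le_two (α := ℝ)) hq
      have h0 := Real.rpow_pos_of_pos (dyadicRadius_pos K) (-q)
      split_ifs <;> nlinarith
  induction K with
  | zero => simpa using Real.rpow_nonneg ht.le _
  | succ K ih =>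
    rw [Finset.sum_range_succ]
    split_ifs with h
    · have h1 : dyadicRadius K ^ (-q) ≤ t ^ (-q) :=
        Real.rpow_le_rpow_of_nonpos ht h.le (by linarith)
      linarith [key K]
    · simpa using ih

/-- With a = 2^(-s) the full sum is s·a/(1 - a), and 1 - a ≤ s log 2 ≤ s, so it is at least a ≥ 1/4.
For s = 2 - σ this is the source of uniformity as σ → 2: the sum over scales blows up like 1/s. -/
lemma quarter_le_tsum_dyadicRadius {s : ℝ} (hs0 : 0 < s) (hs : s < 2) {B : ℝ}
    (h : ∀ K : ℕ, s * ∑ k ∈ Finset.range K, dyadicRadius k ^ s ≤ B) : 1 / 4 ≤ B := by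
  set a : ℝ := (1 / 2) ^ s with ha
  have ha0 : 0 < a := by positivity
  have ha1 : a < 1 := Real.rpow_lt_one (by norm_num) (by norm_num) hs0
  have e : ∀ k, dyadicRadius k ^ s = a * a ^ k := by
    intro k
    rw [dyadicRadius, ← Real.rpow_natCast, ← Real.rpow_mul (by norm_num), mul_comm,
      Real.rpow_mul (by norm_num), Real.rpow_natCast, pow_succ']
  have hlim : Tendsto (fun K : ℕ => s * ∑ k ∈ Finset.range K, dyadicRadius k ^ s) atTop
      (𝓝 (s * (a * (1 - a)⁻¹))) := by
    simp_rw [e, ← Finset.mul_sum]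
    exact ((hasSum_geometric_of_lt_one ha0.le ha1).tendsto_sum_nat.const_mul a).const_mul s
  have hle := le_of_tendsto' hlim h
  have h1 : 1 - a ≤ s := by
    have h2 : 1 + s * Real.log (1 / 2) ≤ a := by
      rw [ha, Real.rpow_def_of_pos (by norm_num)]
      linarith [Real.add_one_le_exp (Real.log (1 / 2) * s)]
    have h3 : -1 ≤ Real.log (1 / 2) := by
      rw [one_div, Real.log_inv]
      linarith [Real.log_two_lt_d9]
    nlinarith
  have h4 : 1 / 4 ≤ a := by
    have : ((1 : ℝ) / 2) ^ (2 : ℝ) ≤ (1 / 2) ^ s :=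
      Real.rpow_le_rpow_of_exponent_ge (by norm_num) (by norm_num) hs.le
    refine le_trans (by norm_num) this
  have h5 : a ≤ s * (a * (1 - a)⁻¹) := by
    rw [← div_eq_mul_inv, ← mul_div_assoc, le_div_iff₀ (by linarith)]
    nlinarith
  linarith

variable {n : ℕ} [NeZero n]

/-- A nonnegative function whose integral against the kernel is finite lies below a paraboloid
on most of some ball. -/
lemma exists_radius_mostly_below_paraboloid {σ lmin lmax : ℝ} {k : Rn n → ℝ}
    (hk : IsComparableKernel n σ lmin lmax k) (hσ0 : 0 < σ) (hσ : σ < 2) (hmin : 0 < lmin)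
    {w : Rn n → ℝ} (hw0 : ∀ y, 0 ≤ w y) (hwm : AEStronglyMeasurable w)
    (hwi : Integrable fun y => w y * k y) {C₀ C₁ δ : ℝ} (hwC : ∫ y, w y * k y ≤ C₀)
    (hC₁ : 0 < C₁) (hδ : 0 < δ) (hC : 8 * C₀ < lmin * δ * C₁) :
    ∃ R, 0 < R ∧ R ≤ 1 / 2 ∧
      volume.real {y | y ∈ Metric.ball (0 : Rn n) R ∧ C₁ * R ^ 2 < w y} ≤ δ * R ^ n := by
  -- If every dyadic radius r fails, each scale contributes at least a multiple of (2 - σ) r^(2-σ)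
  -- to the integral of w against k, and the sum over scales is too large.
  by_contra! hcon
  set S : ℕ → Set (Rn n) := fun j =>
    {y | y ∈ Metric.ball (0 : Rn n) (dyadicRadius j) ∧ C₁ * dyadicRadius j ^ 2 < w y} with hS
  have hSm : ∀ j, NullMeasurableSet (S j) := fun j =>
    Metric.isOpen_ball.measurableSet.nullMeasurableSet.inter
      (nullMeasurableSet_lt aemeasurable_const hwm.aemeasurable)
  have hSf : ∀ j, volume (S j) ≠ ∞ := fun j =>
    (measure_lt_top_of_subset (fun y hy => hy.1) measure_ball_lt_top.ne).ne
  have hvol : ∀ j, δ * dyadicRadius j ^ n < volume.real (S j) := fun j =>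
    hcon _ (dyadicRadius_pos j) (dyadicRadius_le j)
  set q : ℝ := (n : ℝ) + σ with hq
  have hn1 : (1 : ℝ) ≤ n := by exact_mod_cast NeZero.one_le
  have hc : 0 < lmin * (2 - σ) * C₁ := by
    have : 0 < 2 - σ := by linarith
    positivity
  have hsum : ∀ J : ℕ, (2 - σ) * ∑ j ∈ Finset.range J, dyadicRadius j ^ (2 - σ) ≤
      2 * C₀ / (lmin * δ * C₁) := by
    intro J
    have hpt : ∀ᵐ y : Rn n, ∑ j ∈ Finset.range J, (S j).indicator
        (fun _ => lmin * (2 - σ) * C₁ * (dyadicRadius j ^ 2 * dyadicRadius j ^ (-q))) y ≤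
        2 * (w y * k y) := by
      filter_upwards [ae_ne_zero] with y hy
      have hy' : 0 < ‖y‖ := norm_pos_iff.2 hy
      have h1 : ∀ j ∈ Finset.range J, (S j).indicator
          (fun _ => lmin * (2 - σ) * C₁ * (dyadicRadius j ^ 2 * dyadicRadius j ^ (-q))) y ≤
          lmin * (2 - σ) * w y *
            (if ‖y‖ < dyadicRadius j then dyadicRadius j ^ (-q) else 0) := by
        intro j _
        have hr := Real.rpow_pos_of_pos (dyadicRadius_pos j) (-q)
        have hl : 0 ≤ lmin * (2 - σ) := mul_nonneg hmin.le (by linarith)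
        by_cases hyS : y ∈ S j
        · rw [indicator_of_mem hyS, if_pos (by simpa using hyS.1)]
          have : C₁ * dyadicRadius j ^ 2 ≤ w y := hyS.2.le
          calc _ = lmin * (2 - σ) * (C₁ * dyadicRadius j ^ 2) * dyadicRadius j ^ (-q) := by ring
            _ ≤ _ := by gcongr
        · rw [indicator_of_notMem hyS]
          have := hw0 y
          split_ifs <;> positivity
      refine (Finset.sum_le_sum h1).trans ?_
      rw [← Finset.mul_sum]
      have h2 := sum_dyadicRadius_rpow_neg_le (q := q) (by linarith) hy' J
      have h3 := hk.lower y hy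
      have e : modelKernel n σ y = (2 - σ) * ‖y‖ ^ (-q) := by
        rw [modelKernel]; congr 2; simp [q]; ring
      have h4 : 0 ≤ lmin * (2 - σ) * w y :=
        mul_nonneg (mul_nonneg hmin.le (by linarith)) (hw0 y)
      calc _ ≤ lmin * (2 - σ) * w y * (2 * ‖y‖ ^ (-q)) := by gcongr
        _ = 2 * (w y * (lmin * modelKernel n σ y)) := by rw [e]; ring
        _ ≤ _ := by have := hw0 y; gcongr
    have hint : ∀ j, Integrable ((S j).indicator
        (fun _ : Rn n => lmin * (2 - σ) * C₁ * (dyadicRadius j ^ 2 * dyadicRadius j ^ (-q)))) :=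
      fun j => (integrableOn_const (hSf j)).integrable_indicator₀ (hSm j)
    have hI := integral_mono_ae (integrable_finsetSum _ fun j _ => hint j) (hwi.const_mul 2) hpt
    rw [integral_finsetSum _ fun j _ => hint j, integral_const_mul] at hI
    have hterm : ∀ j ∈ Finset.range J, lmin * (2 - σ) * C₁ * δ * dyadicRadius j ^ (2 - σ) ≤
        ∫ y, (S j).indicator (fun _ : Rn n =>
          lmin * (2 - σ) * C₁ * (dyadicRadius j ^ 2 * dyadicRadius j ^ (-q))) y := by
      intro j _
      have hr := dyadicRadius_pos j
      rw [integral_indicator₀ (hSm j), setIntegral_const, smul_eq_mul]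
      have e : dyadicRadius j ^ (2 - σ) =
          dyadicRadius j ^ n * (dyadicRadius j ^ 2 * dyadicRadius j ^ (-q)) := by
        rw [← Real.rpow_natCast, ← Real.rpow_natCast, ← Real.rpow_add hr, ← Real.rpow_add hr]
        congr 1
        simp [q]
        ring
      rw [e]
      have hp : 0 < dyadicRadius j ^ 2 * dyadicRadius j ^ (-q) := by positivity
      calc _ = (δ * dyadicRadius j ^ n) *
            (lmin * (2 - σ) * C₁ * (dyadicRadius j ^ 2 * dyadicRadius j ^ (-q))) := by ring
        _ ≤ _ := by gcongr; exact (hvol j).le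
    have := (Finset.sum_le_sum hterm).trans (hI.trans (mul_le_mul_of_nonneg_left hwC zero_le_two))
    rw [← Finset.mul_sum] at this
    rw [le_div_iff₀ (by positivity)]
    linarith
  -- This gives 1/4 ≤ 2C₀/(lmin δ C₁), which the factor 8 in `hC` excludes.
  have h4 := quarter_le_tsum_dyadicRadius (by linarith) (by linarith) hsum
  rw [le_div_iff₀ (by positivity)] at h4
  linarith

end Scales

/-! ### Comparison of slopes at neighbouring contact points. -/

section Slopes

variable {n : ℕ}

/-- Affine functions that touch `V` from below near `x` have slopes close to the slope of an affine
function which is almost an upper bound for `V` in most of a ball around `x`. -/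
lemma norm_slope_sub_le {V : Rn n → ℝ} {p p' x x' : Rn n} {m m' R C : ℝ} (hR : 0 < R)
    (hC : 0 ≤ C)
    (h' : ∀ y ∈ Metric.ball x R, inner ℝ p' y + m' ≤ V y) (hx' : V x' = inner ℝ p' x' + m')
    (h : inner ℝ p x' + m ≤ V x') (hxx' : ‖x' - x‖ ≤ R / 4)
    (hmeas : volume.real {y | y ∈ Metric.ball (0 : Rn n) R ∧
      C * R ^ 2 < V (x + y) - inner ℝ p (x + y) - m} <
        (R / 4) ^ n * volume.real (Metric.ball (0 : Rn n) 1)) :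
    ‖p' - p‖ ≤ 4 * C * R := by
  rcases eq_or_ne (p' - p) 0 with hq | hq
  · rw [hq, norm_zero]; positivity
  set q := p' - p with hqdef
  have hq0 : 0 < ‖q‖ := norm_pos_iff.2 hq
  -- The centre is moved from the contact point x' by R/2 in the direction of q. The ball of radius
  -- R/4 about `z` stays inside the ball of radius R, is too large to consist of bad points, and on
  -- it the two affine functions have separated by at least ‖q‖R/4.
  set z : Rn n := x' - x + (R / 2 / ‖q‖) • q with hz
  have hnz : ‖(R / 2 / ‖q‖) • q‖ = R / 2 := by
    rw [norm_smul, Real.norm_of_nonneg (by positivity)]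
    field_simp
  obtain ⟨y, hy, hyS⟩ : ∃ y ∈ Metric.ball z (R / 4), ¬ (y ∈ Metric.ball (0 : Rn n) R ∧
      C * R ^ 2 < V (x + y) - inner ℝ p (x + y) - m) := by
    by_contra! hcon
    rw [← volume_ball_Rn z (by positivity : 0 < R / 4)] at hmeas
    refine hmeas.not_ge (measureReal_mono (fun y hy => hcon y hy) ?_)
    exact (measure_lt_top_of_subset (fun y hy => hy.1) measure_ball_lt_top.ne).ne
  have hyz : ‖y - z‖ < R / 4 := by simpa [dist_eq_norm] using hy
  have hyR : y ∈ Metric.ball (0 : Rn n) R := by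
    have e : y = (y - z) + ((x' - x) + (R / 2 / ‖q‖) • q) := by rw [hz]; abel
    have : ‖y‖ < R := by
      calc ‖y‖ ≤ ‖y - z‖ + (‖x' - x‖ + ‖(R / 2 / ‖q‖) • q‖) := by
            conv_lhs => rw [e]
            exact (norm_add_le _ _).trans (by gcongr; exact norm_add_le _ _)
        _ < R := by rw [hnz]; linarith
    simpa using this
  have hle : V (x + y) - inner ℝ p (x + y) - m ≤ C * R ^ 2 := by
    by_contra! hlt
    exact hyS ⟨hyR, hlt⟩
  have h1 := h' (x + y) (by simpa using hyR)
  have e1 : inner ℝ q (x + y - x') = inner ℝ q (y - z) + R / 2 * ‖q‖ := by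
    have : x + y - x' = (y - z) + (R / 2 / ‖q‖) • q := by rw [hz]; abel
    rw [this, inner_add_right, inner_smul_right, real_inner_self_eq_norm_sq]
    field_simp
  have e2 : -(‖q‖ * (R / 4)) ≤ inner ℝ q (y - z) := by
    have h2 := abs_real_inner_le_norm q (y - z)
    have h3 := neg_abs_le (inner ℝ q (y - z))
    nlinarith
  have e3 : inner ℝ q (x + y - x') =
      inner ℝ p' (x + y) - inner ℝ p (x + y) - (inner ℝ p' x' - inner ℝ p x') := by
    rw [hqdef, inner_sub_left, inner_sub_right, inner_sub_right]
    ring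
  have h5 : ‖q‖ * (R / 4) ≤ C * R ^ 2 := by linarith
  have : ‖q‖ * R ≤ (4 * C * R) * R := by linarith
  exact le_of_mul_le_mul_right this hR

end Slopes

/-! ### Summing densities over disjoint balls. -/

section Vitali

lemma tsum_volume_closedBall_le {n : ℕ} {ι : Type*} {U : Set ι} {x : ι → Rn n} {r : ι → ℝ}
    (hr : ∀ a ∈ U, 0 < r a) (hd : U.PairwiseDisjoint fun a => Metric.closedBall (x a) (r a))
    {A : Set (Rn n)} (hA : MeasurableSet A) {c : ℝ≥0∞}
    (h : ∀ a ∈ U, volume (Metric.closedBall (x a) (r a)) ≤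
      c * volume (A ∩ Metric.closedBall (x a) (r a))) :
    U.Countable ∧ ∑' a : U, volume (Metric.closedBall (x a) (r a)) ≤ c * volume A := by
  have hc : U.Countable := hd.countable_of_nonempty_interior fun a ha =>
    ⟨x a, Metric.ball_subset_interior_closedBall (Metric.mem_ball_self (hr a ha))⟩
  refine ⟨hc, (ENNReal.tsum_le_tsum fun a : U => h a a.2).trans ?_⟩
  rw [ENNReal.tsum_mul_left]
  gcongr
  rw [← measure_biUnion hc (hd.mono fun a => inter_subset_right)
    fun a _ => hA.inter Metric.isClosed_closedBall.measurableSet]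
  exact measure_mono (iUnion₂_subset fun a _ => inter_subset_left)

end Vitali

/-! ### Linear test functions, cut off because they are not integrable at infinity when σ ≤ 1. -/

section Slab

variable {n : ℕ}

/-- The linear function with slope `p`, cut off outside a ball. -/
noncomputable def slab (p : Rn n) : Rn n → ℝ :=
  (Metric.ball (0 : Rn n) 6).indicator fun z => inner ℝ p z

lemma slab_of_mem (p : Rn n) {z : Rn n} (hz : ‖z‖ < 6) : slab p z = inner ℝ p z :=
  indicator_of_mem (by simpa using hz) _

lemma slab_of_notMem (p : Rn n) {z : Rn n} (hz : 6 ≤ ‖z‖) : slab p z = 0 :=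
  indicator_of_notMem (by simpa using hz) _

lemma abs_slab_le (p z : Rn n) : |slab p z| ≤ 6 * ‖p‖ := by
  rcases lt_or_ge ‖z‖ 6 with h | h
  · rw [slab_of_mem p h]
    have := abs_real_inner_le_norm p z
    nlinarith [norm_nonneg p]
  · rw [slab_of_notMem p h, abs_zero]
    positivity

lemma measurable_slab (p : Rn n) : Measurable (slab p) :=
  Measurable.indicator (by fun_prop) Metric.isOpen_ball.measurableSet

variable [NeZero n]

lemma tailIntegrable_slab {σ : ℝ} (hσ : 0 < σ) (p : Rn n) : TailIntegrable σ (slab p) :=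
  tailIntegrable_of_bounded hσ (measurable_slab p).aestronglyMeasurable (abs_slab_le p)

omit [NeZero n] in
lemma slab_eventuallyEq (p : Rn n) {x : Rn n} (hx : ‖x‖ < 6) :
    slab p =ᶠ[𝓝 x] fun z => inner ℝ p z := by
  filter_upwards [Metric.isOpen_ball.mem_nhds (show x ∈ Metric.ball 0 6 by simpa using hx)] with z hz
  exact slab_of_mem p (by simpa using hz)

/-- For |x| < 4 and |y| < 1 everything stays where the slab is linear, and the second difference
vanishes. Only |y| ≥ 1 contributes, with second differences of size at most 4 · 6‖p‖, so the error
is proportional to ‖p‖. -/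
lemma nonlocalOp_slab_ge {σ lmin lmax : ℝ} {k : Rn n → ℝ}
    (hk : IsComparableKernel n σ lmin lmax k) (hσ0 : 0 < σ) (hσ : σ < 2) (hmin : 0 < lmin)
    (hmax : 0 < lmax) (p : Rn n) {x : Rn n} (hx : ‖x‖ < 4) :
    -(24 * ‖p‖ * lmax * sphereArea n / σ) ≤ nonlocalOp k (slab p) x := by
  have hI := hk.integrable_secondDifference (x := x) hσ0 hσ hmin
    (φ := fun z => inner ℝ p z) (contDiff_const.inner ℝ contDiff_id) (slab_eventuallyEq p (by linarith))
    (tailIntegrable_slab hσ0 p)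
  have hmB : MeasurableSet (Metric.ball (0 : Rn n) 1) := Metric.isOpen_ball.measurableSet
  have h0 : ∫ y in Metric.ball (0 : Rn n) 1,
      (slab p (x + y) + slab p (x - y) - 2 * slab p x) * k y = 0 := by
    rw [setIntegral_congr_fun (g := fun _ => (0 : ℝ)) hmB, integral_zero]
    intro y hy
    have hy' : ‖y‖ < 1 := by simpa using hy
    have a1 : ‖x + y‖ < 6 := (norm_add_le _ _).trans_lt (by linarith)
    have a2 : ‖x - y‖ < 6 := (norm_sub_le _ _).trans_lt (by linarith)
    simp only [slab_of_mem p a1, slab_of_mem p a2, slab_of_mem p (show ‖x‖ < 6 by linarith),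
      inner_add_right, inner_sub_right]
    ring
  have h1 : -(24 * ‖p‖ * lmax * ((2 - σ) * (sphereArea n * ((1 : ℝ) ^ (-σ) / σ)))) ≤
      ∫ y in (Metric.ball (0 : Rn n) 1)ᶜ,
        (slab p (x + y) + slab p (x - y) - 2 * slab p x) * k y := by
    rw [← integral_modelKernel hσ0 one_pos, ← integral_const_mul, ← integral_neg]
    refine integral_mono_ae ((integrableOn_modelKernel hσ0 one_pos).const_mul _).neg
      hI.integrableOn ?_
    filter_upwards [ae_restrict_of_ae ae_ne_zero] with y hy0
    have hk0 := hk.nonneg hσ hmin hy0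
    have b1 := abs_le.1 (abs_slab_le p (x + y))
    have b2 := abs_le.1 (abs_slab_le p (x - y))
    have b3 := abs_le.1 (abs_slab_le p x)
    have b4 : -(24 * ‖p‖) ≤ slab p (x + y) + slab p (x - y) - 2 * slab p x := by linarith
    refine le_trans ?_ (mul_le_mul_of_nonneg_right b4 hk0)
    have : 24 * ‖p‖ * k y ≤ 24 * ‖p‖ * (lmax * modelKernel n σ y) := by
      gcongr; exact hk.upper y hy0
    linarith
  rw [nonlocalOp, ← integral_add_compl hmB hI, h0, zero_add]
  rw [Real.one_rpow] at h1
  have h2 : 24 * ‖p‖ * lmax * ((2 - σ) * (sphereArea n * (1 / σ))) ≤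
      24 * ‖p‖ * lmax * (2 * (sphereArea n * (1 / σ))) := by
    have := sphereArea_pos n
    gcongr
    linarith
  have e : 24 * ‖p‖ * lmax * (2 * (sphereArea n * (1 / σ))) =
      2 * (24 * ‖p‖ * lmax * sphereArea n / σ) := by ring
  linarith

end Slab

/-! ### Sliding test functions to a contact point. -/

section Contact

variable {n : ℕ}

/-- Sliding the functions `ψ + ⟨p, ·⟩` from below under a nonnegative supersolution that is small
somewhere, the contact point lies near the origin and the equation controls the gap. -/
lemma exists_contact (n : ℕ) [NeZero n] {σ₀ lmin lmax : ℝ} (hσ₀ : 0 < σ₀) (hmin : 0 < lmin)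
    (hmax : 0 < lmax) :
    ∃ (ψ : Rn n → ℝ) (M₀ η ε C₀ : ℝ), 0 < M₀ ∧ 0 < η ∧ η ≤ 1 ∧ 0 < ε ∧ 0 < C₀ ∧
      (∀ z, ψ z ≤ M₀) ∧
      ∀ σ, σ₀ ≤ σ → σ < 2 → ∀ (K : Rn n → Rn n → ℝ) (u : Rn n → ℝ),
        Supersol σ lmin lmax K ε (Metric.ball 0 7) u → (∀ z, 0 ≤ u z) →
        (∃ x ∈ Metric.closedBall (0 : Rn n) 3, u x ≤ 1) → ∀ p : Rn n, ‖p‖ ≤ η →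
        ∃ (x : Rn n) (m : ℝ), ‖x‖ < 1 / 4 ∧ m ≤ 0 ∧
          (∀ z, ψ z + slab p z + m ≤ u z) ∧ u x = ψ x + slab p x + m ∧
          AEStronglyMeasurable (fun y => u (x + y) - (ψ (x + y) + slab p (x + y) + m)) ∧
          Integrable (fun y => (u (x + y) - (ψ (x + y) + slab p (x + y) + m)) * K x y) ∧
          ∫ y, (u (x + y) - (ψ (x + y) + slab p (x + y) + m)) * K x y ≤ C₀ := by
  obtain ⟨ρ, D, hρ, hD, hbar⟩ := exists_gaussian_barrier n hσ₀ hmin hmax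
  have hω := sphereArea_pos n
  set g3 : ℝ := Real.exp (-(3 ^ 2 / ρ ^ 2)) with hg3
  set g4 : ℝ := Real.exp (-(4 ^ 2 / ρ ^ 2)) with hg4
  have hg34 : g4 < g3 := by
    rw [hg3, hg4, Real.exp_lt_exp]
    gcongr
    norm_num
  have hg4pos : 0 < g4 := Real.exp_pos _
  -- The scaled Gaussian drops by 11 between |z| = 3 and |z| = 4. This exceeds 1 + 3 + 6: the value
  -- of u at x₀ and the sizes of the linear part on the balls of radii 3 and 6. Hence contact occurs
  -- in |x| < 4.
  set M₀ : ℝ := 11 / (g3 - g4) with hM₀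
  have hM₀pos : 0 < M₀ := div_pos (by norm_num) (by linarith)
  have hM₀eq : M₀ * g3 - M₀ * g4 = 11 := by
    rw [hM₀, ← mul_sub]
    exact div_mul_cancel₀ _ (sub_pos.2 hg34).ne'
  -- `c₁` is a lower bound for the operator on the scaled Gaussian in 1/4 ≤ |x| < 4. The right-hand
  -- side may use c₁/2 and the slab c₁/4, so contact there is impossible.
  set c₁ : ℝ := M₀ * (g4 * sphereArea n) with hc₁
  have hc₁pos : 0 < c₁ := by positivity
  set E : ℝ := 24 * lmax * sphereArea n / σ₀ with hE
  have hEpos : 0 < E := by positivity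
  set η : ℝ := min 1 (c₁ / 4 / E) with hη
  have hηpos : 0 < η := lt_min one_pos (by positivity)
  refine ⟨fun z => M₀ * gaussian ρ z, M₀, η, c₁ / 2, c₁ + M₀ * D, hM₀pos, hηpos, min_le_left _ _,
    by positivity, by positivity,
    fun z => mul_le_of_le_one_right hM₀pos.le (gaussian_le_one z), ?_⟩
  rintro σ hσσ hσ K u hS hu ⟨x₀, hx₀, hux₀⟩ p hp
  have hσ0 : 0 < σ := hσ₀.trans_le hσσ
  have hx₀' : ‖x₀‖ ≤ 3 := by simpa using hx₀
  have hp1 : ‖p‖ ≤ 1 := hp.trans (min_le_left _ _)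
  have hgle : ∀ z : Rn n, 4 ≤ ‖z‖ → gaussian ρ z ≤ g4 := fun z hz => by
    rw [gaussian, hg4, Real.exp_le_exp]; gcongr
  have hgge : ∀ z : Rn n, ‖z‖ ≤ 4 → g4 ≤ gaussian ρ z := fun z hz => by
    rw [gaussian, hg4, Real.exp_le_exp]; gcongr
  have hgge3 : g3 ≤ gaussian ρ x₀ := by
    rw [gaussian, hg3, Real.exp_le_exp]; gcongr
  have hinner : ∀ z : Rn n, |inner ℝ p z| ≤ ‖z‖ := fun z =>
    (abs_real_inner_le_norm p z).trans (mul_le_of_le_one_left (norm_nonneg z) hp1)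
  have hcont : ContinuousOn (fun z => u z - M₀ * gaussian ρ z - inner ℝ p z)
      (Metric.closedBall (0 : Rn n) 6) := by
    refine ((hS.continuousOn.mono (Metric.closedBall_subset_ball (by norm_num))).sub ?_).sub ?_
    · exact (continuous_const.mul continuous_gaussian).continuousOn
    · fun_prop
  obtain ⟨x, hx6, hxmin⟩ := (isCompact_closedBall (0 : Rn n) 6).exists_isMinOn
    ⟨0, by simp⟩ hcont
  set m : ℝ := u x - M₀ * gaussian ρ x - inner ℝ p x with hm
  have hmin' : ∀ z, ‖z‖ ≤ 6 → m ≤ u z - M₀ * gaussian ρ z - inner ℝ p z := fun z hz =>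
    hxmin (by simpa using hz)
  have hm1 : m ≤ 4 - M₀ * g3 := by
    have h1 := hmin' x₀ (by linarith)
    have h2 := (abs_le.1 (hinner x₀)).1
    have h3 : M₀ * g3 ≤ M₀ * gaussian ρ x₀ := by gcongr
    linarith
  have hx6' : ‖x‖ ≤ 6 := by simpa using hx6
  have hx4 : ‖x‖ < 4 := by
    by_contra! hx4
    have h1 : M₀ * gaussian ρ x ≤ M₀ * g4 := by gcongr; exact hgle x hx4
    have h2 := (abs_le.1 (hinner x)).2
    have h3 := hu x
    linarith
  have hMg4 : 0 < M₀ * g4 := by positivity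
  -- The minimum was taken over |z| ≤ 6 only; beyond that radius the touching function is negative,
  -- again by the drop of 11.
  have hle : ∀ z, M₀ * gaussian ρ z + slab p z + m ≤ u z := by
    intro z
    rcases lt_or_ge ‖z‖ 6 with h | h
    · rw [slab_of_mem p h]
      linarith [hmin' z h.le]
    · rw [slab_of_notMem p h]
      have h1 : M₀ * gaussian ρ z ≤ M₀ * g4 := by gcongr; exact hgle z (by linarith)
      linarith [hu z]
  have hxeq : M₀ * gaussian ρ x + slab p x + m = u x := by
    rw [slab_of_mem p (by linarith), hm]; ring
  have hT : TailIntegrable σ fun z => M₀ * gaussian ρ z + slab p z + m :=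
    (((tailIntegrable_gaussian hσ0).const_mul M₀).add (tailIntegrable_slab hσ0 p)).add
      (tailIntegrable_const hσ0 m)
  have hslab := slab_eventuallyEq p (show ‖x‖ < 6 by linarith)
  have hx7 : x ∈ Metric.ball (0 : Rn n) 7 := by simp; linarith
  have hk := hS.kernel x hx7
  obtain ⟨hI, hop⟩ := hS.touch x hx7 (fun z => M₀ * gaussian ρ z + slab p z + m)
    (fun z => M₀ * gaussian ρ z + inner ℝ p z + m)
    (((contDiff_const.mul contDiff_gaussian).add (contDiff_const.inner ℝ contDiff_id)).add
      contDiff_const)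
    (hslab.mono fun z hz => by simp only [hz]) hT hle hxeq
  have hopeq : nonlocalOp (K x) (fun z => M₀ * gaussian ρ z + slab p z + m) x =
      M₀ * nonlocalOp (K x) (gaussian ρ) x + nonlocalOp (K x) (slab p) x := by
    have i1 := hk.integrable_secondDifference (x := x) hσ0 hσ hmin contDiff_gaussian
      (EventuallyEq.refl _ (gaussian ρ)) (tailIntegrable_gaussian hσ0)
    have i2 := hk.integrable_secondDifference (x := x) hσ0 hσ hmin
      (φ := fun z => inner ℝ p z) (contDiff_const.inner ℝ contDiff_id) hslab (tailIntegrable_slab hσ0 p)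
    have e : ∀ y, (M₀ * gaussian ρ (x + y) + slab p (x + y) + m +
        (M₀ * gaussian ρ (x - y) + slab p (x - y) + m) -
        2 * (M₀ * gaussian ρ x + slab p x + m)) * K x y =
        M₀ * ((gaussian ρ (x + y) + gaussian ρ (x - y) - 2 * gaussian ρ x) * K x y) +
        (slab p (x + y) + slab p (x - y) - 2 * slab p x) * K x y := fun y => by ring
    rw [nonlocalOp, nonlocalOp, nonlocalOp, integral_congr_ae (ae_of_all _ e),
      integral_add (i1.const_mul M₀) i2, integral_const_mul]
    ring
  have hslabge : -(c₁ / 4) ≤ nonlocalOp (K x) (slab p) x := by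
    refine le_trans ?_ (nonlocalOp_slab_ge hk hσ0 hσ hmin hmax p hx4)
    have h1 : 24 * ‖p‖ * lmax * sphereArea n / σ ≤ 24 * η * lmax * sphereArea n / σ₀ := by
      gcongr
    have h2 : 24 * η * lmax * sphereArea n / σ₀ = η * E := by rw [hE]; ring
    have h3 : η * E ≤ c₁ / 4 := by
      rw [← le_div_iff₀ hEpos]; exact min_le_right _ _
    linarith
  obtain ⟨hbar1, hbar2⟩ := hbar σ hσσ hσ (K x) hk
  have hnn : 0 ≤ ∫ y, (u (x + y) - (M₀ * gaussian ρ (x + y) + slab p (x + y) + m)) * K x y := by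
    refine integral_nonneg_of_ae ?_
    filter_upwards [ae_ne_zero] with y hy
    exact mul_nonneg (sub_nonneg.2 (hle _)) (hk.nonneg hσ hmin hy)
  have hxq : ‖x‖ < 1 / 4 := by
    by_contra! hxq
    have h1 : c₁ ≤ M₀ * nonlocalOp (K x) (gaussian ρ) x := by
      rw [hc₁]
      gcongr
      refine le_trans ?_ (hbar1 x hxq)
      gcongr
      exact hgge x hx4.le
    linarith
  refine ⟨x, m, hxq, by linarith, hle, hxeq.symm, ?_, hI, ?_⟩
  · have := ((hS.tailIntegrable.sub hT).comp_affine hσ0 x one_pos).aestronglyMeasurable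
    simpa only [one_smul] using this
  · have h1 : M₀ * (-D) ≤ M₀ * nonlocalOp (K x) (gaussian ρ) x := by gcongr; exact hbar2 x
    linarith

end Contact

/-! ### The measure estimate, by counting slopes. -/

section PointEstimate

variable {n : ℕ}

/-- A nonnegative supersolution that is small at some point is bounded on a set of positive
measure. -/
theorem exists_point_estimate (n : ℕ) [NeZero n] {σ₀ lmin lmax : ℝ} (hσ₀ : 0 < σ₀)
    (hmin : 0 < lmin) (hmax : 0 < lmax) :
    ∃ ε M μ : ℝ, 0 < ε ∧ 1 < M ∧ 0 < μ ∧
      ∀ σ, σ₀ ≤ σ → σ < 2 → ∀ (K : Rn n → Rn n → ℝ) (u : Rn n → ℝ),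
        Supersol σ lmin lmax K ε (Metric.ball 0 7) u → (∀ z, 0 ≤ u z) →
        (∃ x ∈ Metric.closedBall (0 : Rn n) 3, u x ≤ 1) →
        μ * volume.real (Metric.closedBall (0 : Rn n) 1) ≤
          volume.real (Metric.closedBall (0 : Rn n) 1 ∩ {y | u y ≤ M}) := by
  obtain ⟨ψ, M₀, η, ε, C₀, hM₀, hη, hη1, hε, hC₀, hψ, hcontact⟩ :=
    exists_contact n hσ₀ hmin hmax
  set b := volume.real (Metric.ball (0 : Rn n) 1) with hb
  have hb0 : 0 < b := volume_unitBall_pos n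
  -- δRⁿ is half the volume of a ball of radius R/20, so at least half of such a ball about a
  -- contact point is good.
  set δ : ℝ := (1 / 20) ^ n / 2 * b with hδ
  have hδ0 : 0 < δ := by positivity
  set C₁ : ℝ := 9 * C₀ / (lmin * δ) with hC₁
  have hC₁0 : 0 < C₁ := by positivity
  have hC₁C₀ : 8 * C₀ < lmin * δ * C₁ := by
    rw [hC₁, mul_div_cancel₀ _ (by positivity)]; linarith
  set μ : ℝ := η ^ n / (2 * (80 * C₁) ^ n) with hμ
  -- At good points u is at most ψ ≤ M₀, plus the slab ≤ 6, plus the paraboloid ≤ C₁; the constant m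
  -- is nonpositive.
  refine ⟨ε, M₀ + 6 + C₁, μ, hε, by linarith, by positivity, ?_⟩
  intro σ hσσ hσ K u hS hu hx₀
  have hσ0 : 0 < σ := hσ₀.trans_le hσσ
  choose! x m hx hm hle hxeq hwm hwi hwC using hcontact σ hσσ hσ K u hS hu hx₀
  have hrad : ∀ p : Rn n, ‖p‖ ≤ η → ∃ R, 0 < R ∧ R ≤ 1 / 2 ∧
      volume.real {y | y ∈ Metric.ball (0 : Rn n) R ∧
        C₁ * R ^ 2 < u (x p + y) - (ψ (x p + y) + slab p (x p + y) + m p)} ≤ δ * R ^ n :=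
    fun p hp => exists_radius_mostly_below_paraboloid
      (hS.kernel (x p) (by simp; linarith [hx p hp])) hσ0 hσ hmin
      (fun y => sub_nonneg.2 (hle p hp _)) (hwm p hp) (hwi p hp) (hwC p hp) hC₁0 hδ0 hC₁C₀
  choose! R hR hR2 hbad using hrad
  have hmem : ∀ p ∈ Metric.closedBall (0 : Rn n) η, ‖p‖ ≤ η := fun p hp => by simpa using hp
  set A : Set (Rn n) := Metric.closedBall (0 : Rn n) 1 ∩ {y | u y ≤ M₀ + 6 + C₁} with hA
  have hAm : MeasurableSet A :=
    ((hS.continuousOn.mono (Metric.closedBall_subset_ball (by norm_num))).preimage_isClosed_of_isClosed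
      Metric.isClosed_closedBall isClosed_Iic).measurableSet
  have hAf : volume A ≠ ∞ :=
    (measure_lt_top_of_subset inter_subset_left measure_closedBall_lt_top.ne).ne
  have hgood : ∀ p ∈ Metric.closedBall (0 : Rn n) η,
      volume (Metric.closedBall (x p) (R p / 20)) ≤
        2 * volume (A ∩ Metric.closedBall (x p) (R p / 20)) := by
    intro p hp
    replace hp := hmem p hp
    have hRp := hR p hp
    set S := {y | y ∈ Metric.ball (0 : Rn n) (R p) ∧
        C₁ * R p ^ 2 < u (x p + y) - (ψ (x p + y) + slab p (x p + y) + m p)} with hSdef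
    have hSf : volume S ≠ ∞ :=
      (measure_lt_top_of_subset (fun y hy => hy.1) measure_ball_lt_top.ne).ne
    have hsub : Metric.closedBall (x p) (R p / 20) ⊆
        (A ∩ Metric.closedBall (x p) (R p / 20)) ∪ (fun y => - x p + y) ⁻¹' S := by
      intro y hy
      by_cases hyS : -x p + y ∈ S
      · exact Or.inr hyS
      · refine Or.inl ⟨⟨?_, ?_⟩, hy⟩
        · have h1 : ‖y - x p‖ ≤ R p / 20 := by simpa [dist_eq_norm] using hy
          have h2 : ‖y‖ ≤ ‖y - x p‖ + ‖x p‖ := by simpa using norm_add_le (y - x p) (x p)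
          have h3 := hx p hp
          have h4 := hR2 p hp
          simp
          linarith
        · have h1 : ‖y - x p‖ ≤ R p / 20 := by simpa [dist_eq_norm] using hy
          have h2 : -x p + y ∈ Metric.ball (0 : Rn n) (R p) := by
            rw [neg_add_eq_sub]
            simp
            linarith
          have h3 : u y - (ψ y + slab p y + m p) ≤ C₁ * R p ^ 2 := by
            by_contra! hlt
            exact hyS ⟨h2, by simpa using hlt⟩
          have h4 := (abs_le.1 (abs_slab_le p y)).2
          have h5 : C₁ * R p ^ 2 ≤ C₁ := by
            have := hR2 p hp
            have : R p ^ 2 ≤ 1 := by nlinarith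
            nlinarith
          have h6 := hψ y
          have h7 := hm p hp
          simp only [mem_ofPred_eq]
          linarith
    have h1 : volume.real (Metric.closedBall (x p) (R p / 20)) ≤
        volume.real (A ∩ Metric.closedBall (x p) (R p / 20)) + volume.real S := by
      have e : volume.real ((fun y => - x p + y) ⁻¹' S) = volume.real S := by
        rw [Measure.real, measure_preimage_add]; rfl
      rw [← e]
      refine (measureReal_mono hsub (measure_union_ne_top ?_ ?_)).trans (measureReal_union_le _ _)
      · exact (measure_lt_top_of_subset inter_subset_left hAf).ne
      · rw [measure_preimage_add]; exact hSf
    have h2 := hbad p hp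
    have h3 : volume.real (Metric.closedBall (x p) (R p / 20)) = 2 * (δ * R p ^ n) := by
      rw [volume_closedBall_Rn _ (by positivity), hδ, div_eq_mul_one_div (R p), mul_pow]; ring
    have h4 : volume.real (Metric.closedBall (x p) (R p / 20)) ≤
        2 * volume.real (A ∩ Metric.closedBall (x p) (R p / 20)) := by linarith
    have f1 : volume (A ∩ Metric.closedBall (x p) (R p / 20)) ≠ ∞ :=
      (measure_lt_top_of_subset inter_subset_left hAf).ne
    rw [← ENNReal.toReal_le_toReal measure_closedBall_lt_top.ne
      (ENNReal.mul_ne_top (by simp) f1), ENNReal.toReal_mul]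
    exact h4
  -- The balls are indexed by slopes but centred at contact points. The enlargement factor 5 turns
  -- R/20 into R/4, the distance allowed in `norm_slope_sub_le`.
  obtain ⟨U, hUt, hUd, hUcov⟩ := Vitali.exists_disjoint_subfamily_covering_enlargement_closedBall
    (Metric.closedBall (0 : Rn n) η) x (fun p => R p / 20) (1 / 40)
    (fun p hp => by linarith [hR2 p (hmem p hp)]) 5 (by norm_num)
  obtain ⟨hUc, hUsum⟩ := tsum_volume_closedBall_le (A := A) (c := 2)
    (fun p hp => by have := hR p (hmem p (hUt hp)); positivity) hUd hAm
    (fun p hp => hgood p (hUt hp))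
  have hslope : Metric.closedBall (0 : Rn n) η ⊆
      ⋃ q ∈ U, Metric.closedBall q (4 * C₁ * R q) := by
    intro p hp
    obtain ⟨q, hq, hpq⟩ := hUcov p hp
    refine mem_iUnion₂.2 ⟨q, hq, ?_⟩
    replace hp := hmem p hp
    have hqη := hmem q (hUt hq)
    have hRq := hR q hqη
    have hR2q := hR2 q hqη
    have hxx : ‖x p - x q‖ ≤ R q / 4 := by
      have := hpq (Metric.mem_closedBall_self (by have := hR p hp; positivity))
      rw [Metric.mem_closedBall, dist_eq_norm] at this
      linarith
    rw [Metric.mem_closedBall, dist_eq_norm]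
    have hin : ∀ y : Rn n, ‖y‖ < R q → ‖x q + y‖ < 6 := fun y hy =>
      (norm_add_le _ _).trans_lt (by linarith [hx q hqη])
    refine norm_slope_sub_le (V := fun z => u z - ψ z) (x := x q) (x' := x p) (m := m q) (m' := m p)
      hRq hC₁0.le (fun y hy => ?_) ?_ ?_ hxx ?_
    · have h1 : ‖y - x q‖ < R q := by simpa [dist_eq_norm] using hy
      have h2 := hin _ h1
      rw [add_sub_cancel] at h2
      have := hle p hp y
      rw [slab_of_mem p h2] at this
      linarith
    · have := hxeq p hp
      rw [slab_of_mem p (by linarith [hx p hp])] at this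
      linarith
    · have := hle q hqη (x p)
      rw [slab_of_mem q (by linarith [hx p hp])] at this
      linarith
    · have e : {y | y ∈ Metric.ball (0 : Rn n) (R q) ∧ C₁ * R q ^ 2 <
          u (x q + y) - ψ (x q + y) - inner ℝ q (x q + y) - m q} =
          {y | y ∈ Metric.ball (0 : Rn n) (R q) ∧
        C₁ * R q ^ 2 < u (x q + y) - (ψ (x q + y) + slab q (x q + y) + m q)} := by
        ext y
        refine and_congr_right fun hy => ?_
        rw [slab_of_mem q (hin y (by simpa using hy))]
        constructor <;> intro h <;> linarith
      rw [e]
      refine (hbad q hqη).trans_lt ?_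
      rw [hδ]
      have h1 : ((1 : ℝ) / 20) ^ n ≤ (1 / 4) ^ n := by gcongr; norm_num
      have h2 : 0 < R q ^ n * b := by positivity
      have h3 : (0 : ℝ) < (1 / 20) ^ n := by positivity
      have h4 : (R q / 4) ^ n = (1 / 4) ^ n * R q ^ n := by rw [← mul_pow]; ring
      rw [h4]
      change _ < (1 / 4) ^ n * R q ^ n * b
      nlinarith
  -- A ball of slopes of radius 4C₁R has (80C₁)ⁿ times the volume of the disjoint ball of radius
  -- R/20, at least half of which lies in `A`.
  have hfin : volume (Metric.closedBall (0 : Rn n) η) ≤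
      ENNReal.ofReal ((80 * C₁) ^ n) * (2 * volume A) := by
    calc volume (Metric.closedBall (0 : Rn n) η)
        ≤ ∑' q : U, volume (Metric.closedBall (q : Rn n) (4 * C₁ * R q)) :=
          (measure_mono hslope).trans (measure_biUnion_le _ hUc _)
      _ = ∑' q : U, ENNReal.ofReal ((80 * C₁) ^ n) *
            volume (Metric.closedBall (x q) (R q / 20)) := by
          refine tsum_congr fun q => ?_
          have hRq := hR q (hmem q (hUt q.2))
          rw [Measure.addHaar_closedBall _ _ (by positivity), Measure.addHaar_closedBall _ _
            (by positivity), ← mul_assoc, ← ENNReal.ofReal_mul (by positivity),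
            finrank_euclideanSpace, Fintype.card_fin, ← mul_pow]
          congr 3
          ring
      _ ≤ _ := by
          rw [ENNReal.tsum_mul_left]
          gcongr
  have hfin2 := ENNReal.toReal_mono (by finiteness) hfin
  rw [ENNReal.toReal_mul, ENNReal.toReal_mul, ENNReal.toReal_ofReal (by positivity)] at hfin2
  have e1 : (volume (Metric.closedBall (0 : Rn n) η)).toReal = η ^ n * b :=
    volume_closedBall_Rn _ hη.le
  have e2 : volume.real (Metric.closedBall (0 : Rn n) 1) = b := by
    rw [volume_closedBall_Rn _ zero_le_one, one_pow, one_mul]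
  have e3 : (volume A).toReal = volume.real A := rfl
  rw [e1, e3, ENNReal.toReal_ofNat] at hfin2
  rw [e2, hμ, div_mul_eq_mul_div, div_le_iff₀ (by positivity)]
  linarith

end PointEstimate

/-! ### The growing ink spots lemma. -/

section InkSpots

variable {n : ℕ}

lemma closedBall_toward_subset {x : Rn n} (hx : ‖x‖ ≤ 1) {s : ℝ} (hs1 : s ≤ 1) :
    Metric.closedBall ((1 - s) • x) s ⊆ Metric.closedBall 0 1 := by
  refine Metric.closedBall_subset_closedBall' ?_
  rw [dist_zero_right, norm_smul, Real.norm_of_nonneg (by linarith)]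
  nlinarith

/-- A growing ink spots lemma. -/
lemma growing_ink_spots {E F : Set (Rn n)} {μ : ℝ} (hμ : 0 < μ) (hE : MeasurableSet E)
    (hF : MeasurableSet F) (hEF : E ⊆ F) (hF1 : F ⊆ Metric.closedBall 0 1)
    (h1 : volume.real E ≤ (1 - μ) * volume.real (Metric.closedBall (0 : Rn n) 1))
    (h2 : ∀ (z : Rn n) (s : ℝ), 0 < s → s ≤ 1 → Metric.closedBall z s ⊆ Metric.closedBall 0 1 →
      (1 - μ) * volume.real (Metric.closedBall z s) < volume.real (E ∩ Metric.closedBall z s) →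
      Metric.closedBall z (3 * s) ∩ Metric.closedBall 0 1 ⊆ F) :
    (1 + μ / 5 ^ n) * volume.real E ≤ volume.real F := by
  have hE1 : E ⊆ Metric.closedBall 0 1 := hEF.trans hF1
  set s : ℕ → ℝ := fun j => (1 / 2) ^ j with hs
  have hs0 : ∀ j, 0 < s j := fun j => by positivity
  have hs1 : ∀ j, s j ≤ 1 := fun j => pow_le_one₀ (by norm_num) (by norm_num)
  have hfin : ∀ (z : Rn n) r, volume (Metric.closedBall z r) ≠ ∞ := fun z r =>
    measure_closedBall_lt_top.ne
  have hFfin : volume F ≠ ∞ := (measure_lt_top_of_subset hF1 (hfin _ _)).ne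
  have hslim : Tendsto s atTop (𝓝[>] 0) := tendsto_nhdsWithin_iff.2
    ⟨tendsto_pow_atTop_nhds_zero_of_lt_one (by norm_num) (by norm_num),
      Eventually.of_forall fun j => hs0 j⟩
  -- For |x| ≤ 1 the ball of radius s about (1 - s)x contains x and stays in the unit ball, which is
  -- the case s = 1. This avoids boundary effects.
  set good : Rn n → ℕ → Prop := fun x j =>
    (1 - μ) * volume.real (Metric.closedBall ((1 - s j) • x) (s j)) <
      volume.real (E ∩ Metric.closedBall ((1 - s j) • x) (s j)) with hgood
  set t : Set (Rn n) := {x | x ∈ E ∧ ∃ j, good x j} with ht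
  -- Lebesgue density along balls that contain x without being centred there: almost every point of
  -- E is good at some scale.
  have hae : volume (E \ t) = 0 := by
    have hdens := IsUnifLocDoublingMeasure.ae_tendsto_measure_inter_div (volume : Measure (Rn n)) E 1
    rw [ae_restrict_iff' hE] at hdens
    refine measure_mono_null ?_ hdens
    rintro x ⟨hxE, hxt⟩
    simp only [mem_compl_iff, mem_ofPred_eq]
    intro hx
    refine hxt ⟨hxE, ?_⟩
    have hx1 : ‖x‖ ≤ 1 := by simpa using hE1 hxE
    have hlim := hx hxE (fun j => (1 - s j) • x) s hslim (Eventually.of_forall fun j => by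
      rw [Metric.mem_closedBall, dist_eq_norm, show x - (1 - s j) • x = s j • x by module,
        norm_smul, Real.norm_of_nonneg (hs0 j).le, one_mul]
      exact mul_le_of_le_one_right (hs0 j).le hx1)
    have hlim' := (ENNReal.tendsto_toReal ENNReal.one_ne_top).comp hlim
    obtain ⟨j, hj⟩ := (hlim'.eventually (lt_mem_nhds (show 1 - μ < (1 : ℝ≥0∞).toReal by simpa))).exists
    refine ⟨j, ?_⟩
    simp only [Function.comp_apply, ENNReal.toReal_div] at hj
    have hpos : 0 < volume.real (Metric.closedBall ((1 - s j) • x) (s j)) := by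
      rw [volume_closedBall_Rn _ (hs0 j).le]
      have := volume_unitBall_pos n
      have := hs0 j
      positivity
    exact (lt_div_iff₀ hpos).1 hj
  have hparent : ∀ x ∈ t, ∃ r, 0 < r ∧ r ≤ 1 ∧ x ∈ Metric.closedBall ((1 - r) • x) r ∧
      volume (Metric.closedBall ((1 - r) • x) r) ≤
        ENNReal.ofReal (1 / μ) * volume ((F \ E) ∩ Metric.closedBall ((1 - r) • x) r) := by
    rintro x ⟨hxE, hxj⟩
    have hx1 : ‖x‖ ≤ 1 := by simpa using hE1 hxE
    classical
    -- The least index gives the largest good ball. Its predecessor has twice the radius and is not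
    -- good, yet lies inside the tripled good ball and hence in F, so a fraction μ of it belongs to
    -- F \ E.
    have hj := Nat.find_spec hxj
    have hjmin := fun i => Nat.find_min hxj (m := i)
    set j := Nat.find hxj
    have hj0 : j ≠ 0 := by
      intro h0
      rw [h0] at hj
      simp only [hgood, hs, pow_zero, sub_self, zero_smul] at hj
      rw [inter_eq_self_of_subset_left hE1] at hj
      linarith
    obtain ⟨i, hi⟩ := Nat.exists_eq_succ_of_ne_zero hj0
    have hnot : ¬ good x i := hjmin i (by omega)
    have hsi : s i = 2 * s j := by rw [hi]; simp only [hs, Nat.succ_eq_add_one, pow_succ]; ring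
    have hP1 := closedBall_toward_subset hx1 (hs1 i)
    have hPF : Metric.closedBall ((1 - s i) • x) (s i) ⊆ F := by
      refine Subset.trans (subset_inter ?_ hP1) (h2 _ _ (hs0 j) (hs1 j)
        (closedBall_toward_subset hx1 (hs1 j)) hj)
      refine Metric.closedBall_subset_closedBall' ?_
      rw [dist_eq_norm, hsi, show (1 - 2 * s j) • x - (1 - s j) • x = - (s j • x) by module,
        norm_neg, norm_smul, Real.norm_of_nonneg (hs0 j).le]
      nlinarith [hs0 j]
    refine ⟨s i, hs0 i, hs1 i, ?_, ?_⟩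
    · rw [Metric.mem_closedBall, dist_eq_norm, show x - (1 - s i) • x = s i • x by module,
        norm_smul, Real.norm_of_nonneg (hs0 i).le]
      exact mul_le_of_le_one_right (hs0 i).le hx1
    · set P := Metric.closedBall ((1 - s i) • x) (s i) with hPdef
      have h3 : volume.real (E ∩ P) ≤ (1 - μ) * volume.real P := not_lt.1 hnot
      have h4 : volume.real P = volume.real (P ∩ E) + volume.real (P \ E) :=
        (measureReal_inter_add_sdiff hE (hfin _ _)).symm
      have h5 : volume.real (P \ E) ≤ volume.real ((F \ E) ∩ P) :=
        measureReal_mono (fun y hy => ⟨⟨hPF hy.1, hy.2⟩, hy.1⟩)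
          (measure_lt_top_of_subset inter_subset_right (hfin _ _)).ne
      rw [inter_comm] at h3
      have h6 : volume.real P ≤ 1 / μ * volume.real ((F \ E) ∩ P) := by
        rw [one_div, ← div_eq_inv_mul, le_div_iff₀ hμ]
        linarith
      rw [← ENNReal.toReal_le_toReal (hfin _ _) (ENNReal.mul_ne_top ENNReal.ofReal_ne_top
        (measure_lt_top_of_subset inter_subset_right (hfin _ _)).ne), ENNReal.toReal_mul,
        ENNReal.toReal_ofReal (by positivity)]
      exact h6
  choose! r hr0 hr1 hxr hvol using hparent
  obtain ⟨U, hUt, hUd, hUcov⟩ := Vitali.exists_disjoint_subfamily_covering_enlargement_closedBall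
    t (fun x => (1 - r x) • x) r 1 hr1 5 (by norm_num)
  obtain ⟨hUc, hUsum⟩ := tsum_volume_closedBall_le (fun x hx => hr0 x (hUt hx)) hUd
    (hF.diff hE) (fun x hx => hvol x (hUt hx))
  have hcov : volume E ≤ ENNReal.ofReal (5 ^ n) * (ENNReal.ofReal (1 / μ) * volume (F \ E)) := by
    calc volume E ≤ volume (t ∪ E \ t) := measure_mono fun x hx => by
          by_cases h : x ∈ t
          · exact Or.inl h
          · exact Or.inr ⟨hx, h⟩
      _ ≤ volume t + volume (E \ t) := measure_union_le _ _
      _ = volume t := by rw [hae, add_zero]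
      _ ≤ volume (⋃ x ∈ U, Metric.closedBall ((1 - r x) • x) (5 * r x)) := by
          refine measure_mono fun x hx => ?_
          obtain ⟨y, hy, hxy⟩ := hUcov x hx
          exact mem_iUnion₂.2 ⟨y, hy, hxy (hxr x hx)⟩
      _ ≤ ∑' x : U, volume (Metric.closedBall ((1 - r x) • (x : Rn n)) (5 * r x)) :=
          measure_biUnion_le _ hUc _
      _ = ∑' x : U, ENNReal.ofReal (5 ^ n) *
            volume (Metric.closedBall ((1 - r x) • (x : Rn n)) (r x)) := by
          refine tsum_congr fun x => ?_
          have := hr0 x (hUt x.2)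
          rw [Measure.addHaar_closedBall _ _ (by positivity), Measure.addHaar_closedBall _ _
            (by positivity), ← mul_assoc, ← ENNReal.ofReal_mul (by positivity),
            finrank_euclideanSpace, Fintype.card_fin, ← mul_pow]
      _ ≤ _ := by
          rw [ENNReal.tsum_mul_left]
          gcongr
  have hFE : volume (F \ E) ≠ ∞ := (measure_lt_top_of_subset sdiff_subset hFfin).ne
  have hcov2 := ENNReal.toReal_mono (by finiteness) hcov
  rw [ENNReal.toReal_mul, ENNReal.toReal_mul, ENNReal.toReal_ofReal (by positivity),
    ENNReal.toReal_ofReal (by positivity)] at hcov2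
  have h3 : volume.real E ≤ 5 ^ n * (1 / μ * volume.real (F \ E)) := hcov2
  have h4 : volume.real F = volume.real E + volume.real (F \ E) := by
    rw [← measureReal_inter_add_sdiff hE hFfin, inter_eq_self_of_subset_right hEF]
  have h5 : μ / 5 ^ n * volume.real E ≤ volume.real (F \ E) := by
    calc _ ≤ μ / 5 ^ n * (5 ^ n * (1 / μ * volume.real (F \ E))) := by gcongr
      _ = _ := by field_simp
  linarith

end InkSpots

/-! ### The growth lemma. -/

section Growth

/-- A nonnegative supersolution that is large on half of a ball is bounded from below there. -/
theorem exists_growth (n : ℕ) [NeZero n] {σ₀ lmin lmax : ℝ} (hσ₀ : 0 < σ₀)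
    (hmin : 0 < lmin) (hmax : 0 < lmax) :
    ∃ ε κ : ℝ, 0 < ε ∧ 0 < κ ∧ κ < 1 ∧
      ∀ σ, σ₀ ≤ σ → σ < 2 → ∀ (K : Rn n → Rn n → ℝ) (u : Rn n → ℝ),
        Supersol σ lmin lmax K ε (Metric.ball 0 8) u → (∀ z, 0 ≤ u z) →
        1 / 2 * volume.real (Metric.closedBall (0 : Rn n) 1) ≤
          volume.real (Metric.closedBall (0 : Rn n) 1 ∩ {y | 1 < u y}) →
        ∀ x ∈ Metric.closedBall (0 : Rn n) 1, κ ≤ u x := by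
  obtain ⟨ε, M, μ, hε, hM, hμ, hPE⟩ := exists_point_estimate n hσ₀ hmin hmax
  set q : ℝ := 1 + μ / 5 ^ n with hq
  have hq1 : 1 < q := by rw [hq]; linarith [show 0 < μ / 5 ^ n by positivity]
  -- If u < κ = M^(-k) somewhere, each factor M in the level costs a factor q in measure. The k
  -- steps from level κ to level 1 would leave less than half of the ball.
  obtain ⟨k, hk⟩ := pow_unbounded_of_one_lt 2 hq1
  have hk0 : k ≠ 0 := by rintro rfl; norm_num at hk
  have hM0 : 0 < M := one_pos.trans hM
  set κ : ℝ := (M ^ k)⁻¹ with hκdef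
  have hκ : 0 < κ := by positivity
  refine ⟨ε * κ, κ, by positivity, hκ, inv_lt_one_of_one_lt₀ (one_lt_pow₀ hM hk0), ?_⟩
  intro σ hσσ hσ K u hS hu hhalf x₁ hx₁
  have hσ0 : 0 < σ := hσ₀.trans_le hσσ
  by_contra! hlt
  -- The point estimate at scale s and level t. Dividing by t ≥ κ turns the right-hand side εκ into
  -- at most ε, and |z| + 7s ≤ 8 explains the domain.
  have H : ∀ (z : Rn n) (s t : ℝ), 0 < s → s ≤ 1 → ‖z‖ ≤ 1 → κ ≤ t →
      (∃ y ∈ Metric.closedBall z (3 * s), u y ≤ t) →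
      μ * volume.real (Metric.closedBall z s) ≤
        volume.real (Metric.closedBall z s ∩ {y | u y ≤ M * t}) := by
    rintro z s t hs hs1 hz ht ⟨y, hy, huy⟩
    have ht0 : 0 < t := hκ.trans_le ht
    have hR := ((hS.rescale hσ0 z hs).affine hσ0 (inv_pos.2 ht0) 0).mono (c' := ε)
      (Ω' := Metric.ball 0 7) ?_ ?_
    · have h1 := hPE σ hσσ hσ _ _ hR (fun w => by have := hu (z + s • w); positivity)
        ⟨s⁻¹ • (y - z), ?_, ?_⟩
      · set T : Set (Rn n) := Metric.closedBall z s ∩ {y | u y ≤ M * t} with hT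
        have e : Metric.closedBall (0 : Rn n) 1 ∩ {w | t⁻¹ * u (z + s • w) + 0 ≤ M} =
            (fun w => s • w) ⁻¹' ((fun w => z + w) ⁻¹' T) := by
          ext w
          simp only [mem_inter_iff, mem_preimage, Metric.mem_closedBall, mem_ofPred_eq, hT,
            dist_eq_norm, sub_zero, add_sub_cancel_left, norm_smul,
            Real.norm_of_nonneg hs.le, add_zero]
          rw [inv_mul_le_iff₀ ht0, mul_comm t, mul_le_iff_le_one_right hs]
        rw [e, measureReal_def volume (_ ⁻¹' _), Measure.addHaar_preimage_smul _ hs.ne',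
          measure_preimage_add,
          ENNReal.toReal_mul, ENNReal.toReal_ofReal (abs_nonneg _), abs_of_pos (by positivity),
          finrank_euclideanSpace, Fintype.card_fin, inv_mul_eq_div, le_div_iff₀ (by positivity),
          volume_closedBall_Rn _ zero_le_one] at h1
        rw [volume_closedBall_Rn _ hs.le]
        change _ ≤ volume.real T at h1
        refine le_trans (le_of_eq ?_) h1
        ring
      · rw [Metric.mem_closedBall, dist_eq_norm] at hy
        rw [mem_closedBall_zero_iff, norm_smul, norm_inv, Real.norm_of_nonneg hs.le,
          inv_mul_le_iff₀ hs]
        linarith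
      · rw [smul_smul, mul_inv_cancel₀ hs.ne', one_smul, add_sub_cancel, add_zero,
          inv_mul_le_iff₀ ht0]
        linarith
    · rw [inv_mul_le_iff₀ ht0]
      have h1 : s ^ σ ≤ 1 := Real.rpow_le_one hs.le hs1 hσ0.le
      calc s ^ σ * (ε * κ) ≤ 1 * (ε * t) := by gcongr
        _ = _ := by ring
    · intro w hw
      have hw' : ‖w‖ < 7 := by simpa using hw
      have h1 : ‖z + s • w‖ ≤ ‖z‖ + s * ‖w‖ := by
        simpa [norm_smul, Real.norm_of_nonneg hs.le] using norm_add_le z (s • w)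
      simp only [mem_preimage, Metric.mem_ball, dist_zero_right]
      nlinarith [norm_nonneg w]
  set E : ℕ → Set (Rn n) := fun j => Metric.closedBall 0 1 ∩ {y | M ^ j * κ < u y} with hE
  have hEm : ∀ j, MeasurableSet (E j) := by
    intro j
    have h1 : MeasurableSet (Metric.ball (0 : Rn n) 8 ∩ {y | M ^ j * κ < u y}) :=
      (hS.continuousOn.isOpen_inter_preimage Metric.isOpen_ball isOpen_Ioi).measurableSet
    have h2 : E j = Metric.closedBall 0 1 ∩ (Metric.ball (0 : Rn n) 8 ∩ {y | M ^ j * κ < u y}) := by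
      rw [← inter_assoc, inter_eq_self_of_subset_left
        (Metric.closedBall_subset_ball (by norm_num : (1 : ℝ) < 8))]
    rw [h2]
    exact Metric.isClosed_closedBall.measurableSet.inter h1
  have hfin : ∀ (z : Rn n) r, volume (Metric.closedBall z r) ≠ ∞ := fun z r =>
    measure_closedBall_lt_top.ne
  have hdense : ∀ j (z : Rn n) s, 0 < s → s ≤ 1 → Metric.closedBall z s ⊆ Metric.closedBall 0 1 →
      (1 - μ) * volume.real (Metric.closedBall z s) <
        volume.real (E (j + 1) ∩ Metric.closedBall z s) →
      ∀ y ∈ Metric.closedBall z (3 * s), M ^ j * κ < u y := by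
    intro j z s hs hs1 hsub hd y hy
    by_contra! hy2
    have hz : ‖z‖ ≤ 1 := by simpa using hsub (Metric.mem_closedBall_self hs.le)
    have hMj : 1 ≤ M ^ j := one_le_pow₀ hM.le
    have h1 := H z s (M ^ j * κ) hs hs1 hz (by nlinarith) ⟨y, hy, hy2⟩
    have h2 : Metric.closedBall z s ∩ {y | u y ≤ M * (M ^ j * κ)} ⊆
        Metric.closedBall z s \ E (j + 1) := by
      rintro w ⟨hw1, hw2⟩
      refine ⟨hw1, fun hw3 => ?_⟩
      have a1 : u w ≤ M * (M ^ j * κ) := hw2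
      have a2 : M ^ (j + 1) * κ < u w := hw3.2
      rw [pow_succ] at a2
      linarith
    have h3 := measureReal_mono h2 (measure_lt_top_of_subset sdiff_subset (hfin z s)).ne
    have h4 := measureReal_inter_add_sdiff (hEm (j + 1)) (hfin z s)
    rw [inter_comm] at hd
    linarith
  have hstep : ∀ j, q * volume.real (E (j + 1)) ≤ volume.real (E j) := by
    intro j
    refine growing_ink_spots hμ (hEm _) (hEm _) ?_ inter_subset_left ?_ ?_
    · rintro y ⟨hy1, hy2⟩
      refine ⟨hy1, ?_⟩
      change M ^ (j + 1) * κ < u y at hy2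
      change M ^ j * κ < u y
      refine lt_of_le_of_lt ?_ hy2
      gcongr
      · exact hM.le
      · omega
    -- If E(j+1) were too dense in the unit ball, u would exceed M^j κ ≥ κ also at x₁.
    · by_contra! hd
      have h1 := hdense j 0 1 one_pos le_rfl subset_rfl (by
        rwa [inter_eq_self_of_subset_left inter_subset_left]) x₁
        (Metric.closedBall_subset_closedBall (by norm_num) hx₁)
      have : 1 ≤ M ^ j := one_le_pow₀ hM.le
      nlinarith
    · intro z s hs hs1 hsub hd y hy
      exact ⟨hy.2, hdense j z s hs hs1 hsub hd y hy.1⟩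
  have hiter : ∀ j, q ^ j * volume.real (E j) ≤ volume.real (E 0) := by
    intro j
    induction j with
    | zero => simp
    | succ j ih =>
      refine le_trans ?_ ih
      rw [pow_succ, mul_assoc]
      gcongr
      exact hstep j
  have h1 := hiter k
  have h2 : E k = Metric.closedBall 0 1 ∩ {y | 1 < u y} := by
    simp only [hE, hκdef]
    rw [mul_inv_cancel₀ (by positivity)]
  have h3 : volume.real (E 0) ≤ volume.real (Metric.closedBall (0 : Rn n) 1) :=
    measureReal_mono inter_subset_left (hfin _ _)
  have h4 : 0 < volume.real (Metric.closedBall (0 : Rn n) 1) := by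
    rw [volume_closedBall_Rn _ zero_le_one]
    have := volume_unitBall_pos n
    positivity
  rw [← h2] at hhalf
  have h5 : q ^ k * (1 / 2 * volume.real (Metric.closedBall (0 : Rn n) 1)) ≤
      q ^ k * volume.real (E k) := by gcongr
  nlinarith

end Growth

/-! ### Recentring and rescaling tail integrals. -/

section FarField

variable {n : ℕ}

lemma modelKernel_sub_le {σ : ℝ} (hσ0 : 0 < σ) (hσ : σ < 2) {x z : Rn n} (hz : z ≠ 0)
    (hxz : ‖x‖ ≤ ‖z‖ / 2) : modelKernel n σ (z - x) ≤ 2 ^ (n + 2) * modelKernel n σ z := by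
  have hz0 : 0 < ‖z‖ := norm_pos_iff.2 hz
  have h1 : ‖z‖ / 2 ≤ ‖z - x‖ := by linarith [norm_sub_norm_le z x]
  have h2 : ‖z - x‖ ^ (-(n : ℝ) - σ) ≤ (‖z‖ / 2) ^ (-(n : ℝ) - σ) :=
    Real.rpow_le_rpow_of_nonpos (by positivity) h1 (by linarith [n.cast_nonneg (α := ℝ)])
  have h3 : (‖z‖ / 2) ^ (-(n : ℝ) - σ) = ‖z‖ ^ (-(n : ℝ) - σ) * 2 ^ ((n : ℝ) + σ) := by
    rw [Real.div_rpow hz0.le zero_le_two, div_eq_mul_inv, ← Real.rpow_neg zero_le_two]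
    congr 2
    ring
  have h4 : (2 : ℝ) ^ ((n : ℝ) + σ) ≤ 2 ^ (n + 2) := by
    rw [← Real.rpow_natCast]
    exact Real.rpow_le_rpow_of_exponent_le one_le_two (by push_cast; linarith)
  have h5 : 0 ≤ ‖z‖ ^ (-(n : ℝ) - σ) := by positivity
  rw [modelKernel, modelKernel]
  calc (2 - σ) * ‖z - x‖ ^ (-(n : ℝ) - σ)
      ≤ (2 - σ) * (‖z‖ ^ (-(n : ℝ) - σ) * 2 ^ (n + 2)) := by
        refine mul_le_mul_of_nonneg_left (h2.trans ?_) (by linarith)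
        rw [h3]
        gcongr
    _ = _ := by ring

lemma TailIntegrable.integrable_of_far {σ : ℝ} (hσ0 : 0 < σ) (hσ : σ < 2) {g : Rn n → ℝ}
    (hg : TailIntegrable σ g) {R : ℝ} (hR : 0 < R) (hfar : ∀ z, ‖z‖ < R → g z = 0) :
    Integrable fun z => g z * modelKernel n σ z := by
  have h := hg.integrableOn_mul_modelKernel hσ0 hσ hR 0
  simp only [zero_add] at h
  rw [← integrable_indicator_iff Metric.isOpen_ball.measurableSet.compl] at h
  refine h.congr (ae_of_all _ fun z => ?_)
  by_cases hz : ‖z‖ < R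
  · rw [indicator_of_notMem (by simpa using hz)]
    simp [hfar z hz]
  · rw [indicator_of_mem (by simpa using hz)]

/-- The function lives where |z| ≥ R ≥ 2|x|; there |z - x| ≥ |z|/2, and recentring the kernel costs
a constant factor. -/
lemma TailIntegrable.integral_shift_le {σ : ℝ} (hσ0 : 0 < σ) (hσ : σ < 2) {g : Rn n → ℝ}
    (hg : TailIntegrable σ g) (hg0 : ∀ z, 0 ≤ g z) {R : ℝ} (hR : 0 < R)
    (hfar : ∀ z, ‖z‖ < R → g z = 0) {x : Rn n} (hx : ‖x‖ ≤ R / 2) :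
    Integrable (fun y => g (x + y) * modelKernel n σ y) ∧
    ∫ y, g (x + y) * modelKernel n σ y ≤ 2 ^ (n + 2) * ∫ z, g z * modelKernel n σ z := by
  have hI := hg.integrable_of_far hσ0 hσ hR hfar
  have hle : ∀ z, g z * modelKernel n σ (z - x) ≤ 2 ^ (n + 2) * (g z * modelKernel n σ z) := by
    intro z
    rcases lt_or_ge ‖z‖ R with hz | hz
    · rw [hfar z hz, zero_mul, zero_mul, mul_zero]
    · have := modelKernel_sub_le hσ0 hσ (x := x) (z := z) (norm_pos_iff.1 (hR.trans_le hz))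
        (by linarith)
      calc _ ≤ g z * (2 ^ (n + 2) * modelKernel n σ z) :=
            mul_le_mul_of_nonneg_left this (hg0 z)
        _ = _ := by ring
  have hI2 : Integrable fun z => g z * modelKernel n σ (z - x) := by
    refine (hI.const_mul (2 ^ (n + 2))).mono' (hg.aestronglyMeasurable.mul
      ((measurable_modelKernel σ).comp (measurable_id.sub_const x)).aestronglyMeasurable)
      (ae_of_all _ fun z => ?_)
    rw [Real.norm_of_nonneg (mul_nonneg (hg0 z) (modelKernel_nonneg hσ _))]
    exact hle z
  refine ⟨by simpa using hI2.comp_add_left x, ?_⟩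
  have e := integral_add_left_eq_self (μ := volume) (fun z => g z * modelKernel n σ (z - x)) x
  simp only [add_sub_cancel_left] at e
  rw [e, ← integral_const_mul]
  exact integral_mono hI2 (hI.const_mul _) hle

lemma integral_rescale_modelKernel {σ r : ℝ} (hr : 0 < r) {G : Rn n → ℝ}
    (hG : Integrable fun y => G y * modelKernel n σ y) :
    Integrable (fun z => G (r • z) * modelKernel n σ z) ∧
    ∫ z, G (r • z) * modelKernel n σ z = r ^ σ * ∫ y, G y * modelKernel n σ y := by
  have e : ∀ z : Rn n, G (r • z) * modelKernel n σ z =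
      r ^ ((n : ℝ) + σ) * (G (r • z) * modelKernel n σ (r • z)) := by
    intro z
    rw [modelKernel, modelKernel, norm_smul, Real.norm_of_nonneg hr.le,
      Real.mul_rpow hr.le (norm_nonneg _), show -(n : ℝ) - σ = -((n : ℝ) + σ) by ring,
      Real.rpow_neg hr.le]
    have : r ^ ((n : ℝ) + σ) ≠ 0 := (Real.rpow_pos_of_pos hr _).ne'
    field_simp
  simp only [e]
  refine ⟨(hG.comp_smul hr.ne').const_mul _, ?_⟩
  rw [integral_const_mul, Measure.integral_comp_smul_of_nonneg volume
    (fun y => G y * modelKernel n σ y) r (hR := hr.le), finrank_euclideanSpace, Fintype.card_fin,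
    smul_eq_mul, ← mul_assoc, Real.rpow_add hr, Real.rpow_natCast]
  congr 1
  field_simp

end FarField

/-! ### Growth for functions that may be negative far away. -/

section Step

/-- The growth estimate for supersolutions that may be negative far away. -/
lemma exists_growth_of_small_tail (n : ℕ) [NeZero n] {σ₀ lmin lmax : ℝ} (hσ₀ : 0 < σ₀)
    (hmin : 0 < lmin) (hmax : 0 < lmax) :
    ∃ ε κ : ℝ, 0 < ε ∧ 0 < κ ∧ κ < 1 ∧
      ∀ σ, σ₀ ≤ σ → σ < 2 → ∀ (K : Rn n → Rn n → ℝ) (v : Rn n → ℝ) (b : ℝ), 16 ≤ b →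
        Supersol σ lmin lmax K ε (Metric.ball 0 b) v → (∀ z, ‖z‖ < b → 0 ≤ v z) →
        ∫ z, max (- v z) 0 * modelKernel n σ z ≤ ε →
        1 / 2 * volume.real (Metric.closedBall (0 : Rn n) 1) ≤
          volume.real (Metric.closedBall (0 : Rn n) 1 ∩ {y | 1 < v y}) →
        ∀ x ∈ Metric.closedBall (0 : Rn n) 1, κ ≤ v x := by
  obtain ⟨ε, κ, hε, hκ, hκ1, hgrowth⟩ := exists_growth n hσ₀ hmin hmax
  set c : ℝ := lmax * 2 ^ (n + 2) with hc
  have hc0 : 0 < c := by positivity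
  -- Half of ε goes to the equation for v, the other half to the integral of v⁻; b ≥ 16 ensures |x|
  -- < 8 ≤ b/2 for the recentring.
  refine ⟨min (ε / 2) (ε / 2 / c), κ, lt_min (by positivity) (by positivity), hκ, hκ1, ?_⟩
  intro σ hσσ hσ K v b hb hS hv htail hhalf x hx
  have hσ0 : 0 < σ := hσ₀.trans_le hσσ
  have hb0 : 0 < b := by linarith
  have hsub : Metric.ball (0 : Rn n) 8 ⊆ Metric.ball 0 b := Metric.ball_subset_ball (by linarith)
  have hT : TailIntegrable σ fun z => max (- v z) 0 := hS.tailIntegrable.mono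
    (hS.tailIntegrable.aestronglyMeasurable.neg.sup aestronglyMeasurable_const)
    fun y => by rcases le_total (v y) 0 with h | h <;> simp [h]
  have hd : ∀ x ∈ Metric.ball (0 : Rn n) 8, ∫ y, max (- v (x + y)) 0 * K x y ≤ ε / 2 := by
    intro x hx
    have hx8 : ‖x‖ < 8 := by simpa using hx
    have hk := hS.kernel x (hsub hx)
    obtain ⟨i1, i2⟩ := hT.integral_shift_le hσ0 hσ (fun z => le_max_right _ _) hb0
      (fun z hz => max_eq_right (by linarith [hv z hz])) (x := x) (by linarith)
    calc ∫ y, max (- v (x + y)) 0 * K x y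
        ≤ ∫ y, lmax * (max (- v (x + y)) 0 * modelKernel n σ y) := by
          refine integral_mono_of_nonneg ?_ (i1.const_mul _) ?_
          · filter_upwards [ae_ne_zero] with y hy
            exact mul_nonneg (le_max_right _ _) (hk.nonneg hσ hmin hy)
          · filter_upwards [ae_ne_zero] with y hy
            calc _ ≤ max (- v (x + y)) 0 * (lmax * modelKernel n σ y) :=
                  mul_le_mul_of_nonneg_left (hk.upper y hy) (le_max_right _ _)
              _ = _ := by ring
      _ = lmax * ∫ y, max (- v (x + y)) 0 * modelKernel n σ y := integral_const_mul _ _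
      _ ≤ lmax * (2 ^ (n + 2) * (ε / 2 / c)) := by
          gcongr
          exact i2.trans (by gcongr; exact htail.trans (min_le_right _ _))
      _ = ε / 2 := by rw [hc]; field_simp
  have hpos := (hS.posPart hσ0 hσ hmin hsub Metric.isOpen_ball
    (fun z hz => hv z (by simpa using hsub hz)) hd).mono (c' := ε)
    (by linarith [min_le_left (ε / 2) (ε / 2 / c)]) subset_rfl
  have hres := hgrowth σ hσσ hσ K _ hpos (fun z => le_max_right _ _) (hhalf.trans (le_of_eq (by
    congr 2
    ext y
    simp [not_lt.2 (zero_le_one (α := ℝ))]))) x hx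
  have hx1 : ‖x‖ ≤ 1 := by simpa using hx
  rwa [max_eq_left (hv x (by linarith))] at hres

end Step

/-! ### Control of the far field along the iteration. -/

section Iteration

variable {n : ℕ}

/-- The part of `|u|` outside the unit ball. -/
noncomputable def farPart (u : Rn n → ℝ) : Rn n → ℝ :=
  (Metric.ball (0 : Rn n) 1)ᶜ.indicator fun z => |u z|

lemma farPart_nonneg (u : Rn n → ℝ) (z : Rn n) : 0 ≤ farPart u z :=
  indicator_nonneg (fun _ _ => abs_nonneg _) z

lemma farPart_of_lt (u : Rn n → ℝ) {z : Rn n} (hz : ‖z‖ < 1) : farPart u z = 0 :=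
  indicator_of_notMem (by simpa using hz) _

lemma farPart_of_ge (u : Rn n → ℝ) {z : Rn n} (hz : 1 ≤ ‖z‖) : farPart u z = |u z| :=
  indicator_of_mem (by simpa using hz) _

lemma TailIntegrable.farPart {σ : ℝ} {u : Rn n → ℝ} (hu : TailIntegrable σ u) :
    TailIntegrable σ (farPart u) := by
  refine hu.mono (hu.aestronglyMeasurable.norm.indicator
    Metric.isOpen_ball.measurableSet.compl) fun y => ?_
  rw [abs_of_nonneg (farPart_nonneg u y)]
  exact indicator_le_self' (fun _ _ => abs_nonneg _) y

/-- If the oscillation of `w` decays geometrically up to scale `k`, then after rescaling to that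
scale `w` grows slowly far away. -/
lemma rescaled_growth {b θ α : ℝ} (hb : 16 ≤ b) (hα : 0 < α) (hθ : θ = b ^ (-α)) {w : Rn n → ℝ}
    (hw : ∀ x, ‖x‖ < 1 → |w x| ≤ 1 / 2) {x₀ : Rn n} (hx₀ : ‖x₀‖ < 1 / 2) {k : ℕ}
    (hosc : ∀ j ≤ k, ∃ m, ∀ x, ‖x - x₀‖ ≤ 1 / 2 * b⁻¹ ^ j → |w x - m| ≤ θ ^ j) {m : ℝ}
    (hm : ∀ x, ‖x - x₀‖ ≤ 1 / 2 * b⁻¹ ^ k → |w x - m| ≤ θ ^ k) {z : Rn n} (hz : b ≤ ‖z‖) :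
    |w (x₀ + (1 / 2 * b⁻¹ ^ (k + 1)) • z) - m| / θ ^ k ≤
      3 * ‖z‖ ^ α + farPart w (x₀ + (1 / 2 * b⁻¹ ^ (k + 1)) • z) / θ ^ k := by
  have hb0 : 0 < b := by linarith
  have hθ0 : 0 < θ := by rw [hθ]; positivity
  have hθ1 : θ ≤ 1 := by
    rw [hθ]; exact Real.rpow_le_one_of_one_le_of_nonpos (by linarith) (by linarith)
  have hpow : ∀ j, b ^ j ≤ ‖z‖ → 1 ≤ θ ^ j * ‖z‖ ^ α := by
    intro j hj
    have h1 : (b ^ j) ^ α ≤ ‖z‖ ^ α := Real.rpow_le_rpow (by positivity) hj hα.le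
    have h2 : θ ^ j * (b ^ j) ^ α = 1 := by
      rw [hθ, ← Real.rpow_natCast, ← Real.rpow_natCast, ← Real.rpow_mul hb0.le,
        ← Real.rpow_mul hb0.le, ← Real.rpow_add hb0]
      simp [mul_comm]
    rw [← h2]
    gcongr
  have hwx₀ : |w x₀ - m| ≤ θ ^ k := hm x₀ (by simp; positivity)
  have hfp := farPart_nonneg w (x₀ + (1 / 2 * b⁻¹ ^ (k + 1)) • z)
  have hθk : 0 < θ ^ k := by positivity
  have hzα : 0 ≤ ‖z‖ ^ α := by positivity
  rw [div_le_iff₀ hθk, add_mul, div_mul_cancel₀ _ hθk.ne']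
  have hnorm : ‖(1 / 2 * b⁻¹ ^ (k + 1)) • z‖ = 1 / 2 * b⁻¹ ^ (k + 1) * ‖z‖ := by
    rw [norm_smul, Real.norm_of_nonneg (by positivity)]
  -- With b^j ≤ |z| < b^(j+1), the point lies in the ball of scale k - j if j ≤ k, where the
  -- oscillation is already known. For j > k only the crude bound on w and its far part is
  -- available.
  obtain ⟨j, hj1, hj2⟩ := exists_nat_pow_near (show 1 ≤ ‖z‖ by linarith) (show 1 < b by linarith)
  rcases le_or_gt j k with hjk | hjk
  · obtain ⟨i, rfl⟩ := Nat.exists_eq_add_of_le hjk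
    obtain ⟨m', hm'⟩ := hosc i (by omega)
    have hball : ‖x₀ + (1 / 2 * b⁻¹ ^ (j + i + 1)) • z - x₀‖ ≤ 1 / 2 * b⁻¹ ^ i := by
      rw [add_sub_cancel_left, hnorm]
      calc 1 / 2 * b⁻¹ ^ (j + i + 1) * ‖z‖ ≤ 1 / 2 * b⁻¹ ^ (j + i + 1) * b ^ (j + 1) := by gcongr
        _ = 1 / 2 * b⁻¹ ^ i := by
          rw [show j + i + 1 = i + (j + 1) by ring, pow_add, inv_pow b (j + 1)]
          field_simp
    have h1 := abs_le.1 (hm' _ hball)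
    have h2 := abs_le.1 (hm' x₀ (by simp; positivity))
    have h3 := abs_le.1 hwx₀
    have h4 : θ ^ (j + i) ≤ θ ^ i := pow_le_pow_of_le_one hθ0.le hθ1 (by omega)
    have h5 := hpow j hj1
    have h6 : θ ^ i ≤ ‖z‖ ^ α * θ ^ (j + i) := by
      rw [pow_add]
      have : 0 < θ ^ i := by positivity
      nlinarith
    have h7 : |w (x₀ + (1 / 2 * b⁻¹ ^ (j + i + 1)) • z) - m| ≤ 3 * θ ^ i :=
      abs_le.2 ⟨by linarith, by linarith⟩
    linarith
  · have hbk : b ^ (k + 1) ≤ ‖z‖ := (pow_le_pow_right₀ (by linarith) hjk).trans hj1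
    have h5 := hpow k ((pow_le_pow_right₀ (by linarith) (by omega)).trans hbk)
    have h6 := abs_le.1 (hw x₀ (by linarith))
    have h7 : θ ^ k ≤ 1 := pow_le_one₀ hθ0.le hθ1
    have h3 := abs_le.1 hwx₀
    have h8 : |m| ≤ 3 / 2 := abs_le.2 ⟨by linarith, by linarith⟩
    have h9 : |w (x₀ + (1 / 2 * b⁻¹ ^ (k + 1)) • z)| ≤
        1 / 2 + farPart w (x₀ + (1 / 2 * b⁻¹ ^ (k + 1)) • z) := by
      rcases lt_or_ge ‖x₀ + (1 / 2 * b⁻¹ ^ (k + 1)) • z‖ 1 with h | h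
      · linarith [hw _ h]
      · rw [farPart_of_ge w h]; linarith
    have := abs_sub (w (x₀ + (1 / 2 * b⁻¹ ^ (k + 1)) • z)) m
    linarith

/-- The growth |z|^α beyond radius b is integrable with a negative power of b to spare, since σ - α
≥ σ₀/2. The original tail gains r^σ from rescaling, which compensates the division by θ^k. -/
lemma rescaled_tail_le [NeZero n] {σ₀ σ b θ α η : ℝ} (hσ₀ : 0 < σ₀) (hσσ : σ₀ ≤ σ) (hσ : σ < 2)
    (hb : 16 ≤ b) (hα : 0 < α) (hασ : α ≤ σ₀ / 2) (hθ : θ = b ^ (-α)) {w : Rn n → ℝ}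
    (hwt : TailIntegrable σ w) (hwη : ∫ z, farPart w z * modelKernel n σ z ≤ η)
    (hw : ∀ x, ‖x‖ < 1 → |w x| ≤ 1 / 2) {x₀ : Rn n} (hx₀ : ‖x₀‖ < 1 / 2) {k : ℕ}
    (hosc : ∀ j ≤ k, ∃ m, ∀ x, ‖x - x₀‖ ≤ 1 / 2 * b⁻¹ ^ j → |w x - m| ≤ θ ^ j) {m : ℝ}
    (hm : ∀ x, ‖x - x₀‖ ≤ 1 / 2 * b⁻¹ ^ k → |w x - m| ≤ θ ^ k)
    (hr : (1 / 2 * b⁻¹ ^ (k + 1)) ^ σ ≤ θ ^ k)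
    {v : Rn n → ℝ} (hv : ∀ z, v z = 2 / θ ^ k * (w (x₀ + (1 / 2 * b⁻¹ ^ (k + 1)) • z) - m) + 2)
    (hv0 : ∀ z, ‖z‖ < b → 0 ≤ v z) :
    ∫ z, max (- v z) 0 * modelKernel n σ z ≤
      24 * sphereArea n / σ₀ * b ^ (-(σ₀ / 2)) + 2 * 2 ^ (n + 2) * η := by
  have hσ0 : 0 < σ := hσ₀.trans_le hσσ
  have hb0 : 0 < b := by linarith
  have hθ0 : 0 < θ := by rw [hθ]; positivity
  set r : ℝ := 1 / 2 * b⁻¹ ^ (k + 1) with hrdef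
  have hr0 : 0 < r := by positivity
  have hθk : 0 < θ ^ k := by positivity
  have hα' : α < σ := by linarith
  have hω := sphereArea_pos n
  obtain ⟨i1, e1⟩ := hwt.farPart.integral_shift_le hσ0 hσ (farPart_nonneg w) one_pos
    (fun z hz => farPart_of_lt w hz) (x := x₀) (by linarith)
  obtain ⟨i2, e2⟩ := integral_rescale_modelKernel (G := fun y => farPart w (x₀ + y)) hr0 i1
  have hmB : MeasurableSet (Metric.ball (0 : Rn n) b) := Metric.isOpen_ball.measurableSet
  have i3 : Integrable ((Metric.ball (0 : Rn n) b)ᶜ.indicator fun z => ‖z‖ ^ α * modelKernel n σ z) :=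
    (integrable_indicator_iff hmB.compl).2 (integrableOn_rpow_modelKernel hα' hb0)
  have hpt : ∀ z, max (- v z) 0 * modelKernel n σ z ≤
      6 * (Metric.ball (0 : Rn n) b)ᶜ.indicator (fun z => ‖z‖ ^ α * modelKernel n σ z) z +
      2 / θ ^ k * (farPart w (x₀ + r • z) * modelKernel n σ z) := by
    intro z
    have hk0 := modelKernel_nonneg hσ z
    have hf := farPart_nonneg w (x₀ + r • z)
    rcases lt_or_ge ‖z‖ b with hz | hz
    · rw [max_eq_right (by linarith [hv0 z hz]), zero_mul,
        indicator_of_notMem (by simpa using hz)]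
      positivity
    · rw [indicator_of_mem (by simpa using hz)]
      have h1 := rescaled_growth hb hα hθ hw hx₀ hosc hm hz
      rw [← hrdef] at h1
      have h2 : max (- v z) 0 ≤ 2 * (|w (x₀ + r • z) - m| / θ ^ k) := by
        refine max_le ?_ (by positivity)
        rw [hv]
        have := neg_abs_le (w (x₀ + r • z) - m)
        have h3 : 2 / θ ^ k * (-|w (x₀ + r • z) - m|) ≤ 2 / θ ^ k * (w (x₀ + r • z) - m) := by
          gcongr
        have h4 : 2 * (|w (x₀ + r • z) - m| / θ ^ k) =
          - (2 / θ ^ k * (-|w (x₀ + r • z) - m|)) := by ring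
        linarith
      calc max (- v z) 0 * modelKernel n σ z
          ≤ 2 * (3 * ‖z‖ ^ α + farPart w (x₀ + r • z) / θ ^ k) * modelKernel n σ z := by
            gcongr
            linarith
        _ = _ := by ring
  have hint := integral_mono_of_nonneg (μ := volume)
    (ae_of_all _ fun z => mul_nonneg (le_max_right _ _) (modelKernel_nonneg hσ z))
    ((i3.const_mul 6).add (i2.const_mul (2 / θ ^ k))) (ae_of_all _ hpt)
  refine hint.trans ?_
  rw [integral_add' (i3.const_mul 6) (i2.const_mul (2 / θ ^ k)), integral_const_mul,
    integral_const_mul, integral_indicator hmB.compl, integral_rpow_modelKernel hα' hb0, e2]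
  have hb1 : 1 ≤ b := by linarith
  refine add_le_add ?_ ?_
  · have h1 : b ^ (-(σ - α)) ≤ b ^ (-(σ₀ / 2)) :=
      Real.rpow_le_rpow_of_exponent_le hb1 (by linarith)
    have h2 : b ^ (-(σ - α)) / (σ - α) ≤ b ^ (-(σ₀ / 2)) / (σ₀ / 2) := by
      gcongr
      linarith
    calc 6 * ((2 - σ) * (sphereArea n * (b ^ (-(σ - α)) / (σ - α))))
        ≤ 6 * (2 * (sphereArea n * (b ^ (-(σ₀ / 2)) / (σ₀ / 2)))) := by
          have h3 : 0 ≤ b ^ (-(σ - α)) / (σ - α) :=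
            div_nonneg (by positivity) (by linarith)
          gcongr
          linarith
      _ = _ := by field_simp; ring
  · have h3 : 0 ≤ ∫ y, farPart w (x₀ + y) * modelKernel n σ y :=
      integral_nonneg fun y => mul_nonneg (farPart_nonneg w _) (modelKernel_nonneg hσ y)
    have h4 : ∫ y, farPart w (x₀ + y) * modelKernel n σ y ≤ 2 ^ (n + 2) * η :=
      e1.trans (by gcongr)
    calc 2 / θ ^ k * (r ^ σ * ∫ y, farPart w (x₀ + y) * modelKernel n σ y)
        ≤ 2 / θ ^ k * (θ ^ k * (2 ^ (n + 2) * η)) := by gcongr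
      _ = _ := by field_simp

end Iteration

/-! ### Decay of oscillation and the normalized estimate. -/

section Holder

variable {n : ℕ}

lemma farPart_neg (u : Rn n → ℝ) : farPart (fun z => - u z) = farPart u := by
  simp [farPart]

/-- The Hölder estimate for normalized functions. -/
theorem exists_holder_normalized (n : ℕ) [NeZero n] {σ₀ lmin lmax : ℝ} (hσ₀ : 0 < σ₀)
    (hσ₀2 : σ₀ < 2) (hmin : 0 < lmin) (hmax : 0 < lmax) :
    ∃ α η C : ℝ, 0 < α ∧ α < 1 ∧ 0 < η ∧ 0 < C ∧
      ∀ σ, σ₀ ≤ σ → σ < 2 → ∀ (K : Rn n → Rn n → ℝ) (u : Rn n → ℝ),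
        Supersol σ lmin lmax K η (Metric.ball 0 1) u →
        Supersol σ lmin lmax K η (Metric.ball 0 1) (fun z => - u z) →
        (∀ x, ‖x‖ < 1 → |u x| ≤ η) → ∫ z, farPart u z * modelKernel n σ z ≤ η →
        ∀ x y : Rn n, ‖x‖ < 1 / 2 → ‖y‖ < 1 / 2 → |u x - u y| ≤ C * ‖x - y‖ ^ α := by
  obtain ⟨ε, κ, hε, hκ, hκ1, hgrowth⟩ := exists_growth_of_small_tail n hσ₀ hmin hmax
  have hω := sphereArea_pos n
  -- A gain of κ/2 at one end of an interval of half-length 1 leaves half-length 1 - κ/4.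
  set θ : ℝ := 1 - κ / 4 with hθdef
  have hθ0 : 0 < θ := by linarith
  have hθ1 : θ < 1 := by linarith
  -- Taking b large makes α = -log_b θ at most σ₀/2 and the growth term of `rescaled_tail_le` at
  -- most ε/2.
  obtain ⟨b, hb16, hbθ, hbε⟩ : ∃ b : ℝ, 16 ≤ b ∧ b ^ (-(σ₀ / 2)) < θ ∧
      b ^ (-(σ₀ / 2)) < ε / 2 / (24 * sphereArea n / σ₀) := by
    have hlim := tendsto_rpow_neg_atTop (show 0 < σ₀ / 2 by positivity)
    exact ((eventually_ge_atTop 16).and ((hlim.eventually (gt_mem_nhds hθ0)).and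
      (hlim.eventually (gt_mem_nhds (by positivity))))).exists
  have hb0 : 0 < b := by linarith
  have hb1 : 1 < b := by linarith
  set α : ℝ := - Real.logb b θ with hα
  have hθα : θ = b ^ (-α) := by rw [hα, neg_neg, Real.rpow_logb hb0 hb1.ne' hθ0]
  have hα0 : 0 < α := by rw [hα, neg_pos]; exact Real.logb_neg hb1 hθ0 hθ1
  have hασ : α ≤ σ₀ / 2 := by
    rw [hθα, Real.rpow_lt_rpow_left_iff hb1] at hbθ
    linarith
  set η : ℝ := min (1 / 2) (min (ε / 2) (ε / (4 * 2 ^ (n + 2)))) with hη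
  have hη0 : 0 < η := by positivity
  have hη1 : η ≤ 1 / 2 := min_le_left _ _
  have hη2 : η ≤ ε / 2 := (min_le_right _ _).trans (min_le_left _ _)
  have hη3 : 2 * 2 ^ (n + 2) * η ≤ ε / 2 := by
    have : η ≤ ε / (4 * 2 ^ (n + 2)) := (min_le_right _ _).trans (min_le_right _ _)
    rw [le_div_iff₀ (by positivity)] at this
    linarith
  refine ⟨α, η, 4 * b, hα0, by linarith, hη0, by positivity, ?_⟩
  intro σ hσσ hσ K u hSp hSm hu hfar
  have hσ0 : 0 < σ := hσ₀.trans_le hσσ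
  have hscale : ∀ k : ℕ, (1 / 2 * b⁻¹ ^ (k + 1)) ^ σ ≤ θ ^ k := by
    intro k
    have h1 : 1 / 2 * b⁻¹ ^ (k + 1) ≤ b⁻¹ ^ k := by
      have h3 : b⁻¹ ≤ 1 := inv_le_one_of_one_le₀ hb1.le
      have h2 : 0 < b⁻¹ ^ k := by positivity
      rw [pow_succ]
      nlinarith
    calc (1 / 2 * b⁻¹ ^ (k + 1)) ^ σ ≤ (b⁻¹ ^ k) ^ σ :=
          Real.rpow_le_rpow (by positivity) h1 hσ0.le
      _ = (b ^ (-σ)) ^ k := by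
          rw [← Real.rpow_natCast, ← Real.rpow_natCast, ← Real.rpow_mul (by positivity),
            Real.inv_rpow hb0.le, ← Real.rpow_neg hb0.le, ← Real.rpow_mul hb0.le]
          congr 1
          ring
      _ ≤ θ ^ k := by
          rw [hθα]
          refine pow_le_pow_left₀ (by positivity) ?_ k
          exact Real.rpow_le_rpow_of_exponent_le hb1.le (by linarith)
  -- one step of the iteration, applied to `u` and to `-u`
  have hstep : ∀ w : Rn n → ℝ, Supersol σ lmin lmax K η (Metric.ball 0 1) w →
      (∀ x, ‖x‖ < 1 → |w x| ≤ 1 / 2) → ∫ z, farPart w z * modelKernel n σ z ≤ η →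
      ∀ x₀ : Rn n, ‖x₀‖ < 1 / 2 → ∀ k : ℕ,
      (∀ j ≤ k, ∃ m, ∀ x, ‖x - x₀‖ ≤ 1 / 2 * b⁻¹ ^ j → |w x - m| ≤ θ ^ j) → ∀ m : ℝ,
      (∀ x, ‖x - x₀‖ ≤ 1 / 2 * b⁻¹ ^ k → |w x - m| ≤ θ ^ k) →
      1 / 2 * volume.real (Metric.closedBall (0 : Rn n) 1) ≤
        volume.real (Metric.closedBall (0 : Rn n) 1 ∩
          {z | m ≤ w (x₀ + (1 / 2 * b⁻¹ ^ (k + 1)) • z)}) →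
      ∀ x, ‖x - x₀‖ ≤ 1 / 2 * b⁻¹ ^ (k + 1) → m - θ ^ k + κ / 2 * θ ^ k ≤ w x := by
    intro w hS hw hwfar x₀ hx₀ k hosc m hm hhalf x hx
    have hθk : 0 < θ ^ k := by positivity
    have hsc := hscale k
    set r : ℝ := 1 / 2 * b⁻¹ ^ (k + 1) with hr
    have hr0 : 0 < r := by positivity
    have hrb : r * b = 1 / 2 * b⁻¹ ^ k := by rw [hr, pow_succ]; field_simp
    have hrb1 : r * b ≤ 1 / 2 := by
      rw [hrb]
      have : b⁻¹ ^ k ≤ 1 := pow_le_one₀ (by positivity) (inv_le_one_of_one_le₀ hb1.le)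
      linarith
    have hsub : Metric.ball (0 : Rn n) b ⊆ (fun z => x₀ + r • z) ⁻¹' Metric.ball 0 1 := by
      intro z hz
      have hz' : ‖z‖ < b := by simpa using hz
      have h1 : ‖x₀ + r • z‖ ≤ ‖x₀‖ + r * ‖z‖ := by
        simpa [norm_smul, Real.norm_of_nonneg hr0.le] using norm_add_le x₀ (r • z)
      simp only [mem_preimage, Metric.mem_ball, dist_zero_right]
      nlinarith
    -- The rescaled function v = 2(w - m)/θ^k + 2 is nonnegative in the ball of radius b and at
    -- least 2 where w ≥ m; the bound v ≥ κ returns the gain (κ/2)θ^k.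
    have hSv := ((hS.rescale hσ0 x₀ hr0).affine hσ0 (show 0 < 2 / θ ^ k by positivity)
      (2 - 2 / θ ^ k * m)).mono (c' := ε) (by
        calc 2 / θ ^ k * (r ^ σ * η) ≤ 2 / θ ^ k * (θ ^ k * (ε / 2)) := by gcongr
          _ = ε := by field_simp) hsub
    have hv : ∀ z, 2 / θ ^ k * w (x₀ + r • z) + (2 - 2 / θ ^ k * m) =
        2 / θ ^ k * (w (x₀ + r • z) - m) + 2 := fun z => by ring
    simp only [hv] at hSv
    have hv0 : ∀ z : Rn n, ‖z‖ < b → 0 ≤ 2 / θ ^ k * (w (x₀ + r • z) - m) + 2 := by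
      intro z hz
      have h1 := (abs_le.1 (hm (x₀ + r • z) (by
        rw [add_sub_cancel_left, norm_smul, Real.norm_of_nonneg hr0.le, ← hrb]
        gcongr))).1
      have h2 : 2 / θ ^ k * (-θ ^ k) ≤ 2 / θ ^ k * (w (x₀ + r • z) - m) := by gcongr
      have h3 : 2 / θ ^ k * (-θ ^ k) = -2 := by field_simp
      linarith
    have htail := rescaled_tail_le hσ₀ hσσ hσ hb16 hα0 hασ hθα hS.tailIntegrable hwfar hw hx₀ hosc
      hm hsc (fun z => rfl) hv0
    have htail' : 24 * sphereArea n / σ₀ * b ^ (-(σ₀ / 2)) + 2 * 2 ^ (n + 2) * η ≤ ε := by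
      rw [lt_div_iff₀ (by positivity)] at hbε
      linarith
    have hres := hgrowth σ hσσ hσ _ _ b hb16 hSv hv0 (htail.trans htail') (hhalf.trans
      (measureReal_mono (fun z hz => ⟨hz.1, by
        have h1 : m ≤ w (x₀ + r • z) := hz.2
        have h2 : 0 ≤ 2 / θ ^ k * (w (x₀ + r • z) - m) :=
          mul_nonneg (by positivity) (by linarith)
        simp only [mem_ofPred_eq]
        linarith⟩)
        (measure_lt_top_of_subset inter_subset_left measure_closedBall_lt_top.ne).ne))
      (r⁻¹ • (x - x₀)) (by
        rw [mem_closedBall_zero_iff, norm_smul, norm_inv, Real.norm_of_nonneg hr0.le,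
          inv_mul_le_iff₀ hr0, mul_one]
        exact hx)
    rw [smul_smul, mul_inv_cancel₀ hr0.ne', one_smul, add_sub_cancel] at hres
    have h4 : θ ^ k / 2 * κ ≤ θ ^ k / 2 * (2 / θ ^ k * (w x - m) + 2) := by gcongr
    have h5 : θ ^ k / 2 * (2 / θ ^ k * (w x - m) + 2) = w x - m + θ ^ k := by field_simp
    linarith
  have hu2 : ∀ x, ‖x‖ < 1 → |u x| ≤ 1 / 2 := fun x hx => (hu x hx).trans hη1
  have hosc : ∀ x₀ : Rn n, ‖x₀‖ < 1 / 2 → ∀ k : ℕ,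
      ∃ m, ∀ x, ‖x - x₀‖ ≤ 1 / 2 * b⁻¹ ^ k → |u x - m| ≤ θ ^ k := by
    intro x₀ hx₀ k
    induction k using Nat.strong_induction_on with
    | _ k ih =>
      rcases Nat.eq_zero_or_pos k with rfl | hk
      · refine ⟨0, fun x hx => ?_⟩
        have h1 : ‖x‖ ≤ ‖x - x₀‖ + ‖x₀‖ := by simpa using norm_add_le (x - x₀) x₀
        rw [pow_zero, mul_one] at hx
        rw [sub_zero, pow_zero]
        exact (hu2 x (by linarith)).trans (by norm_num)
      · obtain ⟨k, rfl⟩ := Nat.exists_eq_succ_of_ne_zero hk.ne'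
        have ih' : ∀ j ≤ k, ∃ m, ∀ x, ‖x - x₀‖ ≤ 1 / 2 * b⁻¹ ^ j → |u x - m| ≤ θ ^ j :=
          fun j hj => ih j (Nat.lt_succ_of_le hj)
        obtain ⟨m, hm⟩ := ih' k le_rfl
        have hθk : 0 < θ ^ k := by positivity
        have hsmall : ∀ x, ‖x - x₀‖ ≤ 1 / 2 * b⁻¹ ^ (k + 1) →
            ‖x - x₀‖ ≤ 1 / 2 * b⁻¹ ^ k := by
          intro x hx
          refine hx.trans ?_
          have : b⁻¹ ^ (k + 1) ≤ b⁻¹ ^ k := pow_le_pow_of_le_one (by positivity)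
            (inv_le_one_of_one_le₀ hb1.le) (Nat.le_succ k)
          linarith
        have hθs : θ ^ (k + 1) = θ ^ k - κ / 4 * θ ^ k := by rw [pow_succ, hθdef]; ring
        set A : Set (Rn n) := Metric.closedBall (0 : Rn n) 1 ∩
          {z | m ≤ u (x₀ + (1 / 2 * b⁻¹ ^ (k + 1)) • z)}
        set B : Set (Rn n) := Metric.closedBall (0 : Rn n) 1 ∩
          {z | -m ≤ - u (x₀ + (1 / 2 * b⁻¹ ^ (k + 1)) • z)}
        -- One of {u ≥ m} and {u ≤ m} fills half of the ball, so the step applies to u or to -u.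
        have hAB : volume.real (Metric.closedBall (0 : Rn n) 1) ≤ volume.real A + volume.real B := by
          refine (measureReal_mono (fun z hz => ?_) (measure_union_ne_top
            (measure_lt_top_of_subset inter_subset_left measure_closedBall_lt_top.ne).ne
            (measure_lt_top_of_subset inter_subset_left measure_closedBall_lt_top.ne).ne)).trans
            (measureReal_union_le A B)
          rcases le_total m (u (x₀ + (1 / 2 * b⁻¹ ^ (k + 1)) • z)) with h | h
          · exact Or.inl ⟨hz, h⟩
          · exact Or.inr ⟨hz, neg_le_neg h⟩
        rcases le_or_gt (1 / 2 * volume.real (Metric.closedBall (0 : Rn n) 1)) (volume.real A)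
          with hA | hA
        · refine ⟨m + κ / 4 * θ ^ k, fun x hx => ?_⟩
          have h1 := hstep u hSp hu2 hfar x₀ hx₀ k ih' m hm hA x hx
          have h2 := abs_le.1 (hm x (hsmall x hx))
          rw [hθs]
          exact abs_le.2 ⟨by linarith, by linarith⟩
        · refine ⟨m - κ / 4 * θ ^ k, fun x hx => ?_⟩
          have hneg : ∀ a : ℝ, ∀ x, |(- u x) - -a| = |u x - a| := fun a x => by
            rw [← abs_neg]; congr 1; ring
          have h1 := hstep (fun z => - u z) hSm (fun x hx => by rw [abs_neg]; exact hu2 x hx)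
            (by rw [farPart_neg]; exact hfar) x₀ hx₀ k
            (fun j hj => by
              obtain ⟨m', hm'⟩ := ih' j hj
              exact ⟨-m', fun x hx => by rw [hneg]; exact hm' x hx⟩) (-m)
            (fun x hx => by rw [hneg]; exact hm x hx) (by linarith) x hx
          have h2 := abs_le.1 (hm x (hsmall x hx))
          rw [hθs]
          exact abs_le.2 ⟨by linarith, by linarith⟩
  intro x y hx hy
  rcases eq_or_ne x y with rfl | hxy
  · simp [Real.zero_rpow hα0.ne']
  have hd0 : 0 < ‖x - y‖ := norm_pos_iff.2 (sub_ne_zero.2 hxy)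
  have hα1 : α < 1 := by linarith
  rcases le_or_gt ‖x - y‖ (1 / 2) with hd | hd
  · obtain ⟨k, hk1, hk2⟩ := exists_nat_pow_near (show 1 ≤ 1 / 2 / ‖x - y‖ by
      rw [le_div_iff₀ hd0]; linarith) hb1
    obtain ⟨m, hm⟩ := hosc y hy k
    have h1 := abs_le.1 (hm x (by
      rw [le_div_iff₀ hd0] at hk1
      rw [inv_pow, ← div_eq_mul_inv, le_div_iff₀ (by positivity)]
      linarith))
    have h2 := abs_le.1 (hm y (by simp; positivity))
    have h3 : |u x - u y| ≤ 2 * θ ^ k := abs_le.2 ⟨by linarith, by linarith⟩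
    have h4 : θ ^ k ≤ 2 * b * ‖x - y‖ ^ α := by
      have e1 : θ ^ k = (b⁻¹ ^ k) ^ α := by
        rw [hθα, ← Real.rpow_natCast, ← Real.rpow_natCast, ← Real.rpow_mul hb0.le,
          ← Real.rpow_mul (by positivity), Real.inv_rpow hb0.le, ← Real.rpow_neg hb0.le]
        congr 1
        ring
      have e2 : b⁻¹ ^ k ≤ 2 * b * ‖x - y‖ := by
        rw [div_lt_iff₀ hd0, pow_succ] at hk2
        rw [inv_pow, inv_le_iff_one_le_mul₀ (by positivity)]
        linarith
      calc θ ^ k ≤ (2 * b * ‖x - y‖) ^ α := by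
            rw [e1]; exact Real.rpow_le_rpow (by positivity) e2 hα0.le
        _ = (2 * b) ^ α * ‖x - y‖ ^ α := Real.mul_rpow (by positivity) hd0.le
        _ ≤ (2 * b) ^ (1 : ℝ) * ‖x - y‖ ^ α := by
            gcongr
            · linarith
        _ = _ := by rw [Real.rpow_one]
    linarith
  · have h1 := abs_le.1 (hu2 x (by linarith))
    have h2 := abs_le.1 (hu2 y (by linarith))
    have h3 : |u x - u y| ≤ 1 := abs_le.2 ⟨by linarith, by linarith⟩
    have h4 : 1 / 2 ≤ ‖x - y‖ ^ α := by
      calc (1 : ℝ) / 2 = (1 / 2) ^ (1 : ℝ) := by rw [Real.rpow_one]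
        _ ≤ (1 / 2) ^ α := Real.rpow_le_rpow_of_exponent_ge (by norm_num) (by norm_num) hα1.le
        _ ≤ _ := Real.rpow_le_rpow (by norm_num) hd.le hα0.le
    nlinarith

end Holder

/-! ### Removal of the normalization. -/

section Main

variable {n : ℕ}

lemma enorm_le_supNormOn {S : Set (Rn n)} {u : Rn n → ℝ} {x : Rn n} (hx : x ∈ S) :
    ‖u x‖ₑ ≤ supNormOn S u :=
  le_iSup₂ (f := fun x (_ : x ∈ S) => ‖u x‖ₑ) x hx

lemma supNormOn_mono {S S' : Set (Rn n)} (h : S ⊆ S') (u : Rn n → ℝ) :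
    supNormOn S u ≤ supNormOn S' u :=
  iSup₂_le fun _ hx => enorm_le_supNormOn (h hx)

lemma abs_le_of_enorm_le {a : ℝ} {s : ℝ≥0∞} (hs : s ≠ ∞) (h : ‖a‖ₑ ≤ s) : |a| ≤ s.toReal := by
  have := ENNReal.toReal_mono hs h
  simpa using this

lemma lintegral_farPart {σ : ℝ} (hσ : σ < 2) (u : Rn n → ℝ) :
    ∫⁻ z, ENNReal.ofReal (farPart u z * modelKernel n σ z) = tail σ u := by
  rw [tail, ← lintegral_const_mul' _ _ ENNReal.ofReal_ne_top,
    ← lintegral_indicator Metric.isOpen_ball.measurableSet.compl]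
  refine lintegral_congr fun z => ?_
  rcases lt_or_ge ‖z‖ 1 with hz | hz
  · rw [farPart_of_lt u hz, indicator_of_notMem (by simpa using hz), zero_mul, ENNReal.ofReal_zero]
  · have hz0 : 0 < ‖z‖ := by linarith
    rw [farPart_of_ge u hz, indicator_of_mem (by simpa using hz), modelKernel,
      ← ofReal_norm, ← ofReal_norm, ENNReal.ofReal_rpow_of_pos hz0,
      ← ENNReal.ofReal_div_of_pos (by positivity), ← ENNReal.ofReal_mul (by linarith),
      show -(n : ℝ) - σ = -((n : ℝ) + σ) by ring, Real.rpow_neg hz0.le, Real.norm_eq_abs]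
    congr 1
    ring

lemma integral_farPart_eq {σ : ℝ} (hσ : σ < 2) {u : Rn n → ℝ} (hu : TailIntegrable σ u) :
    ∫ z, farPart u z * modelKernel n σ z = (tail σ u).toReal := by
  rw [integral_eq_lintegral_of_nonneg_ae (ae_of_all _ fun z =>
    mul_nonneg (farPart_nonneg u z) (modelKernel_nonneg hσ z))
    (hu.farPart.aestronglyMeasurable.mul (measurable_modelKernel σ).aestronglyMeasurable),
    lintegral_farPart hσ]

/-- The Hölder estimate with constants that are uniform for orders in `[σ₀, 2)`. -/
theorem exists_holder_estimate (n : ℕ) [NeZero n] {σ₀ lmin lmax : ℝ} (hσ₀ : 0 < σ₀)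
    (hσ₀2 : σ₀ < 2) (hmin : 0 < lmin) (hmax : 0 < lmax) :
    ∃ α C : ℝ≥0, 0 < α ∧ α < 1 ∧ 0 < C ∧ ∀ σ, σ₀ ≤ σ → σ < 2 →
      ∀ (K : Rn n → Rn n → ℝ) (f u : Rn n → ℝ),
        (∀ x ∈ Metric.ball (0 : Rn n) 1, IsComparableKernel n σ lmin lmax (K x)) →
        IsViscositySolution σ K f (Metric.ball 0 1) u →
        holderNormOn α (Metric.ball 0 (1 / 2)) u ≤
          (C : ℝ≥0∞) * (supNormOn (Metric.ball 0 1) f + supNormOn (Metric.ball 0 1) u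
            + tail σ u) := by
  obtain ⟨α, η, C, hα0, hα1, hη, hC, hmain⟩ := exists_holder_normalized n hσ₀ hσ₀2 hmin hmax
  lift α to ℝ≥0 using hα0.le
  refine ⟨α, 1 + (C / η).toNNReal, by exact_mod_cast hα0, by exact_mod_cast hα1, by positivity, ?_⟩
  intro σ hσσ hσ K f u hK hsol
  have hσ0 : 0 < σ := hσ₀.trans_le hσσ
  set S : ℝ≥0∞ := supNormOn (Metric.ball 0 1) f + supNormOn (Metric.ball 0 1) u + tail σ u with hS
  rcases eq_or_ne S ∞ with hStop | hStop
  · rw [hStop, ENNReal.mul_top (by simp)]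
    exact le_top
  have hut : TailIntegrable σ u := hsol.integrable
  have hf : ∀ x ∈ Metric.ball (0 : Rn n) 1, |f x| ≤ S.toReal := fun x hx =>
    abs_le_of_enorm_le hStop ((enorm_le_supNormOn hx).trans
      (le_add_right (le_add_right le_rfl)))
  have hu : ∀ x ∈ Metric.ball (0 : Rn n) 1, |u x| ≤ S.toReal := fun x hx =>
    abs_le_of_enorm_le hStop ((enorm_le_supNormOn hx).trans
      (le_add_right (le_add_left le_rfl)))
  have hfar : ∫ z, farPart u z * modelKernel n σ z ≤ S.toReal := by
    rw [integral_farPart_eq hσ hut]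
    exact ENNReal.toReal_mono hStop (le_add_left le_rfl)
  have hp := hsol.super.supersol (c := S.toReal) Metric.isOpen_ball hσ0 hσ hmin hK hut
    hsol.continuousOn fun x hx => (abs_le.1 (hf x hx)).2
  have hm := hsol.sub.neg.supersol (c := S.toReal) Metric.isOpen_ball hσ0 hσ hmin hK hut.neg
    hsol.continuousOn.neg fun x hx => by linarith [(abs_le.1 (hf x hx)).1]
  -- The divisor is any positive A ≥ S/η, since S itself may vanish; `hB` then lets A decrease to
  -- S/η.
  have hA : ∀ A : ℝ, 0 < A → S.toReal ≤ η * A → ∀ x y : Rn n, ‖x‖ < 1 / 2 → ‖y‖ < 1 / 2 →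
      |u x - u y| ≤ A * (C * ‖x - y‖ ^ (α : ℝ)) := by
    intro A hA hSA x y hx hy
    have hc : A⁻¹ * S.toReal ≤ η := by rw [inv_mul_le_iff₀ hA]; linarith
    have h1 := (hp.affine hσ0 (inv_pos.2 hA) 0).mono hc subset_rfl
    have h2 := (hm.affine hσ0 (inv_pos.2 hA) 0).mono hc subset_rfl
    simp only [add_zero, mul_neg] at h1 h2
    have h3 := hmain σ hσσ hσ K (fun z => A⁻¹ * u z) h1 h2 (fun x hx => by
        rw [abs_mul, abs_of_pos (inv_pos.2 hA)]
        refine le_trans ?_ hc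
        gcongr
        exact hu x (by simpa using hx)) (by
        refine le_trans (le_of_eq_of_le ?_ (mul_le_mul_of_nonneg_left hfar
          (inv_pos.2 hA).le)) hc
        rw [← integral_const_mul]
        refine integral_congr_ae (ae_of_all _ fun z => ?_)
        have : farPart (fun z => A⁻¹ * u z) z = A⁻¹ * farPart u z := by
          rcases lt_or_ge ‖z‖ 1 with hz | hz
          · rw [farPart_of_lt _ hz, farPart_of_lt _ hz, mul_zero]
          · rw [farPart_of_ge _ hz, farPart_of_ge _ hz, abs_mul, abs_of_pos (inv_pos.2 hA)]
        simp only [this]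
        ring) x y hx hy
    rw [← mul_sub, abs_mul, abs_of_pos (inv_pos.2 hA), inv_mul_le_iff₀ hA] at h3
    exact h3
  have hB : ∀ x y : Rn n, ‖x‖ < 1 / 2 → ‖y‖ < 1 / 2 →
      |u x - u y| ≤ C / η * S.toReal * ‖x - y‖ ^ (α : ℝ) := by
    intro x y hx hy
    have hS0 : 0 ≤ S.toReal := ENNReal.toReal_nonneg
    set g : ℝ := C / η * ‖x - y‖ ^ (α : ℝ) with hg
    have hg0 : 0 ≤ g := by positivity
    refine le_of_forall_pos_le_add fun e he => ?_
    have he' : 0 < e / (g + 1) := by positivity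
    have h1 := hA ((S.toReal + e / (g + 1)) / η) (by positivity)
      (by rw [mul_div_cancel₀ _ hη.ne']; linarith) x y hx hy
    have h2 : (S.toReal + e / (g + 1)) / η * (C * ‖x - y‖ ^ (α : ℝ)) =
        C / η * S.toReal * ‖x - y‖ ^ (α : ℝ) + e * (g / (g + 1)) := by
      rw [hg]; field_simp
    have h3 : g / (g + 1) ≤ 1 := by rw [div_le_one (by linarith)]; linarith
    nlinarith
  have hhol : eHolderNorm α ((Metric.ball (0 : Rn n) (1 / 2)).domRestrict u) ≤
      ((C / η).toNNReal * S.toNNReal : ℝ≥0) := by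
    refine HolderWith.eHolderNorm_le fun x y => ?_
    have h1 := hB x y (by simpa using x.2) (by simpa using y.2)
    rw [edist_dist, edist_dist, ENNReal.ofReal_rpow_of_nonneg dist_nonneg (NNReal.coe_nonneg α),
      ← ENNReal.ofReal_coe_nnreal, ← ENNReal.ofReal_mul (by positivity)]
    refine ENNReal.ofReal_le_ofReal ?_
    rw [NNReal.coe_mul, Real.coe_toNNReal _ (by positivity), Subtype.dist_eq, Real.dist_eq,
      dist_eq_norm]
    exact h1
  rw [holderNormOn]
  have hSS : (S.toNNReal : ℝ≥0∞) = S := ENNReal.coe_toNNReal hStop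
  push_cast at hhol ⊢
  rw [hSS] at hhol
  rw [add_mul, one_mul]
  refine add_le_add ((supNormOn_mono (Metric.ball_subset_ball (by norm_num)) u).trans
    (le_add_right (le_add_left le_rfl))) hhol

end Main

end NonlocalHolder

theorem theorem4p3 (n : ℕ) (hn : 1 ≤ n) (lmin lmax : ℝ) (hmin : 0 < lmin) (hmax : 0 < lmax) :
    ∃ α C : ℝ → ℝ≥0,
      (∃ σ₀ ∈ Set.Ioo (0 : ℝ) 2, ∃ α₀ C₀ : ℝ≥0,
        ∀ σ ∈ Set.Ioo σ₀ 2, α σ = α₀ ∧ C σ = C₀) ∧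
      ∀ σ ∈ Set.Ioo (0 : ℝ) 2, 0 < α σ ∧ α σ < 1 ∧ 0 < C σ ∧
        ∀ (K : NonlocalHolder.Rn n → NonlocalHolder.Rn n → ℝ) (f u : NonlocalHolder.Rn n → ℝ),
          (∀ x ∈ Metric.ball (0 : NonlocalHolder.Rn n) 1,
            NonlocalHolder.IsComparableKernel n σ lmin lmax (K x)) →
          NonlocalHolder.IsViscositySolution σ K f (Metric.ball 0 1) u →
          NonlocalHolder.holderNormOn (α σ) (Metric.ball 0 (1 / 2)) u ≤
            (C σ : ℝ≥0∞) * (NonlocalHolder.supNormOn (Metric.ball 0 1) f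
              + NonlocalHolder.supNormOn (Metric.ball 0 1) u
              + NonlocalHolder.tail σ u) := by
  have : NeZero n := ⟨by omega⟩
  have h := fun (σ₀ : ℝ) (h0 : 0 < σ₀) (h2 : σ₀ < 2) =>
    NonlocalHolder.exists_holder_estimate n h0 h2 hmin hmax
  choose! α C hα hα1 hC hest using h
  -- The uniform estimate on `[min σ 1, 2)` covers the order σ, and for σ > 1 its constants no
  -- longer depend on σ.
  refine ⟨fun σ => α (min σ 1), fun σ => C (min σ 1),
    ⟨1, ⟨one_pos, one_lt_two⟩, α 1, C 1, fun σ hσ => ?_⟩, fun σ hσ => ?_⟩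
  · simp only [min_eq_right hσ.1.le, and_self]
  · have h0 : 0 < min σ 1 := lt_min hσ.1 one_pos
    have h2 : min σ 1 < 2 := (min_le_right _ _).trans_lt one_lt_two
    exact ⟨hα _ h0 h2, hα1 _ h0 h2, hC _ h0 h2, hest _ h0 h2 σ (min_le_left _ _) hσ.2⟩
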